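/- Let $a<b$, $q\in(0,1)$, and let $W:\mathbb R\to[0,\infty)$ be continuous with $W^{-1}(\{0\})=\{a,b\}$, $W\in C^2(\mathbb R\setminus\{a,b\})$, and such that the limits $\lim_{s\to a}W''(s)|s-a|^{1-q}$ and $\lim_{s\to b}W''(s)|s-b|^{1-q}$ exist in $(0,\infty)$. Put $\mathrm d_W(r,s)=\left|\int_r^s2\sqrt{W(\rho)}\,d\rho\right|$. For $\alpha\in[a,b]$ let $\Psi_\alpha(x)=\int_\alpha^x W(s)^{-1/2}\,ds$ for $x\in[\alpha,b]$, and let $z_\alpha:[0,\infty)\to[a,b]$ be $\Psi_\alpha^{-1}$ on $[0,\Psi_\alpha(b)]$ and $b$ on $(\Psi_\alpha(b),\infty)$; thus $z_\alpha'=\sqrt{W(z_\alpha)}$ and $z_\alpha(0)=\alpha$. Let $\alpha_-\in(a,b)$. There is $\delta>0$, depending only on $W$ and $\alpha_-$, such that the following holds for every $\kappa_0<0$. Let $0<T\le1$ and let $\omega\in C^1([0,T])$ be positive with $\omega(0)=1$ and $\max_{[0,T]}\omega-\min_{[0,T]}\omega<\delta$, and assume that $\omega'\ge-\kappa_0/2$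 on $[0,T]$ in case $\omega'(0)\ge-\kappa_0$. Let $\alpha\in[a,b]$ and, for $\varepsilon>0$, let $\alpha_\varepsilon\in[a,b]$ and $\beta_\varepsilon\in[\alpha_-,b]$ be such that $\alpha_\varepsilon\to\alpha$, $\beta_\varepsilon\to b$, $\mathrm d_W(\alpha_\varepsilon,\alpha)=o(\varepsilon)$ and $\mathrm d_W(\beta_\varepsilon,b)=o(\varepsilon)$ as $\varepsilon\to0^+$, and such that for every $\varepsilon>0$ $$\alpha_\varepsilon\in[\alpha_-,b]\quad\text{or}\quad\omega'(0)\ge-\kappa_0 .$$ On $L^1((0,T))$ define $$G^{(0)}_\varepsilon(v)=\int_0^T\big(W(v)+\varepsilon^2(v')^2\big)\omega\,dt,\qquad G^{(2)}_\varepsilon(v)=\int_0^T\Big(\frac{W(v)}{\varepsilon^2}+(v')^2\Big)\omega\,dt-\frac{\omega(0)}{\varepsilon}\mathrm d_W(b,\alpha)$$ if $v\in H^1((0,T))$, $v(0)=\alpha_\varepsilon$ and $v(T)=\beta_\varepsilon$, and $G^{(0)}_\varepsilon(v)=G^{(2)}_\varepsilon(v)=\infty$ otherwise. (1) If $v_\varepsilon$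 is a minimizer of $G^{(0)}_\varepsilon$ for every $\varepsilon>0$, then $$\liminf_{\varepsilon\to0^+}G^{(2)}_\varepsilon(v_\varepsilon)\ \ge\ \omega'(0)\int_0^\infty2\sqrt{W(z_\alpha(s))}\,z_\alpha'(s)\,s\,ds .$$ (2) For every $L$ and every function $\rho$ with $\rho(\varepsilon)\to0$ as $\varepsilon\to0^+$ there are $M'>0$ and $\varepsilon_0>0$, depending only on $W,\alpha_-,\kappa_0,L$ and $\rho$, such that for all $T,\omega,\alpha,(\alpha_\varepsilon),(\beta_\varepsilon)$ as above with $\|\omega\|_{C^1([0,T])}\le L$ and $b-\beta_\varepsilon\le\rho(\varepsilon)$ for all $\varepsilon>0$, all $\varepsilon\in(0,\varepsilon_0)$ and every minimizer $v_\varepsilon$ of $G^{(0)}_\varepsilon$, $$G^{(2)}_\varepsilon(v_\varepsilon)\ \ge\ -M'\Big(1+\frac{\mathrm d_W(\alpha_\varepsilon,\alpha)+\mathrm d_W(\beta_\varepsilon,b)}{\varepsilon}\Big).$$ -/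

import Mathlib

open MeasureTheory Set Filter Topology Asymptotics

noncomputable section

/-- `W : ℝ → [0,∞)` is a continuous double-well potential with wells `a < b`, of class `C²` away
from the wells, with `W''(s) |s - a|^(1-q)` and `W''(s) |s - b|^(1-q)` having limits in `(0,∞)` as
`s → a` and `s → b` respectively, for the exponent `q ∈ (0,1)` (subquadratic wells). -/
structure IsSubquadraticDoubleWell (W : ℝ → ℝ) (a b q : ℝ) : Prop where
  lt : a < b
  q_mem : q ∈ Ioo (0 : ℝ) 1
  continuous : Continuous W
  nonneg : ∀ s, 0 ≤ W s
  eq_zero_iff : ∀ s, W s = 0 ↔ s = a ∨ s = b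
  contDiffOn : ContDiffOn ℝ 2 W {a, b}ᶜ
  growth_left : ∃ c : ℝ, 0 < c ∧
    Tendsto (fun s => deriv (deriv W) s * |s - a| ^ (1 - q)) (𝓝[≠] a) (𝓝 c)
  growth_right : ∃ c : ℝ, 0 < c ∧
    Tendsto (fun s => deriv (deriv W) s * |s - b| ^ (1 - q)) (𝓝[≠] b) (𝓝 c)

/-- The geodesic distance `d_W(r,s) = |∫_r^s 2 √W(ρ) dρ|`. -/
def geodDist (W : ℝ → ℝ) (r s : ℝ) : ℝ := |∫ ρ in r..s, 2 * √(W ρ)|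

/-- `Ψ_α(x) = ∫_α^x W(s)^(-1/2) ds`. -/
def travelTime (W : ℝ → ℝ) (α x : ℝ) : ℝ := ∫ s in α..x, 1 / √(W s)

open Classical in
/-- The optimal profile `z_α`: the inverse of `Ψ_α : [α,b] → [0, Ψ_α(b)]` on `[0, Ψ_α(b)]`, and
the constant `b` afterwards. For `α = a` it leaves the well `a` immediately. -/
def profile (W : ℝ → ℝ) (b α t : ℝ) : ℝ :=
  if t ∈ Icc 0 (travelTime W α b) then Function.invFunOn (travelTime W α) (Icc α b) t else b

/-- Lebesgue measure on the open interval `I = (0,T)`. -/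
abbrev volI (T : ℝ) : Measure ℝ := volume.restrict (Ioo 0 T)

/-- `g` is a weak derivative of `v` on `(0,T)` that belongs to `L²((0,T))`. -/
def HasL2WeakDeriv (T : ℝ) (v g : ℝ → ℝ) : Prop :=
  MemLp g 2 (volI T) ∧
    ∀ φ : ℝ → ℝ, ContDiff ℝ (⊤ : ℕ∞) φ → HasCompactSupport φ → tsupport φ ⊆ Ioo 0 T →
      ∫ t in Ioo 0 T, v t * deriv φ t = -∫ t in Ioo 0 T, g t * φ t

/-- The Sobolev space `H¹((0,T))`. -/
def MemH1 (T : ℝ) (v : ℝ → ℝ) : Prop :=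
  MemLp v 2 (volI T) ∧ ∃ g : ℝ → ℝ, HasL2WeakDeriv T v g

open Classical in
/-- The weak derivative of `v ∈ H¹((0,T))`; it is determined almost everywhere. -/
def weakDeriv (T : ℝ) (v : ℝ → ℝ) : ℝ → ℝ :=
  if h : ∃ g : ℝ → ℝ, HasL2WeakDeriv T v g then h.choose else 0

/-- `v(0) = α` and `v(T) = β`, read on the representative of `v` that is continuous on `[0,T]`. -/
def HasBoundaryValues (T : ℝ) (v : ℝ → ℝ) (α β : ℝ) : Prop :=
  ∃ u : ℝ → ℝ, ContinuousOn u (Icc 0 T) ∧ v =ᵐ[volI T] u ∧ u 0 = α ∧ u T = β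

open Classical in
/-- The weighted functional `G_ε^(0) : L¹((0,T)) → [0,∞]` with boundary data `α`, `β`
(the integrand is integrable for every `v ∈ H¹((0,T))`). -/
def G0 (W ω : ℝ → ℝ) (T ε α β : ℝ) (v : ℝ →₁[volI T] ℝ) : EReal :=
  if MemH1 T v ∧ HasBoundaryValues T v α β then
    ((∫ t in Ioo 0 T, (W (v t) + ε ^ 2 * weakDeriv T v t ^ 2) * ω t : ℝ) : EReal)
  else ⊤

/-- `v` is a minimizer of `G_ε^(0)` on `L¹((0,T))`. -/
def IsMinimizerG0 (W ω : ℝ → ℝ) (T ε α β : ℝ) (v : ℝ →₁[volI T] ℝ) : Prop :=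
  ∀ u : ℝ →₁[volI T] ℝ, G0 W ω T ε α β v ≤ G0 W ω T ε α β u

open Classical in
/-- The second-order functional `G_ε^(2)` with boundary data `αε`, `βε`; here `α` is the limit
of the left boundary values. -/
def G2 (W ω : ℝ → ℝ) (b α T ε αε βε : ℝ) (v : ℝ →₁[volI T] ℝ) : EReal :=
  if MemH1 T v ∧ HasBoundaryValues T v αε βε then
    (((∫ t in Ioo 0 T, (1 / ε ^ 2 * W (v t) + weakDeriv T v t ^ 2) * ω t)
      - ω 0 / ε * geodDist W b α : ℝ) : EReal)
  else ⊤

/-- The derivative of a weight `ω ∈ C¹([0,T])` (one-sided at the endpoints). -/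
def weightDeriv (ω : ℝ → ℝ) (T t : ℝ) : ℝ := derivWithin ω (Icc 0 T) t

/-- `‖ω‖_{C¹([0,T])} = max |ω| + max |ω'|`. -/
def c1Norm (ω : ℝ → ℝ) (T : ℝ) : ℝ :=
  sSup ((fun t => |ω t|) '' Icc 0 T) + sSup ((fun t => |weightDeriv ω T t|) '' Icc 0 T)

/-- Standing assumptions on the interval `(0,T)` and the weight `ω`: `0 < T ≤ 1`, `ω ∈ C¹([0,T])`
is positive with `ω(0) = 1` and oscillation `max ω - min ω < δ`, and if `ω'(0) ≥ -κ₀` then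
`ω' ≥ -κ₀/2` on `[0,T]`. -/
structure IsAdmissibleWeight (ω : ℝ → ℝ) (T κ₀ δ : ℝ) : Prop where
  T_mem : T ∈ Ioc (0 : ℝ) 1
  contDiffOn : ContDiffOn ℝ 1 ω (Icc 0 T)
  pos : ∀ t ∈ Icc 0 T, 0 < ω t
  zero : ω 0 = 1
  osc_lt : ∀ s ∈ Icc 0 T, ∀ t ∈ Icc 0 T, ω s - ω t < δ
  slope_ge : -κ₀ ≤ weightDeriv ω T 0 → ∀ t ∈ Icc 0 T, -κ₀ / 2 ≤ weightDeriv ω T t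

/-- Assumptions on the boundary data `α_ε → α` and `β_ε → b`: they lie in `[a,b]` and
`[α₋,b]`, they converge at rate `o(ε)` in `d_W`, and for every `ε`, `α_ε ∈ [α₋,b]` or
`ω'(0) ≥ -κ₀`. -/
structure IsAdmissibleBoundaryData (W ω : ℝ → ℝ) (a b T αm κ₀ α : ℝ) (αε βε : ℝ → ℝ) : Prop where
  limit_mem : α ∈ Icc a b
  left_mem : ∀ ε > 0, αε ε ∈ Icc a b
  right_mem : ∀ ε > 0, βε ε ∈ Icc αm b
  dichotomy : ∀ ε > 0, αε ε ∈ Icc αm b ∨ -κ₀ ≤ weightDeriv ω T 0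
  left_tendsto : Tendsto αε (𝓝[>] 0) (𝓝 α)
  right_tendsto : Tendsto βε (𝓝[>] 0) (𝓝 b)
  left_rate : (fun ε => geodDist W (αε ε) α) =o[𝓝[>] 0] (fun ε => ε)
  right_rate : (fun ε => geodDist W (βε ε) b) =o[𝓝[>] 0] (fun ε => ε)

end

/-! Write `D(x) = ∫_x^b 2√W` and rescale `t = εs`. A minimizer becomes a path `w` on `[0, T/ε]` with
derivative `k`, with values in `[a,b]` after clamping, and `G2 = (E - D(α))/ε`, where `E = ∫ (W(w) +
k²) η` and `η(s) = ω(εs)`. Completing the square and integrating by parts (`pathEnergy_eq`), the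
energy on `[0,M]` equals `D(w 0) - D(w M) η(M) + ∫ D(w) η' + ∫ (k - √W(w))² η`. Since `η' = ε
ω'(ε·)`, the first integral divided by `ε` should tend to `ω'(0) ∫ D(z_α)`, which is the asserted
right-hand side after another integration by parts (`integral_profile_eq`). It remains to see that
the boundary term at `M` is `o(ε)` and that `w` is close to `z_α`.

Boundary term. If `ω'(0) ≥ -κ₀ > 0`, then `ω` is increasing: integrating up to `T/ε` leaves only
`D(β_ε)` at the endpoint, and the contribution beyond `M` is nonnegative and may be dropped.
Otherwise `α_ε ≥ α₋`, and the small oscillation of `ω` keeps the path away from `a`, because a dip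
towards `a` is paid for on the way in and on the way out (`le_of_pathEnergy_le`). On the remaining
range `W` is comparable to `(b-x)^(1+r)` with `r < 1`. By minimality and a competitor through `b`,
the tail energy, less a terminal contribution, is at most a multiple of `(b-w)^((3+r)/2)`, while it
decreases at rate at least `W(w)/2`. So it satisfies `f' ≤ -c f^θ` with `θ = 2(1+r)/(3+r) < 1` and
is extinct after a time independent of `ε`. At such a time `M₀` one has `D(w M₀) ≤ C D(β_ε) = o(ε)`
(`exists_arrival_time`).

Convergence. If the liminf were too small, then `E ≤ D(α) + cε` along a sequence, and the lower
bound forces `k - √W(w) → 0` in `L²` on `[0,M]`. The equation `w' = √W(w)` has no uniqueness at `a`,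
where solutions may wait, but no solution overtakes `z_α`. Hence `liminf D(w) ≥ D(z_α)`, which
suffices when `ω' ≥ 0`; away from `a` the opposite bound holds as well. Both comparisons use the
travel time of the truncated potential `max W κ`, and `false_of_seq` passes to the limit.

The bound in (2) is the same estimate without the limit: the integral is at least `-ε D(a) |L| S₀`,
and if the boundary data are far off then `E ≥ 0` is already enough. -/

/-! ### Absolutely continuous functions and their almost everywhere derivatives -/

open AbsolutelyContinuousOnInterval in
/-- A map whose increments are controlled by those of an absolutely continuous map is absolutely
continuous. -/
theorem AbsolutelyContinuousOnInterval.of_dist_le {u v : ℝ → ℝ} {c d K : ℝ} (hK : 0 ≤ K)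
    (hu : AbsolutelyContinuousOnInterval u c d)
    (h : ∀ x ∈ uIcc c d, ∀ y ∈ uIcc c d, dist (v x) (v y) ≤ K * dist (u x) (u y)) :
    AbsolutelyContinuousOnInterval v c d := by
  rw [absolutelyContinuousOnInterval_iff] at hu ⊢
  intro ε hε
  obtain ⟨δ, hδ, H⟩ := hu (ε / (K + 1)) (by positivity)
  refine ⟨δ, hδ, fun E hE hlt => ?_⟩
  have h1 := H E hE hlt
  calc ∑ i ∈ Finset.range E.1, dist (v (E.2 i).1) (v (E.2 i).2)
      ≤ ∑ i ∈ Finset.range E.1, K * dist (u (E.2 i).1) (u (E.2 i).2) :=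
        Finset.sum_le_sum fun i hi => h _ (hE.1 i hi).1 _ (hE.1 i hi).2
    _ = K * ∑ i ∈ Finset.range E.1, dist (u (E.2 i).1) (u (E.2 i).2) :=
        (Finset.mul_sum _ _ _).symm
    _ ≤ (K + 1) * ∑ i ∈ Finset.range E.1, dist (u (E.2 i).1) (u (E.2 i).2) := by
        gcongr
        linarith
    _ < (K + 1) * (ε / (K + 1)) := by gcongr
    _ = ε := by field_simp

theorem AbsolutelyContinuousOnInterval.congr_of_eqOn {u v : ℝ → ℝ} {c d : ℝ}
    (hu : AbsolutelyContinuousOnInterval u c d) (h : ∀ x ∈ uIcc c d, v x = u x) :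
    AbsolutelyContinuousOnInterval v c d :=
  hu.of_dist_le (v := v) zero_le_one fun x hx y hy => by rw [h x hx, h y hy, one_mul]

/-- On `[c,d]`, `u` is absolutely continuous with a.e. derivative `g`. -/
structure IsPrimitive (c d : ℝ) (u g : ℝ → ℝ) : Prop where
  le : c ≤ d
  integrable : IntervalIntegrable g volume c d
  eq_add : ∀ t ∈ Icc c d, u t = u c + ∫ s in c..t, g s

namespace IsPrimitive

variable {c d : ℝ} {u v g k : ℝ → ℝ}

theorem ac (h : IsPrimitive c d u g) : AbsolutelyContinuousOnInterval u c d := by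
  have h1 := h.integrable.absolutelyContinuousOnInterval_intervalIntegral (c := c) (by simp)
  refine h1.of_dist_le zero_le_one fun x hx y hy => ?_
  rw [uIcc_of_le h.le] at hx hy
  rw [h.eq_add x hx, h.eq_add y hy, one_mul, dist_add_left]

theorem continuousOn (h : IsPrimitive c d u g) : ContinuousOn u (Icc c d) := by
  have := h.ac.continuousOn
  rwa [uIcc_of_le h.le] at this

theorem ae_hasDerivAt (h : IsPrimitive c d u g) :
    ∀ᵐ x, x ∈ Ioo c d → HasDerivAt u (g x) x := by
  filter_upwards [h.integrable.ae_hasDerivAt_integral] with x hx hxm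
  have h1 := hx (by rw [uIcc_of_le h.le]; exact Ioo_subset_Icc_self hxm) c (by simp)
  refine (h1.const_add (u c)).congr_of_eventuallyEq ?_
  filter_upwards [Ioo_mem_nhds hxm.1 hxm.2] with y hy
  exact h.eq_add y (Ioo_subset_Icc_self hy)

/-- Lebesgue's fundamental theorem of calculus. Most of the calculus rules below go through it,
since absolute continuity and an a.e. derivative are easier to transport than the integral identity.
-/
theorem of_ac (hcd : c ≤ d) (hu : AbsolutelyContinuousOnInterval u c d)
    (hg : ∀ᵐ x, x ∈ Ioo c d → HasDerivAt u (g x) x) : IsPrimitive c d u g := by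
  have hd : ∀ᵐ x, x ≠ d := by simp [ae_iff, measure_singleton]
  have hae : ∀ᵐ x, x ∈ Ioc c d → deriv u x = g x := by
    filter_upwards [hg, hd] with x hx hxd hxm
    exact (hx ⟨hxm.1, lt_of_le_of_ne hxm.2 hxd⟩).deriv
  have hi : IntervalIntegrable g volume c d := by
    refine hu.intervalIntegrable_deriv.congr_ae ?_
    rw [uIoc_of_le hcd]
    exact (ae_restrict_iff' measurableSet_Ioc).2 hae
  refine ⟨hcd, hi, fun t ht => ?_⟩
  have h1 := (hu.mono (c := c) (d := t) (by
    rw [uIcc_of_le hcd, uIcc_of_le ht.1]; exact Icc_subset_Icc_right ht.2)).integral_deriv_eq_sub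
  have h2 : ∫ x in c..t, deriv u x = ∫ x in c..t, g x := by
    apply intervalIntegral.integral_congr_ae
    filter_upwards [hae] with x hx hxm
    rw [uIoc_of_le ht.1] at hxm
    exact hx ⟨hxm.1, hxm.2.trans ht.2⟩
  rw [← h2, h1]; ring

theorem integral_eq_sub (h : IsPrimitive c d u g) : ∫ x in c..d, g x = u d - u c := by
  rw [h.eq_add d ⟨h.le, le_rfl⟩]; ring

theorem mono (h : IsPrimitive c d u g) {c' d' : ℝ} (hc : c ≤ c') (hcd : c' ≤ d') (hd : d' ≤ d) :
    IsPrimitive c' d' u g := by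
  refine of_ac hcd (h.ac.mono ?_) ?_
  · rw [uIcc_of_le h.le, uIcc_of_le hcd]; exact Icc_subset_Icc hc hd
  · filter_upwards [h.ae_hasDerivAt] with x hx hxm
    exact hx ⟨hc.trans_lt hxm.1, hxm.2.trans_le hd⟩

theorem sub_eq_integral (h : IsPrimitive c d u g) {s t : ℝ} (hs : c ≤ s) (hst : s ≤ t)
    (ht : t ≤ d) : u t - u s = ∫ x in s..t, g x :=
  (h.mono hs hst ht).integral_eq_sub.symm

theorem congr (h : IsPrimitive c d u g) (huv : ∀ x ∈ Icc c d, v x = u x)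
    (hgk : ∀ᵐ x, x ∈ Ioo c d → k x = g x) : IsPrimitive c d v k := by
  refine of_ac h.le (h.ac.congr_of_eqOn (by rwa [uIcc_of_le h.le])) ?_
  filter_upwards [h.ae_hasDerivAt, hgk] with x hx hk hxm
  rw [hk hxm]
  refine (hx hxm).congr_of_eventuallyEq ?_
  filter_upwards [Ioo_mem_nhds hxm.1 hxm.2] with y hy
  exact huv y (Ioo_subset_Icc_self hy)

theorem comp {F F' : ℝ → ℝ} {K : NNReal} (h : IsPrimitive c d u g)
    (hF : LipschitzOnWith K F (u '' Icc c d)) (hF' : ∀ x ∈ u '' Icc c d, HasDerivAt F (F' x) x) :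
    IsPrimitive c d (fun t => F (u t)) (fun t => F' (u t) * g t) := by
  refine of_ac h.le (h.ac.of_dist_le (v := fun t => F (u t)) K.2 fun x hx y hy => ?_) ?_
  · rw [uIcc_of_le h.le] at hx hy
    exact hF.dist_le_mul _ (mem_image_of_mem u hx) _ (mem_image_of_mem u hy)
  · filter_upwards [h.ae_hasDerivAt] with x hx hxm
    exact (hF' _ (mem_image_of_mem u (Ioo_subset_Icc_self hxm))).comp x (hx hxm)

/-- Chain rule on a compact interval `[m₁,m₂]` containing the range of `u`. -/
theorem comp_of_mapsTo {F F' : ℝ → ℝ} {m₁ m₂ : ℝ} (h : IsPrimitive c d u g)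
    (hu : ∀ t ∈ Icc c d, u t ∈ Icc m₁ m₂) (hF : ∀ x ∈ Icc m₁ m₂, HasDerivAt F (F' x) x)
    (hF' : ContinuousOn F' (Icc m₁ m₂)) :
    IsPrimitive c d (fun t => F (u t)) (fun t => F' (u t) * g t) := by
  obtain ⟨K, hK⟩ := isCompact_Icc.exists_bound_of_continuousOn hF'
  have hsub : u '' Icc c d ⊆ Icc m₁ m₂ := by rintro _ ⟨t, ht, rfl⟩; exact hu t ht
  have hL : LipschitzOnWith K.toNNReal F (Icc m₁ m₂) := by
    refine (convex_Icc m₁ m₂).lipschitzOnWith_of_nnnorm_hasDerivWithin_le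
      (fun x hx => (hF x hx).hasDerivWithinAt) fun x hx => ?_
    rw [← NNReal.coe_le_coe, coe_nnnorm]
    exact (hK x hx).trans (Real.le_coe_toNNReal K)
  exact h.comp (hL.mono hsub) fun x hx => hF x (hsub hx)

theorem mul (h : IsPrimitive c d u g) (h' : IsPrimitive c d v k) :
    IsPrimitive c d (fun t => u t * v t) (fun t => g t * v t + u t * k t) := by
  refine of_ac h.le (h.ac.fun_mul h'.ac) ?_
  filter_upwards [h.ae_hasDerivAt, h'.ae_hasDerivAt] with x hx hx' hxm
  exact (hx hxm).mul (hx' hxm)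

/-- Composition with the projection onto `[m₁,m₂]` does not increase the derivative. -/
theorem exists_projIcc (m₁ m₂ : ℝ) (h : IsPrimitive c d u g) :
    ∃ k : ℝ → ℝ, IsPrimitive c d (fun t => max m₁ (min m₂ (u t))) k ∧
      ∀ᵐ x, x ∈ Ioo c d → |k x| ≤ |g x| := by
  have hlip : ∀ x y : ℝ, |max m₁ (min m₂ x) - max m₁ (min m₂ y)| ≤ |x - y| := fun x y => by
    refine (abs_max_sub_max_le_max _ _ _ _).trans (max_le (by simp) ?_)
    exact (abs_min_sub_min_le_max _ _ _ _).trans (max_le (by simp) le_rfl)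
  have hac : AbsolutelyContinuousOnInterval (fun t => max m₁ (min m₂ (u t))) c d :=
    h.ac.of_dist_le zero_le_one fun x _ y _ => by
      rw [one_mul, Real.dist_eq, Real.dist_eq]; exact hlip _ _
  have hd : ∀ᵐ x, x ∈ Ioo c d → DifferentiableAt ℝ (fun t => max m₁ (min m₂ (u t))) x := by
    filter_upwards [hac.ae_differentiableAt] with x hx hxm
    exact hx (by rw [uIcc_of_le h.le]; exact Ioo_subset_Icc_self hxm)
  refine ⟨deriv (fun t => max m₁ (min m₂ (u t))), of_ac h.le hac ?_, ?_⟩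
  · filter_upwards [hd] with x hx hxm using (hx hxm).hasDerivAt
  · filter_upwards [hd, h.ae_hasDerivAt] with x hx hx' hxm
    -- Near a point of differentiability the clamped function moves no further than `u`, which moves
    -- at most `(|g x| + ε) |y - x|`.
    refine le_of_forall_pos_le_add fun ε hε => ?_
    refine (hx hxm).hasDerivAt.le_of_lip' (by positivity) ?_
    filter_upwards [(hasDerivAt_iff_isLittleO.1 (hx' hxm)).def hε] with y hy
    refine (hlip _ _).trans ?_
    rw [Real.norm_eq_abs, Real.norm_eq_abs, smul_eq_mul] at hy
    have h1 := abs_add_le (u y - u x - (y - x) * g x) ((y - x) * g x)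
    rw [sub_add_cancel, abs_mul] at h1
    rw [Real.norm_eq_abs]
    nlinarith

theorem glue {x₀ : ℝ} (h : IsPrimitive c x₀ u g) (h' : IsPrimitive x₀ d v k) (huv : u x₀ = v x₀) :
    IsPrimitive c d (fun t => if t ≤ x₀ then u t else v t)
      (fun t => if t ≤ x₀ then g t else k t) := by
  have hi1 : IntervalIntegrable (fun t => if t ≤ x₀ then g t else k t) volume c x₀ := by
    refine h.integrable.congr_ae ((ae_restrict_iff' measurableSet_uIoc).2 (.of_forall fun t ht => ?_))
    rw [uIoc_of_le h.le] at ht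
    simp [ht.2]
  have hi2 : IntervalIntegrable (fun t => if t ≤ x₀ then g t else k t) volume x₀ d := by
    refine h'.integrable.congr_ae ((ae_restrict_iff' measurableSet_uIoc).2 (.of_forall fun t ht => ?_))
    rw [uIoc_of_le h'.le] at ht
    simp [not_le.2 ht.1]
  have e1 : ∀ t ≤ x₀, c ≤ t → ∫ s in c..t, (if s ≤ x₀ then g s else k s) = ∫ s in c..t, g s := by
    intro t ht hct
    refine intervalIntegral.integral_congr_ae (.of_forall fun s hs => ?_)
    rw [uIoc_of_le hct] at hs
    simp [hs.2.trans ht]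
  refine ⟨h.le.trans h'.le, hi1.trans hi2, fun t ht => ?_⟩
  simp only [h.le, if_true]
  split_ifs with htx
  · rw [e1 t htx ht.1, h.eq_add t ⟨ht.1, htx⟩]
  · have htx' := (not_le.1 htx).le
    have e2 : ∫ s in x₀..t, (if s ≤ x₀ then g s else k s) = ∫ s in x₀..t, k s := by
      refine intervalIntegral.integral_congr_ae (.of_forall fun s hs => ?_)
      rw [uIoc_of_le htx'] at hs
      simp [not_le.2 hs.1]
    rw [← intervalIntegral.integral_add_adjacent_intervals hi1
      (hi2.mono_set (by rw [uIcc_of_le htx', uIcc_of_le h'.le]; exact Icc_subset_Icc_right ht.2)),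
      e1 x₀ le_rfl h.le, e2, h'.eq_add t ⟨htx', ht.2⟩, ← huv, h.integral_eq_sub]
    ring

theorem comp_mul_left (h : IsPrimitive c d u g) {l : ℝ} (hl : 0 < l) :
    IsPrimitive (c / l) (d / l) (fun t => u (l * t)) (fun t => l * g (l * t)) := by
  have hle : c / l ≤ d / l := by have := h.le; gcongr
  refine ⟨hle, ?_, fun t ht => ?_⟩
  · exact (h.integrable.comp_mul_left (c := l)).const_mul l
  · have h1 : c ≤ l * t := by have := ht.1; rw [div_le_iff₀ hl] at this; linarith
    have h2 : l * t ≤ d := by have := ht.2; rw [le_div_iff₀ hl] at this; linarith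
    simp only [intervalIntegral.integral_const_mul, intervalIntegral.mul_integral_comp_mul_left]
    rw [h.eq_add _ ⟨h1, h2⟩]
    simp only [mul_div_cancel₀ c hl.ne']

theorem affine (hcd : c ≤ d) (x₀ m : ℝ) :
    IsPrimitive c d (fun t => x₀ + m * (t - c)) (fun _ => m) :=
  ⟨hcd, intervalIntegrable_const, fun t _ => by simp; ring⟩

end IsPrimitive

/-- By the chain rule and integration by parts. -/
theorem IsPrimitive.integral_deriv_mul_eq {c d : ℝ} {u g v k : ℝ → ℝ} (h : IsPrimitive c d u g)
    (h' : IsPrimitive c d v k) :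
    ∫ t in c..d, g t * v t = u d * v d - u c * v c - ∫ t in c..d, u t * k t := by
  have h1 := (h.mul h').integral_eq_sub
  rw [intervalIntegral.integral_add] at h1
  · linarith
  · refine h.integrable.mul_continuousOn ?_
    rw [uIcc_of_le h.le]; exact h'.continuousOn
  · refine h'.integrable.continuousOn_mul ?_
    rw [uIcc_of_le h.le]; exact h.continuousOn

/-- `IsPrimitive` with square integrable derivative: `u ∈ H¹((c,d))` with derivative `g`. -/
structure IsH1Path (c d : ℝ) (u g : ℝ → ℝ) : Prop extends IsPrimitive c d u g where
  sq_integrable : IntervalIntegrable (fun t => g t ^ 2) volume c d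

/-! ### Weak derivatives and continuous representatives -/

/-- A primitive of a smooth function with vanishing integral, supported in an interval. -/
theorem exists_primitive_of_integral_eq_zero {T : ℝ} {χ : ℝ → ℝ} (hχ : ContDiff ℝ (⊤ : ℕ∞) χ)
    {m₁ m₂ : ℝ} (h0 : 0 < m₁) (hm : m₁ ≤ m₂) (hT : m₂ < T)
    (hsupp : ∀ t, t ∉ Icc m₁ m₂ → χ t = 0) (hint : ∫ t in Ioo 0 T, χ t = 0) :
    ∃ φ : ℝ → ℝ, ContDiff ℝ (⊤ : ℕ∞) φ ∧ HasCompactSupport φ ∧ tsupport φ ⊆ Ioo 0 T ∧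
      deriv φ = χ := by
  have hd : ∀ t, HasDerivAt (fun t => ∫ s in (0 : ℝ)..t, χ s) (χ t) t := fun t =>
    (hχ.continuous.integral_hasStrictDerivAt 0 t).hasDerivAt
  have hderiv : deriv (fun t => ∫ s in (0 : ℝ)..t, χ s) = χ := funext fun t => (hd t).deriv
  have hT0 : 0 < T := by linarith
  have hzero : ∀ t, t ∉ Icc m₁ m₂ → ∫ s in (0 : ℝ)..t, χ s = 0 := by
    intro t ht
    rw [mem_Icc, not_and_or, not_le, not_le] at ht
    rcases ht with ht | ht
    · rw [intervalIntegral.integral_congr (g := fun _ => 0)]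
      · simp
      · intro s hs
        refine hsupp s fun h => ?_
        have : s ≤ max 0 t := hs.2
        rcases max_cases 0 t with h' | h' <;> linarith [h.1, h'.1]
    · have h1 : ∫ s in (0 : ℝ)..t, χ s = (∫ s in (0 : ℝ)..T, χ s) + ∫ s in T..t, χ s :=
        (intervalIntegral.integral_add_adjacent_intervals
          (hχ.continuous.intervalIntegrable _ _) (hχ.continuous.intervalIntegrable _ _)).symm
      rw [h1, intervalIntegral.integral_of_le hT0.le, integral_Ioc_eq_integral_Ioo, hint, zero_add,
        intervalIntegral.integral_congr (g := fun _ => 0)]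
      · simp
      · intro s hs
        refine hsupp s fun h => ?_
        have : min T t ≤ s := hs.1
        rcases min_cases T t with h' | h' <;> linarith [h.2, h'.1]
  have hts : tsupport (fun t => ∫ s in (0 : ℝ)..t, χ s) ⊆ Icc m₁ m₂ := by
    refine closure_minimal (fun t ht => ?_) isClosed_Icc
    by_contra h
    exact ht (hzero t h)
  refine ⟨_, ?_, HasCompactSupport.of_support_subset_isCompact isCompact_Icc
    ((subset_tsupport _).trans hts), hts.trans fun t ht => ⟨by linarith [ht.1], by linarith [ht.2]⟩,
    hderiv⟩
  rw [contDiff_infty_iff_deriv, hderiv]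
  exact ⟨fun t => (hd t).differentiableAt, hχ⟩

/-- The fundamental lemma of du Bois-Reymond. -/
theorem ae_eq_const_of_integral_mul_deriv_eq_zero {T : ℝ} (hT : 0 < T) {f : ℝ → ℝ}
    (hf : IntegrableOn f (Ioo 0 T))
    (h : ∀ φ : ℝ → ℝ, ContDiff ℝ (⊤ : ℕ∞) φ → HasCompactSupport φ → tsupport φ ⊆ Ioo 0 T →
      ∫ t in Ioo 0 T, f t * deriv φ t = 0) :
    ∃ c : ℝ, f =ᵐ[volI T] fun _ => c := by
  let B : ContDiffBump (T / 2 : ℝ) := ⟨T / 8, T / 4, by positivity, by linarith⟩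
  set φ₀ : ℝ → ℝ := B.normed volume with hφ₀
  have hB : ContDiff ℝ (⊤ : ℕ∞) φ₀ := B.contDiff_normed
  have hBts : tsupport φ₀ = Icc (T / 4) (3 * T / 4) := by
    rw [hφ₀, B.tsupport_normed_eq, Real.closedBall_eq_Icc]
    show Icc (T / 2 - T / 4) (T / 2 + T / 4) = _
    congr 1 <;> ring
  have hBint : ∫ t in Ioo 0 T, φ₀ t = 1 := by
    rw [setIntegral_eq_integral_of_forall_compl_eq_zero, B.integral_normed]
    intro t ht
    refine image_eq_zero_of_notMem_tsupport fun h => ht ?_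
    rw [hBts] at h
    exact ⟨by linarith [h.1], by linarith [h.2]⟩
  refine ⟨∫ t in Ioo 0 T, f t * φ₀ t, ?_⟩
  set c := ∫ t in Ioo 0 T, f t * φ₀ t with hc
  have hbd : ∀ ψ : ℝ → ℝ, Continuous ψ → HasCompactSupport ψ →
      IntegrableOn (fun t => f t * ψ t) (Ioo 0 T) := by
    intro ψ hψ hs
    obtain ⟨K, hK⟩ := hs.exists_bound_of_continuous hψ
    exact hf.mul_bdd hψ.aestronglyMeasurable (.of_forall hK)
  have hBc : HasCompactSupport φ₀ := by
    rw [HasCompactSupport, hBts]; exact isCompact_Icc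
  have key : ∀ᵐ x, x ∈ Ioo 0 T → f x - c = 0 := by
    refine isOpen_Ioo.ae_eq_zero_of_integral_contDiff_smul_eq_zero ?_ ?_
    · exact (hf.sub (integrableOn_const (by simp) (by simp))).locallyIntegrableOn
    · intro ψ hψ hψc hψs
      have hK : IsCompact (tsupport ψ ∪ Icc (T / 4) (3 * T / 4)) := hψc.union isCompact_Icc
      have hKs : tsupport ψ ∪ Icc (T / 4) (3 * T / 4) ⊆ Ioo 0 T :=
        union_subset hψs fun t ht => ⟨by linarith [ht.1], by linarith [ht.2]⟩
      have hKn : (tsupport ψ ∪ Icc (T / 4) (3 * T / 4)).Nonempty :=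
        ⟨T / 2, Or.inr ⟨by linarith, by linarith⟩⟩
      obtain ⟨m₁, hm₁, hl⟩ := hK.exists_isLeast hKn
      obtain ⟨m₂, hm₂, hu⟩ := hK.exists_isGreatest hKn
      set J := ∫ t in Ioo 0 T, ψ t with hJ
      have hψi : IntegrableOn ψ (Ioo 0 T) :=
        (hψ.continuous.integrable_of_hasCompactSupport hψc).integrableOn
      have hφi : IntegrableOn φ₀ (Ioo 0 T) :=
        (hB.continuous.integrable_of_hasCompactSupport hBc).integrableOn
      -- `ψ - J φ₀` has integral zero, so it is the derivative of a test function. The points `m₁`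
      -- and `m₂` are the extreme points of the union of the two supports.
      obtain ⟨φ, h1, h2, h3, h4⟩ := exists_primitive_of_integral_eq_zero (T := T)
        (χ := fun t => ψ t - J * φ₀ t) (hψ.sub (contDiff_const.mul hB)) (hKs hm₁).1 (hl hm₂)
        (hKs hm₂).2 (by
          intro t ht
          have ha : t ∉ tsupport ψ ∪ Icc (T / 4) (3 * T / 4) := fun h => ht ⟨hl h, hu h⟩
          rw [← hBts, mem_union, not_or] at ha
          show ψ t - J * φ₀ t = 0
          rw [image_eq_zero_of_notMem_tsupport ha.1, image_eq_zero_of_notMem_tsupport ha.2]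
          ring) (by
          rw [integral_sub hψi (hφi.const_mul J), integral_const_mul, hBint]; ring)
      have h5 := h φ h1 h2 h3
      rw [h4] at h5
      have h6 : ∫ t in Ioo 0 T, f t * (ψ t - J * φ₀ t) = (∫ t in Ioo 0 T, f t * ψ t) - J * c := by
        rw [hc, ← integral_const_mul, ← integral_sub (hbd ψ hψ.continuous hψc)
          ((hbd φ₀ hB.continuous hBc).const_mul J)]
        congr 1; ext t; ring
      have h7 : ∫ t, ψ t • (f t - c) = ∫ t in Ioo 0 T, ψ t • (f t - c) := by
        rw [setIntegral_eq_integral_of_forall_compl_eq_zero]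
        intro t ht
        rw [image_eq_zero_of_notMem_tsupport fun h => ht (hψs h), zero_smul]
      rw [h7]
      have h8 : ∫ t in Ioo 0 T, ψ t • (f t - c) = (∫ t in Ioo 0 T, f t * ψ t) - J * c := by
        rw [hJ, ← integral_mul_const, ← integral_sub (hbd ψ hψ.continuous hψc) (hψi.mul_const c)]
        congr 1; ext t; rw [smul_eq_mul]; ring
      rw [h8, ← h6, h5]
  refine (ae_restrict_iff' measurableSet_Ioo).2 ?_
  filter_upwards [key] with x hx hxm
  linarith [hx hxm]

theorem contDiff_isPrimitive {φ : ℝ → ℝ} (hφ : ContDiff ℝ (⊤ : ℕ∞) φ) {c d : ℝ} (hcd : c ≤ d) :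
    IsPrimitive c d φ (deriv φ) :=
  .of_ac hcd (((hφ.of_le (by exact_mod_cast le_top)).contDiffOn).absolutelyContinuousOnInterval)
    (.of_forall fun x _ => (hφ.differentiable (by simp) x).hasDerivAt)

/-- Integration by parts against test functions. -/
theorem IsPrimitive.integral_mul_deriv {T : ℝ} {u g φ : ℝ → ℝ} (h : IsPrimitive 0 T u g)
    (hφ : ContDiff ℝ (⊤ : ℕ∞) φ) (hs : tsupport φ ⊆ Ioo 0 T) :
    ∫ t in Ioo 0 T, u t * deriv φ t = -∫ t in Ioo 0 T, g t * φ t := by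
  have h1 := h.integral_deriv_mul_eq (contDiff_isPrimitive hφ h.le)
  have h0 : φ 0 = 0 := image_eq_zero_of_notMem_tsupport fun h => (hs h).1.false
  have hT : φ T = 0 := image_eq_zero_of_notMem_tsupport fun h => (hs h).2.false
  rw [h0, hT, intervalIntegral.integral_of_le h.le, intervalIntegral.integral_of_le h.le,
    integral_Ioc_eq_integral_Ioo, integral_Ioc_eq_integral_Ioo] at h1
  linarith

theorem IsH1Path.memLp {T : ℝ} {u g : ℝ → ℝ} (h : IsH1Path 0 T u g) : MemLp g 2 (volI T) := by
  have h1 : IntegrableOn g (Ioo 0 T) := by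
    have := (intervalIntegrable_iff_integrableOn_Ioo_of_le h.le).1 h.integrable
    exact this
  exact (memLp_two_iff_integrable_sq h1.aestronglyMeasurable).2
    ((intervalIntegrable_iff_integrableOn_Ioo_of_le h.le).1 h.sq_integrable)

theorem HasL2WeakDeriv.intervalIntegrable {T : ℝ} (hT : 0 < T) {v g : ℝ → ℝ}
    (h : HasL2WeakDeriv T v g) : IntervalIntegrable g volume 0 T := by
  rw [intervalIntegrable_iff_integrableOn_Ioo_of_le hT.le]
  exact h.1.integrable (by norm_num)

/-- The difference between `v` and the primitive of `g` has vanishing weak derivative, so the du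
Bois-Reymond lemma applies. -/
theorem HasL2WeakDeriv.exists_ae_eq {T : ℝ} (hT : 0 < T) {v g : ℝ → ℝ} (hv : MemLp v 2 (volI T))
    (h : HasL2WeakDeriv T v g) :
    ∃ c : ℝ, v =ᵐ[volI T] fun t => c + ∫ s in (0 : ℝ)..t, g s := by
  have hg := h.intervalIntegrable hT
  have hG : IsPrimitive 0 T (fun t => ∫ s in (0 : ℝ)..t, g s) g :=
    ⟨hT.le, hg, fun t _ => by simp⟩
  have hGi : IntegrableOn (fun t => ∫ s in (0 : ℝ)..t, g s) (Ioo 0 T) :=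
    (hG.continuousOn.integrableOn_Icc).mono_set Ioo_subset_Icc_self
  have hvi : IntegrableOn v (Ioo 0 T) := hv.integrable (by norm_num)
  obtain ⟨c, hc⟩ := ae_eq_const_of_integral_mul_deriv_eq_zero hT (hvi.sub hGi) (by
    intro φ h1 h2 h3
    have hb : Continuous (deriv φ) := h1.continuous_deriv (by simp)
    obtain ⟨K, hK⟩ := h2.deriv.exists_bound_of_continuous hb
    have e : ∀ t, (v - fun t => ∫ s in (0 : ℝ)..t, g s) t * deriv φ t
        = v t * deriv φ t - (∫ s in (0 : ℝ)..t, g s) * deriv φ t := fun t => by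
      simp only [Pi.sub_apply]; ring
    simp only [e]
    rw [integral_sub (hvi.mul_bdd hb.aestronglyMeasurable (.of_forall hK))
      (hGi.mul_bdd hb.aestronglyMeasurable (.of_forall hK)), h.2 φ h1 h2 h3,
      hG.integral_mul_deriv h1 h3]
    ring)
  refine ⟨c, ?_⟩
  filter_upwards [hc] with t ht
  simp only [Pi.sub_apply] at ht
  linarith

theorem MemH1.hasL2WeakDeriv {T : ℝ} {v : ℝ → ℝ} (h : MemH1 T v) :
    HasL2WeakDeriv T v (weakDeriv T v) := by
  rw [weakDeriv, dif_pos h.2]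
  exact h.2.choose_spec

theorem HasL2WeakDeriv.ae_unique {T : ℝ} {v g g' : ℝ → ℝ} (h : HasL2WeakDeriv T v g)
    (h' : HasL2WeakDeriv T v g') : g =ᵐ[volI T] g' := by
  have hi : IntegrableOn g (Ioo 0 T) := h.1.integrable (by norm_num)
  have hi' : IntegrableOn g' (Ioo 0 T) := h'.1.integrable (by norm_num)
  have key : ∀ᵐ x, x ∈ Ioo 0 T → g x - g' x = 0 := by
    refine isOpen_Ioo.ae_eq_zero_of_integral_contDiff_smul_eq_zero
      (hi.sub hi').locallyIntegrableOn fun φ h1 h2 h3 => ?_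
    obtain ⟨K, hK⟩ := h2.exists_bound_of_continuous h1.continuous
    have h7 : ∫ t, φ t • (g t - g' t) = ∫ t in Ioo 0 T, φ t • (g t - g' t) := by
      rw [setIntegral_eq_integral_of_forall_compl_eq_zero]
      intro t ht
      rw [image_eq_zero_of_notMem_tsupport fun h => ht (h3 h), zero_smul]
    have e : ∀ t, φ t • (g t - g' t) = g t * φ t - g' t * φ t := fun t => by
      rw [smul_eq_mul]; ring
    rw [h7]
    simp only [e]
    rw [integral_sub (hi.mul_bdd h1.continuous.aestronglyMeasurable (.of_forall hK))
      (hi'.mul_bdd h1.continuous.aestronglyMeasurable (.of_forall hK))]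
    linarith [h.2 φ h1 h2 h3, h'.2 φ h1 h2 h3]
  refine (ae_restrict_iff' measurableSet_Ioo).2 ?_
  filter_upwards [key] with x hx hxm
  linarith [hx hxm]

/-- The representative carrying the boundary values and the primitive of the weak derivative are
both continuous and agree a.e., hence everywhere on `[0,T]`. -/
theorem MemH1.exists_path {T α β : ℝ} (hT : 0 < T) {v : ℝ → ℝ} (h : MemH1 T v)
    (hb : HasBoundaryValues T v α β) :
    ∃ u : ℝ → ℝ, IsH1Path 0 T u (weakDeriv T v) ∧ v =ᵐ[volI T] u ∧ u 0 = α ∧ u T = β := by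
  obtain ⟨u, hu, hvu, h0, hT'⟩ := hb
  have hw := h.hasL2WeakDeriv
  obtain ⟨c, hc⟩ := hw.exists_ae_eq hT h.1
  have hi := hw.intervalIntegrable hT
  have hG : IsPrimitive 0 T (fun t => c + ∫ s in (0 : ℝ)..t, weakDeriv T v s) (weakDeriv T v) :=
    ⟨hT.le, hi, fun t _ => by simp⟩
  have heq : EqOn u (fun t => c + ∫ s in (0 : ℝ)..t, weakDeriv T v s) (Icc 0 T) := by
    refine Measure.eqOn_Icc_of_ae_eq volume hT.ne ?_ hu hG.continuousOn
    rw [Measure.restrict_congr_set Ioo_ae_eq_Icc.symm]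
    exact hvu.symm.trans hc
  refine ⟨u, ⟨hG.congr heq (.of_forall fun _ _ => rfl), ?_⟩, hvu, h0, hT'⟩
  rw [intervalIntegrable_iff_integrableOn_Ioo_of_le hT.le]
  exact hw.1.integrable_sq

/-- Converts explicit competitors into elements of `L¹`. The function `weakDeriv` is a choice, so
uniqueness of weak derivatives is needed to compare it with `g`. -/
theorem IsH1Path.exists_L1 {T : ℝ} {u g : ℝ → ℝ} (h : IsH1Path 0 T u g) :
    ∃ v : ℝ →₁[volI T] ℝ, v =ᵐ[volI T] u ∧ MemH1 T v ∧ HasBoundaryValues T v (u 0) (u T) ∧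
      weakDeriv T v =ᵐ[volI T] g := by
  obtain ⟨K, hK⟩ := isCompact_Icc.exists_bound_of_continuousOn h.continuousOn
  have hui : IntegrableOn u (Ioo 0 T) :=
    (h.continuousOn.integrableOn_Icc).mono_set Ioo_subset_Icc_self
  have hu2 : MemLp u 2 (volI T) :=
    MemLp.of_bound hui.aestronglyMeasurable K
      ((ae_restrict_iff' measurableSet_Ioo).2 (.of_forall fun t ht => hK t (Ioo_subset_Icc_self ht)))
  have hv : (hui.toL1 u : ℝ → ℝ) =ᵐ[volI T] u := Integrable.coeFn_toL1 hui
  have hwd : HasL2WeakDeriv T (hui.toL1 u : ℝ → ℝ) g := by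
    refine ⟨h.memLp, fun φ h1 _ h3 => ?_⟩
    rw [← h.integral_mul_deriv h1 h3]
    refine integral_congr_ae ?_
    filter_upwards [hv] with t ht
    rw [ht]
  have hm : MemH1 T (hui.toL1 u : ℝ → ℝ) := ⟨(memLp_congr_ae hv).2 hu2, g, hwd⟩
  exact ⟨hui.toL1 u, hv, hm, ⟨u, h.continuousOn, hv, rfl, rfl⟩, hm.hasL2WeakDeriv.ae_unique hwd⟩

/-! ### Path energy, rescaling and the path of a minimizer -/

/-- The weighted energy `∫_c^d (W(w) + k²) η` of a path `w` with derivative `k`. -/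
noncomputable def pathEnergy (W η : ℝ → ℝ) (c d : ℝ) (w k : ℝ → ℝ) : ℝ :=
  ∫ s in c..d, (W (w s) + k s ^ 2) * η s

theorem IsH1Path.mono {c d c' d' : ℝ} {u g : ℝ → ℝ} (h : IsH1Path c d u g) (hc : c ≤ c')
    (hcd : c' ≤ d') (hd : d' ≤ d) : IsH1Path c' d' u g :=
  ⟨h.toIsPrimitive.mono hc hcd hd, h.sq_integrable.mono_set (by
    rw [uIcc_of_le h.le, uIcc_of_le hcd]; exact Icc_subset_Icc hc hd)⟩

theorem IsH1Path.intervalIntegrable_energy {W η : ℝ → ℝ} (hW : Continuous W) {c d : ℝ}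
    {u g : ℝ → ℝ} (h : IsH1Path c d u g) (hη : ContinuousOn η (Icc c d)) :
    IntervalIntegrable (fun s => (W (u s) + g s ^ 2) * η s) volume c d := by
  refine IntervalIntegrable.mul_continuousOn (.add ?_ h.sq_integrable) (by rwa [uIcc_of_le h.le])
  refine ContinuousOn.intervalIntegrable ?_
  rw [uIcc_of_le h.le]
  exact hW.comp_continuousOn h.continuousOn

theorem IsH1Path.glue {c d x₀ : ℝ} {u g v k : ℝ → ℝ} (h : IsH1Path c x₀ u g)
    (h' : IsH1Path x₀ d v k) (huv : u x₀ = v x₀) :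
    IsH1Path c d (fun t => if t ≤ x₀ then u t else v t)
      (fun t => if t ≤ x₀ then g t else k t) := by
  refine ⟨h.toIsPrimitive.glue h'.toIsPrimitive huv, ?_⟩
  refine (h.sq_integrable.congr_ae ?_).trans (h'.sq_integrable.congr_ae ?_)
  · refine (ae_restrict_iff' measurableSet_uIoc).2 (.of_forall fun t ht => ?_)
    rw [uIoc_of_le h.le] at ht
    simp [ht.2]
  · refine (ae_restrict_iff' measurableSet_uIoc).2 (.of_forall fun t ht => ?_)
    rw [uIoc_of_le h'.le] at ht
    simp [not_le.2 ht.1]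

theorem pathEnergy_glue {W η : ℝ → ℝ} (hW : Continuous W) {c d x₀ : ℝ} {u g v k : ℝ → ℝ}
    (h : IsH1Path c x₀ u g) (h' : IsH1Path x₀ d v k) (huv : u x₀ = v x₀)
    (hη : ContinuousOn η (Icc c d)) :
    pathEnergy W η c d (fun t => if t ≤ x₀ then u t else v t)
      (fun t => if t ≤ x₀ then g t else k t) = pathEnergy W η c x₀ u g + pathEnergy W η x₀ d v k := by
  have hi := (h.glue h' huv).intervalIntegrable_energy hW hη
  have hsub1 : uIcc c x₀ ⊆ uIcc c d := by
    rw [uIcc_of_le h.le, uIcc_of_le (h.le.trans h'.le)]; exact Icc_subset_Icc_right h'.le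
  have hsub2 : uIcc x₀ d ⊆ uIcc c d := by
    rw [uIcc_of_le h'.le, uIcc_of_le (h.le.trans h'.le)]; exact Icc_subset_Icc_left h.le
  rw [pathEnergy, ← intervalIntegral.integral_add_adjacent_intervals (hi.mono_set hsub1)
    (hi.mono_set hsub2)]
  congr 1
  · refine intervalIntegral.integral_congr_ae (.of_forall fun t ht => ?_)
    rw [uIoc_of_le h.le] at ht
    simp [ht.2]
  · refine intervalIntegral.integral_congr_ae (.of_forall fun t ht => ?_)
    rw [uIoc_of_le h'.le] at ht
    simp [not_le.2 ht.1]

theorem IsH1Path.pathEnergy_add {W η : ℝ → ℝ} (hW : Continuous W) {c d x₀ : ℝ} {u g : ℝ → ℝ}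
    (h : IsH1Path c d u g) (hη : ContinuousOn η (Icc c d)) (hx₀ : x₀ ∈ Icc c d) :
    pathEnergy W η c x₀ u g + pathEnergy W η x₀ d u g = pathEnergy W η c d u g := by
  have hi := h.intervalIntegrable_energy hW hη
  refine intervalIntegral.integral_add_adjacent_intervals (hi.mono_set ?_) (hi.mono_set ?_)
  · rw [uIcc_of_le hx₀.1, uIcc_of_le h.le]; exact Icc_subset_Icc_right hx₀.2
  · rw [uIcc_of_le hx₀.2, uIcc_of_le h.le]; exact Icc_subset_Icc_left hx₀.1

theorem IsH1Path.comp_mul_left {c d : ℝ} {u g : ℝ → ℝ} (h : IsH1Path c d u g) {l : ℝ}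
    (hl : 0 < l) :
    IsH1Path (c / l) (d / l) (fun t => u (l * t)) (fun t => l * g (l * t)) := by
  refine ⟨h.toIsPrimitive.comp_mul_left hl, ?_⟩
  have := (h.sq_integrable.comp_mul_left (c := l)).const_mul (l ^ 2)
  refine this.congr_ae (.of_forall fun t => ?_)
  simp only; ring

/-- The energy in the original and in the rescaled variable. -/
theorem setIntegral_eq_mul_pathEnergy (W ω : ℝ → ℝ) {T ε : ℝ} (hT : 0 < T) (hε : 0 < ε)
    (u g : ℝ → ℝ) :
    ∫ t in Ioo 0 T, (W (u t) + ε ^ 2 * g t ^ 2) * ω t =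
      ε * pathEnergy W (fun s => ω (ε * s)) 0 (T / ε) (fun s => u (ε * s))
        (fun s => ε * g (ε * s)) := by
  have h := intervalIntegral.mul_integral_comp_mul_left (a := 0) (b := T / ε)
    (f := fun t => (W (u t) + ε ^ 2 * g t ^ 2) * ω t) (c := ε)
  rw [mul_zero, mul_div_cancel₀ T hε.ne', intervalIntegral.integral_of_le hT.le,
    integral_Ioc_eq_integral_Ioo] at h
  rw [← h, pathEnergy]
  simp only [mul_pow]

theorem IsH1Path.affine {c d : ℝ} (hcd : c ≤ d) (x₀ m : ℝ) :
    IsH1Path c d (fun t => x₀ + m * (t - c)) (fun _ => m) :=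
  ⟨.affine hcd x₀ m, intervalIntegrable_const⟩

/-- The energy of any path with the right boundary values bounds the value at a minimizer. -/
theorem IsMinimizerG0.le_of_path {W ω : ℝ → ℝ} {T ε α β : ℝ} {v : ℝ →₁[volI T] ℝ}
    (hv : IsMinimizerG0 W ω T ε α β v) {u g : ℝ → ℝ} (h : IsH1Path 0 T u g) (h0 : u 0 = α)
    (hT : u T = β) :
    G0 W ω T ε α β v ≤
      ((∫ t in Ioo 0 T, (W (u t) + ε ^ 2 * g t ^ 2) * ω t : ℝ) : EReal) := by
  obtain ⟨z, hz, hm, hb, hd⟩ := h.exists_L1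
  refine (hv z).trans ?_
  rw [h0, hT] at hb
  rw [G0, if_pos ⟨hm, hb⟩, EReal.coe_le_coe_iff]
  refine (integral_congr_ae ?_).le
  filter_upwards [hz, hd] with t h1 h2
  rw [h1, h2]

/-- A minimizer has finite energy because the affine path does, so it has a continuous
representative. Clamping to `[a,b]` does not raise the energy, as `W` vanishes at `a` and `b`; by
minimality the clamped path has the same energy and may replace it. -/
theorem IsMinimizerG0.exists_path {W ω : ℝ → ℝ} {a b : ℝ} (hab : a < b) (hW : Continuous W)
    (hW0 : ∀ s, 0 ≤ W s) (hWa : W a = 0) (hWb : W b = 0) {T ε αε βε : ℝ} (hT : 0 < T)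
    (hω : ContinuousOn ω (Icc 0 T)) (hpos : ∀ t ∈ Icc 0 T, 0 < ω t) (hε : 0 < ε)
    (hα : αε ∈ Icc a b) (hβ : βε ∈ Icc a b) {v : ℝ →₁[volI T] ℝ}
    (hv : IsMinimizerG0 W ω T ε αε βε v) (α : ℝ) :
    ∃ w k : ℝ → ℝ, IsH1Path 0 (T / ε) w k ∧ (∀ s ∈ Icc 0 (T / ε), w s ∈ Icc a b) ∧
      w 0 = αε ∧ w (T / ε) = βε ∧
      G2 W ω b α T ε αε βε v = ((1 / ε * (pathEnergy W (fun s => ω (ε * s)) 0 (T / ε) w k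
        - ω 0 * geodDist W b α) : ℝ) : EReal) ∧
      ∀ w' k' : ℝ → ℝ, IsH1Path 0 (T / ε) w' k' → w' 0 = αε → w' (T / ε) = βε →
        pathEnergy W (fun s => ω (ε * s)) 0 (T / ε) w k ≤
          pathEnergy W (fun s => ω (ε * s)) 0 (T / ε) w' k' := by
  have hcond : MemH1 T v ∧ HasBoundaryValues T v αε βε := by
    by_contra hc
    have h1 := hv.le_of_path (IsH1Path.affine hT.le αε ((βε - αε) / T)) (by simp)
      (by field_simp; ring)
    rw [G0, if_neg hc] at h1
    exact EReal.coe_ne_top _ (top_le_iff.1 h1)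
  obtain ⟨u, hu, hvu, hu0, huT⟩ := hcond.1.exists_path hT hcond.2
  set g := weakDeriv T v with hg
  have hEv : ∫ t in Ioo 0 T, (W (v t) + ε ^ 2 * g t ^ 2) * ω t =
      ∫ t in Ioo 0 T, (W (u t) + ε ^ 2 * g t ^ 2) * ω t := by
    refine integral_congr_ae ?_
    filter_upwards [hvu] with t ht
    rw [ht]
  have hG0 : ∀ u' g' : ℝ → ℝ, IsH1Path 0 T u' g' → u' 0 = αε → u' T = βε →
      ∫ t in Ioo 0 T, (W (u t) + ε ^ 2 * g t ^ 2) * ω t ≤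
        ∫ t in Ioo 0 T, (W (u' t) + ε ^ 2 * g' t ^ 2) * ω t := by
    intro u' g' h h0 h1
    have := hv.le_of_path h h0 h1
    rw [G0, if_pos hcond, EReal.coe_le_coe_iff, ← hg, hEv] at this
    exact this
  have hint : ∀ u' g' : ℝ → ℝ, IsH1Path 0 T u' g' →
      IntegrableOn (fun t => (W (u' t) + ε ^ 2 * g' t ^ 2) * ω t) (Ioo 0 T) := by
    intro u' g' h
    rw [← intervalIntegrable_iff_integrableOn_Ioo_of_le hT.le]
    refine IntervalIntegrable.mul_continuousOn (.add ?_ (h.sq_integrable.const_mul _))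
      (by rwa [uIcc_of_le hT.le])
    refine ContinuousOn.intervalIntegrable ?_
    rw [uIcc_of_le hT.le]
    exact hW.comp_continuousOn h.continuousOn
  obtain ⟨k, hk, hkg⟩ := hu.toIsPrimitive.exists_projIcc a b
  have hclamp : ∀ x, W (max a (min b x)) ≤ W x := by
    intro x
    rcases le_total x a with h | h
    · rw [min_eq_right (h.trans hab.le), max_eq_left h, hWa]; exact hW0 x
    · rcases le_total x b with h' | h'
      · rw [min_eq_right h', max_eq_right h]
      · rw [min_eq_left h', max_eq_right hab.le, hWb]; exact hW0 x
  have hfix : ∀ x ∈ Icc a b, max a (min b x) = x := fun x hx => by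
    rw [min_eq_right hx.2, max_eq_right hx.1]
  have hkH : IsH1Path 0 T (fun t => max a (min b (u t))) k := by
    refine ⟨hk, ?_⟩
    rw [intervalIntegrable_iff_integrableOn_Ioo_of_le hT.le]
    refine Integrable.mono
      ((intervalIntegrable_iff_integrableOn_Ioo_of_le hT.le).1 hu.sq_integrable)
      (((intervalIntegrable_iff_integrableOn_Ioo_of_le hT.le).1
        hk.integrable).aestronglyMeasurable.pow 2) ?_
    refine (ae_restrict_iff' measurableSet_Ioo).2 ?_
    filter_upwards [hkg] with t ht htm
    rw [Real.norm_eq_abs, Real.norm_eq_abs, abs_pow, abs_pow]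
    exact pow_le_pow_left₀ (abs_nonneg _) (ht htm) 2
  have hEeq : ∫ t in Ioo 0 T, (W (max a (min b (u t))) + ε ^ 2 * k t ^ 2) * ω t =
      ∫ t in Ioo 0 T, (W (u t) + ε ^ 2 * g t ^ 2) * ω t := by
    refine le_antisymm ?_ (hG0 _ _ hkH ?_ ?_)
    · refine integral_mono_ae (hint _ _ hkH) (hint _ _ hu) ?_
      refine (ae_restrict_iff' measurableSet_Ioo).2 ?_
      filter_upwards [hkg] with t ht htm
      have h1 : k t ^ 2 ≤ g t ^ 2 := sq_le_sq.2 (ht htm)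
      have h2 := hclamp (u t)
      have h3 := (hpos t (Ioo_subset_Icc_self htm)).le
      gcongr
    · simp only [hu0, hfix αε hα]
    · simp only [huT, hfix βε hβ]
  have hS : (0 : ℝ) / ε = 0 := zero_div ε
  refine ⟨fun s => max a (min b (u (ε * s))), fun s => ε * k (ε * s), ?_, ?_, ?_, ?_, ?_, ?_⟩
  · have := hkH.comp_mul_left hε
    rwa [hS] at this
  · exact fun s _ => ⟨le_max_left _ _, max_le hab.le (min_le_left _ _)⟩
  · simp only [mul_zero, hu0, hfix αε hα]
  · simp only [mul_div_cancel₀ T hε.ne', huT, hfix βε hβ]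
  · rw [G2, if_pos hcond]
    have h1 := setIntegral_eq_mul_pathEnergy W ω hT hε (fun t => max a (min b (u t))) k
    have h2 : ∫ t in Ioo 0 T, (1 / ε ^ 2 * W (v t) + weakDeriv T v t ^ 2) * ω t =
        1 / ε ^ 2 * ∫ t in Ioo 0 T, (W (v t) + ε ^ 2 * g t ^ 2) * ω t := by
      rw [← integral_const_mul]
      congr 1; ext t; rw [← hg]; field_simp
    rw [h2, hEv, ← hEeq, h1]
    congr 1
    field_simp
  · intro w' k' h h0 h1
    have h3 := h.comp_mul_left (l := 1 / ε) (by positivity)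
    rw [zero_div, show T / ε / (1 / ε) = T by field_simp] at h3
    have h4 := hG0 _ _ h3 (by simpa using h0) (by rw [← h1]; congr 1; field_simp)
    rw [← hEeq, setIntegral_eq_mul_pathEnergy W ω hT hε (fun t => max a (min b (u t))) k,
      setIntegral_eq_mul_pathEnergy W ω hT hε] at h4
    have h5 := le_of_mul_le_mul_left h4 hε
    refine h5.trans_eq ?_
    rw [pathEnergy, pathEnergy]
    refine intervalIntegral.integral_congr fun s _ => ?_
    have e1 : 1 / ε * (ε * s) = s := by field_simp
    simp only [e1]
    rw [← mul_assoc, mul_one_div_cancel hε.ne', one_mul]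

/-! ### Power-law bounds for the potential at its wells -/

/-- Slopes through the origin of a convex function. -/
theorem ConvexOn.mul_le_mul_of_zero {f : ℝ → ℝ} {ρ : ℝ} (hf : ConvexOn ℝ (Icc 0 ρ) f)
    (h0 : f 0 = 0) {x y : ℝ} (hx : 0 ≤ x) (hxy : x ≤ y) (hy : y ≤ ρ) : f x * y ≤ f y * x := by
  rcases hx.eq_or_lt with rfl | hx
  · simp [h0]
  have hy0 : 0 < y := hx.trans_le hxy
  have h := hf.2 (show (0 : ℝ) ∈ Icc 0 ρ from ⟨le_rfl, hy0.le.trans hy⟩)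
    (show y ∈ Icc 0 ρ from ⟨hy0.le, hy⟩) (show 0 ≤ 1 - x / y from
      sub_nonneg.2 ((div_le_one hy0).2 hxy)) (show 0 ≤ x / y by positivity) (by ring)
  simp only [smul_eq_mul, mul_zero, zero_add, h0] at h
  rw [div_mul_cancel₀ x hy0.ne'] at h
  calc f x * y ≤ x / y * f y * y := by gcongr
    _ = f y * x := by field_simp

/-- A function vanishing at `0` whose second derivative is comparable to `y^(q-1)` is comparable
to `y^(1+r)` near `0`, with `r = q`, or `r = 0` if the graph has a corner. -/
theorem exists_rpow_bounds_nhds_zero {V : ℝ → ℝ} {q R c : ℝ} (hq : q ∈ Ioo (0 : ℝ) 1) (hR : 0 < R)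
    (hV : Continuous V) (hV0 : ∀ y, 0 ≤ V y) (hVz : V 0 = 0) (hVd : ContDiffOn ℝ 2 V (Ioo 0 R))
    (hc : 0 < c) (hlim : Tendsto (fun y => deriv (deriv V) y * y ^ (1 - q)) (𝓝[>] 0) (𝓝 c)) :
    ∃ r ∈ Ico (0 : ℝ) 1, ∃ ρ > 0, ∃ c₁ > 0, ∃ c₂ > 0, ∀ y ∈ Icc 0 ρ,
      c₁ * y ^ (1 + r) ≤ V y ∧ V y ≤ c₂ * y ^ (1 + r) := by
  obtain ⟨hq0, hq1⟩ := hq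
  have hev : ∀ᶠ y in 𝓝[>] (0 : ℝ), y < R ∧ c / 2 ≤ deriv (deriv V) y * y ^ (1 - q) ∧
      deriv (deriv V) y * y ^ (1 - q) ≤ 2 * c := by
    refine (((tendsto_order.1 (tendsto_id.mono_left nhdsWithin_le_nhds)).2 R hR).and
      ((hlim.eventually_const_le (by linarith)).and (hlim.eventually_le_const (by linarith))))
  obtain ⟨ρ', hρ', H⟩ := (nhdsGT_basis (0 : ℝ)).mem_iff.1 hev
  set ρ := ρ' / 2 with hρdef
  have hρ : 0 < ρ := by simp only [hρdef]; exact half_pos hρ'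
  have hρlt : ρ < ρ' := by simp only [hρdef]; exact half_lt_self hρ'
  have hbd : ∀ y ∈ Ioo 0 ρ', y < R ∧ c / 2 * y ^ (q - 1) ≤ deriv (deriv V) y ∧
      deriv (deriv V) y ≤ 2 * c * y ^ (q - 1) := by
    intro y hy
    obtain ⟨h1, h2, h3⟩ := H hy
    have e : y ^ (q - 1) = (y ^ (1 - q))⁻¹ := by rw [← Real.rpow_neg hy.1.le]; congr 1; ring
    have hp : 0 < y ^ (1 - q) := Real.rpow_pos_of_pos hy.1 _
    refine ⟨h1, ?_, ?_⟩
    · rw [e, ← div_eq_mul_inv, div_le_iff₀ hp]; exact h2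
    · rw [e, ← div_eq_mul_inv, le_div_iff₀ hp]; exact h3
  have hd1 : ∀ y ∈ Ioo 0 R, HasDerivAt V (deriv V y) y := fun y hy =>
    ((hVd.differentiableOn (by norm_num)).differentiableAt (isOpen_Ioo.mem_nhds hy)).hasDerivAt
  have hVd' : ContDiffOn ℝ 1 (deriv V) (Ioo 0 R) := by
    have := (contDiffOn_succ_iff_deriv_of_isOpen (n := 1) (𝕜 := ℝ) (f := V)
      (isOpen_Ioo (a := (0 : ℝ)) (b := R))).1 (by convert! hVd using 1)
    exact this.2.2
  have hd2 : ∀ y ∈ Ioo 0 R, HasDerivAt (deriv V) (deriv (deriv V) y) y := fun y hy =>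
    ((hVd'.differentiableOn (by norm_num)).differentiableAt (isOpen_Ioo.mem_nhds hy)).hasDerivAt
  have hpow1 : ∀ (κ : ℝ), ∀ y ∈ Ioo 0 ρ, HasDerivAt (fun y => κ * y ^ (1 + q))
      (κ * ((1 + q) * y ^ q)) y := fun κ y hy => by
    have := Real.hasDerivAt_rpow_const (x := y) (p := 1 + q) (Or.inl hy.1.ne')
    rw [show 1 + q - 1 = q by ring] at this
    exact this.const_mul κ
  have hpow2 : ∀ (κ : ℝ), ∀ y ∈ Ioo 0 ρ, HasDerivAt (fun y => κ * ((1 + q) * y ^ q))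
      (κ * ((1 + q) * (q * y ^ (q - 1)))) y := fun κ y hy =>
    ((Real.hasDerivAt_rpow_const (x := y) (p := q) (Or.inl hy.1.ne')).const_mul (1 + q)).const_mul κ
  have hint : interior (Icc 0 ρ) = Ioo 0 ρ := interior_Icc
  have hpc : ∀ κ : ℝ, Continuous fun y : ℝ => κ * y ^ (1 + q) := fun κ =>
    continuous_const.mul (Real.continuous_rpow_const (by linarith))
  have hmem : ∀ y ∈ Ioo 0 ρ, y ∈ Ioo 0 R := fun y hy =>
    ⟨hy.1, (hbd y ⟨hy.1, hy.2.trans hρlt⟩).1⟩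
  -- With these constants `κ y^(1+q)` has as second derivative exactly the lower, respectively the
  -- upper, bound for `V''`.
  set κ₁ := c / 2 / (q * (1 + q)) with hκ₁
  set κ₂ := 2 * c / (q * (1 + q)) with hκ₂
  have hκ₁0 : 0 < κ₁ := by positivity
  have hκ₂0 : 0 < κ₂ := by positivity
  have conv1 : ConvexOn ℝ (Icc 0 ρ) fun y => V y - κ₁ * y ^ (1 + q) := by
    refine convexOn_of_hasDerivWithinAt2_nonneg (convex_Icc 0 ρ) (hV.sub (hpc κ₁)).continuousOn
      (f' := fun y => deriv V y - κ₁ * ((1 + q) * y ^ q))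
      (f'' := fun y => deriv (deriv V) y - κ₁ * ((1 + q) * (q * y ^ (q - 1)))) ?_ ?_ ?_
    · rw [hint]; exact fun y hy => ((hd1 y (hmem y hy)).sub (hpow1 κ₁ y hy)).hasDerivWithinAt
    · rw [hint]; exact fun y hy => ((hd2 y (hmem y hy)).sub (hpow2 κ₁ y hy)).hasDerivWithinAt
    · rw [hint]; intro y hy
      have := (hbd y ⟨hy.1, hy.2.trans hρlt⟩).2.1
      rw [sub_nonneg]
      refine le_trans (le_of_eq ?_) this
      rw [hκ₁]; field_simp
  have conv2 : ConvexOn ℝ (Icc 0 ρ) fun y => κ₂ * y ^ (1 + q) - V y := by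
    refine convexOn_of_hasDerivWithinAt2_nonneg (convex_Icc 0 ρ) ((hpc κ₂).sub hV).continuousOn
      (f' := fun y => κ₂ * ((1 + q) * y ^ q) - deriv V y)
      (f'' := fun y => κ₂ * ((1 + q) * (q * y ^ (q - 1))) - deriv (deriv V) y) ?_ ?_ ?_
    · rw [hint]; exact fun y hy => ((hpow1 κ₂ y hy).sub (hd1 y (hmem y hy))).hasDerivWithinAt
    · rw [hint]; exact fun y hy => ((hpow2 κ₂ y hy).sub (hd2 y (hmem y hy))).hasDerivWithinAt
    · rw [hint]; intro y hy
      have := (hbd y ⟨hy.1, hy.2.trans hρlt⟩).2.2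
      rw [sub_nonneg]
      refine le_trans this (le_of_eq ?_)
      rw [hκ₂]; field_simp
  have h0p : (0 : ℝ) ^ (1 + q) = 0 := Real.zero_rpow (by linarith)
  have s1 : ∀ x y, 0 ≤ x → x ≤ y → y ≤ ρ →
      (V x - κ₁ * x ^ (1 + q)) * y ≤ (V y - κ₁ * y ^ (1 + q)) * x := fun x y hx hxy hy =>
    conv1.mul_le_mul_of_zero (by simp [hVz, h0p]) hx hxy hy
  have s2 : ∀ x y, 0 ≤ x → x ≤ y → y ≤ ρ →
      (κ₂ * x ^ (1 + q) - V x) * y ≤ (κ₂ * y ^ (1 + q) - V y) * x := fun x y hx hxy hy =>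
    conv2.mul_le_mul_of_zero (by simp [hVz, h0p]) hx hxy hy
  have hsplit : ∀ y : ℝ, 0 < y → y ^ (1 + q) = y * y ^ q := fun y hy => by
    rw [Real.rpow_add hy, Real.rpow_one]
  have mono : ∀ x y, 0 < x → x ≤ y → y ≤ ρ → V x * y ≤ V y * x := by
    intro x y hx hxy hy
    have h1 := s1 x y hx.le hxy hy
    have h2 : x ^ (1 + q) * y ≤ y ^ (1 + q) * x := by
      rw [hsplit x hx, hsplit y (hx.trans_le hxy)]
      have : x ^ q ≤ y ^ q := Real.rpow_le_rpow hx.le hxy hq0.le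
      have hxy0 : 0 < x * y := mul_pos hx (hx.trans_le hxy)
      nlinarith
    nlinarith
  -- `V y / y` is nondecreasing. Either it stays above a positive constant (a corner, `r = 0`), or
  -- it tends to `0` at the origin, and then integrating the bounds for `V''` twice leaves no linear
  -- term.
  by_cases hcase : ∃ l > 0, ∀ y ∈ Ioc 0 ρ, l * y ≤ V y
  · obtain ⟨l, hl, hlb⟩ := hcase
    have hVρ : 0 < V ρ := lt_of_lt_of_le (by positivity) (hlb ρ ⟨hρ, le_rfl⟩)
    refine ⟨0, ⟨le_rfl, one_pos⟩, ρ, hρ, l, hl, V ρ / ρ, by positivity, fun y hy => ?_⟩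
    rw [add_zero, Real.rpow_one]
    rcases hy.1.eq_or_lt with rfl | hy0
    · simp [hVz]
    · refine ⟨hlb y ⟨hy0, hy.2⟩, ?_⟩
      rw [div_mul_eq_mul_div, le_div_iff₀ hρ]
      exact mono y ρ hy0 hy.2 le_rfl
  · push Not at hcase
    refine ⟨q, ⟨hq0.le, hq1⟩, ρ, hρ, κ₁, hκ₁0, κ₂, hκ₂0, fun y hy => ?_⟩
    rcases hy.1.eq_or_lt with rfl | hy0
    · simp [hVz, h0p]
    constructor
    · have htend : Tendsto (fun x : ℝ => -(κ₁ * x ^ q) * y) (𝓝[>] 0) (𝓝 0) := by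
        have : Continuous fun x : ℝ => -(κ₁ * x ^ q) * y :=
          ((continuous_const.mul (Real.continuous_rpow_const hq0.le)).neg).mul continuous_const
        have h := this.tendsto 0
        simp only [Real.zero_rpow hq0.ne', mul_zero, neg_zero, zero_mul] at h
        exact h.mono_left nhdsWithin_le_nhds
      have hle : 0 ≤ V y - κ₁ * y ^ (1 + q) := by
        refine le_of_tendsto htend ?_
        filter_upwards [Ioo_mem_nhdsGT hy0] with x hx
        have h1 := s1 x y hx.1.le hx.2.le hy.2
        rw [hsplit x hx.1] at h1
        have h2 := hV0 x
        refine le_of_mul_le_mul_right ?_ hx.1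
        nlinarith [mul_nonneg h2 hy0.le]
      linarith
    · refine le_of_forall_pos_le_add fun l hl => ?_
      -- A point with small slope; by monotonicity of slopes `min z y` has small slope too, and it
      -- is admissible as the smaller point in `s2`.
      obtain ⟨z, hz, hVz'⟩ := hcase (l / y) (by positivity)
      have hx0 : 0 < min z y := lt_min hz.1 hy0
      have h1 := mono (min z y) z hx0 (min_le_left _ _) hz.2
      have h2 := s2 (min z y) y hx0.le (min_le_right _ _) hy.2
      have h3 : V (min z y) * y ≤ l * min z y := by
        have : V (min z y) * z ≤ l / y * min z y * z := by nlinarith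
        have h4 := le_of_mul_le_mul_right this hz.1
        calc V (min z y) * y ≤ l / y * min z y * y := by gcongr
          _ = l * min z y := by field_simp
      have h4 : 0 ≤ κ₂ * (min z y) ^ (1 + q) * y := by positivity
      have h5 : (V y - κ₂ * y ^ (1 + q)) * min z y ≤ l * min z y := by nlinarith
      linarith [le_of_mul_le_mul_right h5 hx0]

/-- Away from `0` the function and the power are bounded above and below by compactness, so only the
constants change. In the application `V` vanishes again at `R`, the other well, which is why `R' <
R`. -/
theorem exists_rpow_bounds {V : ℝ → ℝ} {q R c : ℝ} (hq : q ∈ Ioo (0 : ℝ) 1) (hR : 0 < R)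
    (hV : Continuous V) (hV0 : ∀ y, 0 ≤ V y) (hVz : V 0 = 0) (hVd : ContDiffOn ℝ 2 V (Ioo 0 R))
    (hVp : ∀ y ∈ Ioo 0 R, 0 < V y)
    (hc : 0 < c) (hlim : Tendsto (fun y => deriv (deriv V) y * y ^ (1 - q)) (𝓝[>] 0) (𝓝 c)) :
    ∃ r ∈ Ico (0 : ℝ) 1, ∀ R' < R, ∃ c₁ > 0, ∃ c₂ > 0, ∀ y ∈ Icc 0 R',
      c₁ * y ^ (1 + r) ≤ V y ∧ V y ≤ c₂ * y ^ (1 + r) := by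
  obtain ⟨r, hr, ρ, hρ, c₁, hc₁, c₂, hc₂, H⟩ :=
    exists_rpow_bounds_nhds_zero hq hR hV hV0 hVz hVd hc hlim
  refine ⟨r, hr, fun R' hR' => ?_⟩
  rcases le_or_gt R' ρ with h | h
  · exact ⟨c₁, hc₁, c₂, hc₂, fun y hy => H y ⟨hy.1, hy.2.trans h⟩⟩
  have hne : (Icc ρ R').Nonempty := nonempty_Icc.2 h.le
  obtain ⟨y₁, hy₁, h1⟩ := isCompact_Icc.exists_isMinOn hne hV.continuousOn
  obtain ⟨y₂, hy₂, h2⟩ := isCompact_Icc.exists_isMaxOn hne hV.continuousOn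
  have hm : 0 < V y₁ := hVp _ ⟨hρ.trans_le hy₁.1, hy₁.2.trans_lt hR'⟩
  have hR'0 : 0 < R' := hρ.trans h
  have hp1 : 0 < R' ^ (1 + r) := Real.rpow_pos_of_pos hR'0 _
  have hp2 : 0 < ρ ^ (1 + r) := Real.rpow_pos_of_pos hρ _
  have hr0 : 0 ≤ 1 + r := by linarith [hr.1]
  refine ⟨min c₁ (V y₁ / R' ^ (1 + r)), by positivity, max c₂ (V y₂ / ρ ^ (1 + r)),
    lt_max_of_lt_left hc₂, fun y hy => ?_⟩
  have hy0 : 0 ≤ y ^ (1 + r) := Real.rpow_nonneg hy.1 _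
  rcases le_or_gt y ρ with hyρ | hyρ
  · obtain ⟨h3, h4⟩ := H y ⟨hy.1, hyρ⟩
    exact ⟨(mul_le_mul_of_nonneg_right (min_le_left _ _) hy0).trans h3,
      h4.trans (mul_le_mul_of_nonneg_right (le_max_left _ _) hy0)⟩
  · have hym : y ∈ Icc ρ R' := ⟨hyρ.le, hy.2⟩
    have h3 : V y₁ ≤ V y := h1 hym
    have h4 : V y ≤ V y₂ := h2 hym
    constructor
    · refine (mul_le_mul_of_nonneg_right (min_le_right _ _) hy0).trans (le_trans ?_ h3)
      rw [div_mul_eq_mul_div, div_le_iff₀ hp1]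
      exact mul_le_mul_of_nonneg_left (Real.rpow_le_rpow hy.1 hy.2 hr0) hm.le
    · refine (h4.trans ?_).trans (mul_le_mul_of_nonneg_right (le_max_right _ _) hy0)
      rw [div_mul_eq_mul_div, le_div_iff₀ hp2]
      exact mul_le_mul_of_nonneg_left (Real.rpow_le_rpow hρ.le hyρ.le hr0) (hV0 _)

namespace IsSubquadraticDoubleWell

variable {W : ℝ → ℝ} {a b q : ℝ}

theorem pos (hW : IsSubquadraticDoubleWell W a b q) {x : ℝ} (hx : x ∈ Ioo a b) : 0 < W x := by
  refine lt_of_le_of_ne (hW.nonneg x) fun h => ?_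
  rcases (hW.eq_zero_iff x).1 h.symm with h | h
  · exact hx.1.ne' h
  · exact hx.2.ne h

theorem exists_bounds_right (hW : IsSubquadraticDoubleWell W a b q) :
    ∃ r ∈ Ico (0 : ℝ) 1, ∀ a' > a, ∃ c₁ > 0, ∃ c₂ > 0, ∀ x ∈ Icc a' b,
      c₁ * (b - x) ^ (1 + r) ≤ W x ∧ W x ≤ c₂ * (b - x) ^ (1 + r) := by
  obtain ⟨c, hc, hlim⟩ := hW.growth_right
  have hab := hW.lt
  have hd1 : deriv (fun y => W (b - y)) = fun y => -deriv W (b - y) :=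
    funext fun y => deriv_comp_const_sub W b y
  have hd2 : deriv (deriv fun y => W (b - y)) = fun y => deriv (deriv W) (b - y) := by
    rw [hd1]; funext y
    rw [deriv.fun_neg, deriv_comp_const_sub (deriv W) b y, neg_neg]
  obtain ⟨r, hr, H⟩ := exists_rpow_bounds (V := fun y => W (b - y)) hW.q_mem (sub_pos.2 hab)
    (hW.continuous.comp (continuous_const.sub continuous_id)) (fun _ => hW.nonneg _)
    (by simp [hW.eq_zero_iff])
    (hW.contDiffOn.comp (contDiffOn_const.sub contDiffOn_id) (fun y hy => by
      simp only [mem_compl_iff, mem_insert_iff, mem_singleton_iff, not_or]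
      exact ⟨fun h => by linarith [hy.2], fun h => by linarith [hy.1]⟩))
    (fun y hy => hW.pos ⟨by linarith [hy.2], by linarith [hy.1]⟩) hc (by
      rw [hd2]
      have ht : Tendsto (fun y : ℝ => b - y) (𝓝[>] 0) (𝓝[≠] b) := by
        refine tendsto_nhdsWithin_iff.2 ⟨?_, ?_⟩
        · have : Continuous fun y : ℝ => b - y := continuous_const.sub continuous_id
          simpa using (this.tendsto 0).mono_left nhdsWithin_le_nhds
        · filter_upwards [self_mem_nhdsWithin] with y hy
          have : (0 : ℝ) < y := hy
          simp [this.ne']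
      refine (hlim.comp ht).congr' ?_
      filter_upwards [self_mem_nhdsWithin] with y hy
      have : (0 : ℝ) < y := hy
      simp [abs_of_pos this])
  refine ⟨r, hr, fun a' ha' => ?_⟩
  obtain ⟨c₁, h1, c₂, h2, h3⟩ := H (b - a') (by linarith)
  refine ⟨c₁, h1, c₂, h2, fun x hx => ?_⟩
  have := h3 (b - x) ⟨by linarith [hx.2], by linarith [hx.1]⟩
  simpa using this

/-- The reflected potential. -/
theorem reflect (hW : IsSubquadraticDoubleWell W a b q) :
    IsSubquadraticDoubleWell (fun x => W (a + b - x)) a b q := by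
  have hd1 : deriv (fun y => W (a + b - y)) = fun y => -deriv W (a + b - y) :=
    funext fun y => deriv_comp_const_sub W (a + b) y
  have hd2 : deriv (deriv fun y => W (a + b - y)) = fun y => deriv (deriv W) (a + b - y) := by
    rw [hd1]; funext y
    rw [deriv.fun_neg, deriv_comp_const_sub (deriv W) (a + b) y, neg_neg]
  have ht : ∀ x z : ℝ, z = a + b - x → Tendsto (fun y : ℝ => a + b - y) (𝓝[≠] x) (𝓝[≠] z) := by
    rintro x z rfl
    refine tendsto_nhdsWithin_iff.2 ⟨?_, ?_⟩
    · have : Continuous fun y : ℝ => a + b - y := continuous_const.sub continuous_id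
      exact (this.tendsto x).mono_left nhdsWithin_le_nhds
    · filter_upwards [self_mem_nhdsWithin] with y hy h
      exact hy (by simp only [mem_singleton_iff] at h ⊢; linarith)
  refine ⟨hW.lt, hW.q_mem, hW.continuous.comp (continuous_const.sub continuous_id),
    fun _ => hW.nonneg _, fun s => ?_, ?_, ?_, ?_⟩
  · rw [hW.eq_zero_iff]
    constructor
    · rintro (h | h)
      · right; linarith
      · left; linarith
    · rintro (h | h)
      · right; linarith
      · left; linarith
  · refine hW.contDiffOn.comp (contDiffOn_const.sub contDiffOn_id) (fun y hy => ?_)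
    simp only [mem_compl_iff, mem_insert_iff, mem_singleton_iff, not_or] at hy ⊢
    exact ⟨fun h => hy.2 (by linarith), fun h => hy.1 (by linarith)⟩
  · obtain ⟨c, hc, h⟩ := hW.growth_right
    refine ⟨c, hc, ?_⟩
    rw [hd2]
    refine (h.comp (ht a b (by ring))).congr fun y => ?_
    simp only [Function.comp]
    rw [show a + b - y - b = -(y - a) by ring, abs_neg]
  · obtain ⟨c, hc, h⟩ := hW.growth_left
    refine ⟨c, hc, ?_⟩
    rw [hd2]
    refine (h.comp (ht b a (by ring))).congr fun y => ?_
    simp only [Function.comp]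
    rw [show a + b - y - a = -(y - b) by ring, abs_neg]

/-- The exponent in `1/√W ≤ C (b-x)^(-(1+r)/2)` exceeds `-1` because `r < 1`: a subquadratic well is
reached in finite time. -/
theorem integrable_right (hW : IsSubquadraticDoubleWell W a b q) :
    IntervalIntegrable (fun x => 1 / √(W x)) volume ((a + b) / 2) b := by
  obtain ⟨r, hr, H⟩ := hW.exists_bounds_right
  have hab := hW.lt
  obtain ⟨c₁, hc₁, c₂, -, h⟩ := H ((a + b) / 2) (by linarith)
  have hmb : (a + b) / 2 ≤ b := by linarith
  have h1 : IntervalIntegrable (fun x : ℝ => x ^ (-((1 + r) / 2))) volume (b - (a + b) / 2)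
      (b - b) := intervalIntegral.intervalIntegrable_rpow' (by linarith [hr.2])
  have h2 := (h1.comp_sub_left b).const_mul (1 / √c₁)
  simp only [sub_sub_cancel] at h2
  refine h2.mono_fun ?_ ?_
  · have : Measurable fun x => 1 / √(W x) :=
      measurable_const.div (Real.continuous_sqrt.comp hW.continuous).measurable
    exact this.aestronglyMeasurable
  · have hne : ∀ᵐ x, x ≠ b := by simp [ae_iff, measure_singleton]
    refine (ae_restrict_iff' measurableSet_uIoc).2 ?_
    filter_upwards [hne] with x hx hxm
    rw [uIoc_of_le hmb] at hxm
    have hxb : 0 < b - x := sub_pos.2 (lt_of_le_of_ne hxm.2 hx)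
    have h3 := (h x ⟨hxm.1.le, hxm.2⟩).1
    have e : (b - x) ^ (-((1 + r) / 2)) = 1 / √((b - x) ^ (1 + r)) := by
      rw [Real.rpow_neg hxb.le, Real.sqrt_eq_rpow, ← Real.rpow_mul hxb.le, one_div]
      congr 2; ring
    rw [e, Real.norm_of_nonneg (by positivity), Real.norm_of_nonneg (by positivity),
      one_div_mul_one_div, ← Real.sqrt_mul hc₁.le]
    have hp : 0 < (b - x) ^ (1 + r) := Real.rpow_pos_of_pos hxb _
    exact one_div_le_one_div_of_le (by positivity) (Real.sqrt_le_sqrt h3)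

theorem intervalIntegrable_inv_sqrt (hW : IsSubquadraticDoubleWell W a b q) :
    IntervalIntegrable (fun x => 1 / √(W x)) volume a b := by
  have h1 := hW.reflect.integrable_right.comp_sub_left (a + b)
  simp only [sub_sub_cancel] at h1
  rw [show a + b - (a + b) / 2 = (a + b) / 2 by ring, show a + b - b = a by ring] at h1
  exact h1.symm.trans hW.integrable_right

end IsSubquadraticDoubleWell

/-! ### Geodesic distance to the right well -/

/-- `∫_x^b 2√W`, the geodesic distance of `x ≤ b` to the well `b`. -/
noncomputable def wellDist (W : ℝ → ℝ) (b x : ℝ) : ℝ := ∫ ρ in x..b, 2 * √(W ρ)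

section wellDist

variable {W : ℝ → ℝ} {b x y : ℝ}

theorem continuous_two_mul_sqrt (hW : Continuous W) : Continuous fun x => 2 * √(W x) :=
  continuous_const.mul (Real.continuous_sqrt.comp hW)

theorem wellDist_sub (hW : Continuous W) (b x y : ℝ) :
    wellDist W b x - wellDist W b y = ∫ ρ in x..y, 2 * √(W ρ) := by
  have hi := fun u v => (continuous_two_mul_sqrt hW).intervalIntegrable (μ := volume) u v
  rw [wellDist, wellDist, ← intervalIntegral.integral_add_adjacent_intervals (hi x y) (hi y b)]
  ring

theorem geodDist_eq (hW : Continuous W) (b x y : ℝ) :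
    geodDist W x y = |wellDist W b x - wellDist W b y| := by
  rw [wellDist_sub hW, geodDist]

@[simp] theorem wellDist_self : wellDist W b b = 0 := by simp [wellDist]

theorem hasDerivAt_wellDist (hW : Continuous W) (b x : ℝ) :
    HasDerivAt (wellDist W b) (-(2 * √(W x))) x := by
  have hc := continuous_two_mul_sqrt hW
  exact intervalIntegral.integral_hasDerivAt_left (hc.intervalIntegrable _ _)
    hc.aestronglyMeasurable.stronglyMeasurableAtFilter hc.continuousAt

theorem continuous_wellDist (hW : Continuous W) (b : ℝ) : Continuous (wellDist W b) :=
  continuous_iff_continuousAt.2 fun x => (hasDerivAt_wellDist hW b x).continuousAt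

theorem wellDist_antitone (hW : Continuous W) (b : ℝ) : Antitone (wellDist W b) := by
  intro x y hxy
  have h := wellDist_sub hW b x y
  have : 0 ≤ ∫ ρ in x..y, 2 * √(W ρ) :=
    intervalIntegral.integral_nonneg hxy fun u _ => by positivity
  linarith

theorem wellDist_nonneg (hx : x ≤ b) : 0 ≤ wellDist W b x :=
  intervalIntegral.integral_nonneg hx fun u _ => by positivity

theorem geodDist_right (hW : Continuous W) (hx : x ≤ b) : geodDist W x b = wellDist W b x := by
  rw [geodDist_eq hW b, wellDist_self, sub_zero, abs_of_nonneg (wellDist_nonneg hx)]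

theorem geodDist_left (hW : Continuous W) (hx : x ≤ b) : geodDist W b x = wellDist W b x := by
  rw [geodDist_eq hW b, wellDist_self, zero_sub, abs_neg, abs_of_nonneg (wellDist_nonneg hx)]

end wellDist

/-! ### Travel time and the optimal profile -/

namespace IsSubquadraticDoubleWell

variable {W : ℝ → ℝ} {a b q α : ℝ}

theorem wellDist_lt (hW : IsSubquadraticDoubleWell W a b q) {x y : ℝ} (hx : a ≤ x) (hxy : x < y)
    (hy : y ≤ b) : wellDist W b y < wellDist W b x := by
  have h := wellDist_sub hW.continuous b x y
  have : 0 < ∫ ρ in x..y, 2 * √(W ρ) := by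
    refine intervalIntegral.intervalIntegral_pos_of_pos_on
      ((continuous_two_mul_sqrt hW.continuous).intervalIntegrable _ _) (fun u hu => ?_) hxy
    have := hW.pos ⟨hx.trans_lt hu.1, hu.2.trans_le hy⟩
    positivity
  linarith

theorem exists_sqrt_bound (hW : IsSubquadraticDoubleWell W a b q) :
    ∃ K > 0, ∀ x ∈ Icc a b, √(W x) ≤ K := by
  obtain ⟨K, hK⟩ := (isCompact_Icc (a := a) (b := b)).exists_bound_of_continuousOn
    (Real.continuous_sqrt.comp hW.continuous).continuousOn
  refine ⟨max K 1, lt_max_of_lt_right one_pos, fun x hx => ?_⟩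
  exact ((le_abs_self _).trans (hK x hx)).trans (le_max_left _ _)

theorem intervalIntegrable_inv_sqrt' (hW : IsSubquadraticDoubleWell W a b q) {x y : ℝ}
    (hx : x ∈ Icc a b) (hy : y ∈ Icc a b) :
    IntervalIntegrable (fun x => 1 / √(W x)) volume x y :=
  hW.intervalIntegrable_inv_sqrt.mono_set (by
    rw [uIcc_of_le hW.lt.le]; exact (convex_Icc a b).ordConnected.uIcc_subset hx hy)

theorem travelTime_sub (hW : IsSubquadraticDoubleWell W a b q) (hα : α ∈ Icc a b) {x y : ℝ}
    (hx : x ∈ Icc a b) (hy : y ∈ Icc a b) :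
    travelTime W α y - travelTime W α x = ∫ s in x..y, 1 / √(W s) := by
  rw [travelTime, travelTime, ← intervalIntegral.integral_add_adjacent_intervals
    (hW.intervalIntegrable_inv_sqrt' hα hx) (hW.intervalIntegrable_inv_sqrt' hx hy)]
  ring

/-- Since `1/√W ≥ 1/K`, the travel time expands distances by at least `1/K`. This gives its strict
monotonicity and the Lipschitz bound for its inverse, the profile. -/
theorem sub_le_mul_travelTime_sub (hW : IsSubquadraticDoubleWell W a b q) (hα : α ∈ Icc a b)
    {K : ℝ} (hK0 : 0 < K) (hK : ∀ x ∈ Icc a b, √(W x) ≤ K) {x y : ℝ} (hx : x ∈ Icc a b)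
    (hy : y ∈ Icc a b) (hxy : x ≤ y) :
    y - x ≤ K * (travelTime W α y - travelTime W α x) := by
  rw [hW.travelTime_sub hα hx hy]
  have h1 : ∫ s in x..y, 1 / K ≤ ∫ s in x..y, 1 / √(W s) := by
    refine intervalIntegral.integral_mono_on_of_le_Ioo hxy (by simp)
      (hW.intervalIntegrable_inv_sqrt' hx hy) fun s hs => ?_
    have := hW.pos ⟨hx.1.trans_lt hs.1, hs.2.trans_le hy.2⟩
    exact one_div_le_one_div_of_le (by positivity)
      (hK s ⟨hx.1.trans hs.1.le, hs.2.le.trans hy.2⟩)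
  rw [intervalIntegral.integral_const, smul_eq_mul] at h1
  calc y - x = K * ((y - x) * (1 / K)) := by field_simp
    _ ≤ _ := by gcongr

theorem travelTime_strictMonoOn (hW : IsSubquadraticDoubleWell W a b q) (hα : α ∈ Icc a b) :
    StrictMonoOn (travelTime W α) (Icc a b) := by
  intro x hx y hy hxy
  obtain ⟨K, hK0, hK⟩ := hW.exists_sqrt_bound
  have := hW.sub_le_mul_travelTime_sub hα hK0 hK hx hy hxy.le
  nlinarith

theorem travelTime_continuousOn (hW : IsSubquadraticDoubleWell W a b q) (hα : α ∈ Icc a b) :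
    ContinuousOn (travelTime W α) (Icc a b) := by
  have h := hW.intervalIntegrable_inv_sqrt
  have := intervalIntegral.continuousOn_primitive_interval' h (a := α)
    (by rwa [uIcc_of_le hW.lt.le])
  rwa [uIcc_of_le hW.lt.le] at this

theorem travelTime_hasDerivAt (hW : IsSubquadraticDoubleWell W a b q) (hα : α ∈ Icc a b) {x : ℝ}
    (hx : x ∈ Ioo a b) : HasDerivAt (travelTime W α) (1 / √(W x)) x := by
  have hm : Measurable fun x => 1 / √(W x) :=
    measurable_const.div (Real.continuous_sqrt.comp hW.continuous).measurable
  refine intervalIntegral.integral_hasDerivAt_right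
    (hW.intervalIntegrable_inv_sqrt' hα (Ioo_subset_Icc_self hx))
    hm.aestronglyMeasurable.stronglyMeasurableAtFilter ?_
  have := hW.pos hx
  exact continuousAt_const.div (Real.continuous_sqrt.comp hW.continuous).continuousAt
    (by positivity)

theorem travelTime_nonneg (hα : α ≤ b) : 0 ≤ travelTime W α b :=
  intervalIntegral.integral_nonneg hα fun _ _ => by positivity

theorem travelTime_self : travelTime W α α = 0 := by simp [travelTime]

theorem profile_spec (hW : IsSubquadraticDoubleWell W a b q) (hα : α ∈ Icc a b) {t : ℝ}
    (ht : t ∈ Icc 0 (travelTime W α b)) :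
    profile W b α t ∈ Icc α b ∧ travelTime W α (profile W b α t) = t := by
  have hsub : Icc α b ⊆ Icc a b := Icc_subset_Icc_left hα.1
  have hsurj : t ∈ travelTime W α '' Icc α b := by
    refine intermediate_value_Icc hα.2 ((hW.travelTime_continuousOn hα).mono hsub) ?_
    rwa [travelTime_self]
  rw [profile, if_pos ht]
  exact ⟨Function.invFunOn_mem hsurj, Function.invFunOn_eq hsurj⟩

theorem profile_of_lt {t : ℝ} (ht : travelTime W α b < t) : profile W b α t = b := by
  rw [profile, if_neg fun h => ht.not_ge h.2]

theorem profile_mem (hW : IsSubquadraticDoubleWell W a b q) (hα : α ∈ Icc a b) (t : ℝ) :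
    profile W b α t ∈ Icc α b := by
  by_cases ht : t ∈ Icc 0 (travelTime W α b)
  · exact (hW.profile_spec hα ht).1
  · rw [profile, if_neg ht]; exact ⟨hα.2, le_rfl⟩

theorem profile_end (hW : IsSubquadraticDoubleWell W a b q) (hα : α ∈ Icc a b) :
    profile W b α (travelTime W α b) = b := by
  have hsub : Icc α b ⊆ Icc a b := Icc_subset_Icc_left hα.1
  have h := hW.profile_spec hα (t := travelTime W α b) ⟨travelTime_nonneg hα.2, le_rfl⟩
  exact (hW.travelTime_strictMonoOn hα).injOn (hsub h.1) ⟨hW.lt.le, le_rfl⟩ h.2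

theorem profile_lipschitz (hW : IsSubquadraticDoubleWell W a b q) (hα : α ∈ Icc a b) :
    ∃ K : NNReal, LipschitzOnWith K (profile W b α) (Icc 0 (travelTime W α b)) := by
  obtain ⟨K, hK0, hK⟩ := hW.exists_sqrt_bound
  refine ⟨⟨K, hK0.le⟩, LipschitzOnWith.of_dist_le_mul ?_⟩
  have hsub : Icc α b ⊆ Icc a b := Icc_subset_Icc_left hα.1
  have key : ∀ s ∈ Icc 0 (travelTime W α b), ∀ t ∈ Icc 0 (travelTime W α b),
      profile W b α s ≤ profile W b α t →
      dist (profile W b α s) (profile W b α t) ≤ K * dist s t := by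
    intro s hs t ht hst
    obtain ⟨h1, h2⟩ := hW.profile_spec hα hs
    obtain ⟨h3, h4⟩ := hW.profile_spec hα ht
    have := hW.sub_le_mul_travelTime_sub hα hK0 hK (hsub h1) (hsub h3) hst
    rw [h2, h4] at this
    rw [dist_comm, Real.dist_eq, abs_of_nonneg (by linarith), dist_comm, Real.dist_eq]
    exact this.trans (by gcongr; exact le_abs_self _)
  intro s hs t ht
  rcases le_total (profile W b α s) (profile W b α t) with h | h
  · exact key s hs t ht h
  · rw [dist_comm, dist_comm s t]; exact key t ht s hs h

theorem profile_hasDerivAt (hW : IsSubquadraticDoubleWell W a b q) (hα : α ∈ Icc a b) {t : ℝ}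
    (ht : t ∈ Ioo 0 (travelTime W α b)) :
    HasDerivAt (profile W b α) (√(W (profile W b α t))) t := by
  obtain ⟨h1, h2⟩ := hW.profile_spec hα (Ioo_subset_Icc_self ht)
  -- The value `a` would force `α = a` and time `0`, the value `b` the final time. So `W` is
  -- positive here, even if `α` is itself a well.
  have hmem : profile W b α t ∈ Ioo a b := by
    refine ⟨lt_of_le_of_ne (hα.1.trans h1.1) fun h => ?_, lt_of_le_of_ne h1.2 fun h => ?_⟩
    · have : profile W b α t = α := le_antisymm (h ▸ hα.1) h1.1
      rw [this, travelTime_self] at h2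
      exact ht.1.ne h2
    · rw [h] at h2; exact ht.2.ne' h2
  have hpos := hW.pos hmem
  obtain ⟨K, hK⟩ := hW.profile_lipschitz hα
  have hc : ContinuousAt (profile W b α) t :=
    hK.continuousOn.continuousAt (Icc_mem_nhds ht.1 ht.2)
  have := HasDerivAt.of_local_left_inverse hc (hW.travelTime_hasDerivAt hα hmem)
    (by positivity) (by
      filter_upwards [Ioo_mem_nhds ht.1 ht.2] with s hs
      exact (hW.profile_spec hα (Ioo_subset_Icc_self hs)).2)
  rwa [one_div, inv_inv] at this

theorem profile_isPrimitive (hW : IsSubquadraticDoubleWell W a b q) (hα : α ∈ Icc a b) :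
    IsPrimitive 0 (travelTime W α b) (profile W b α) (fun t => √(W (profile W b α t))) := by
  obtain ⟨K, hK⟩ := hW.profile_lipschitz hα
  refine .of_ac (travelTime_nonneg hα.2) ?_ (.of_forall fun t ht => hW.profile_hasDerivAt hα ht)
  exact LipschitzOnWith.absolutelyContinuousOnInterval
    (by rwa [uIcc_of_le (travelTime_nonneg hα.2)])

theorem wellDist_isPrimitive (hW : IsSubquadraticDoubleWell W a b q) {c d : ℝ} {w k : ℝ → ℝ}
    (h : IsPrimitive c d w k) (hw : ∀ t ∈ Icc c d, w t ∈ Icc a b) :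
    IsPrimitive c d (fun t => wellDist W b (w t)) (fun t => -(2 * √(W (w t))) * k t) :=
  h.comp_of_mapsTo (F' := fun x => -(2 * √(W x))) hw
    (fun x _ => hasDerivAt_wellDist hW.continuous b x)
    (continuous_two_mul_sqrt hW.continuous).neg.continuousOn

theorem intervalIntegrable_wellDist_profile (hW : IsSubquadraticDoubleWell W a b q)
    (hα : α ∈ Icc a b) {M : ℝ} (hM : travelTime W α b ≤ M) :
    IntervalIntegrable (fun s => wellDist W b (profile W b α s)) volume 0 (travelTime W α b) ∧
      IntervalIntegrable (fun s => wellDist W b (profile W b α s)) volume (travelTime W α b) M := by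
  have hτ0 : 0 ≤ travelTime W α b := travelTime_nonneg hα.2
  constructor
  · refine ContinuousOn.intervalIntegrable ?_
    rw [uIcc_of_le hτ0]
    exact (continuous_wellDist hW.continuous b).comp_continuousOn
      (hW.profile_isPrimitive hα).continuousOn
  · refine (intervalIntegrable_const (c := (0 : ℝ))).congr_ae ?_
    refine (ae_restrict_iff' measurableSet_uIoc).2 (.of_forall fun s hs => ?_)
    rw [uIoc_of_le hM] at hs
    show 0 = wellDist W b (profile W b α s)
    rw [profile_of_lt hs.1, wellDist_self]

/-- Integration by parts in the first moment of the energy of the optimal profile. -/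
theorem integral_profile_eq (hW : IsSubquadraticDoubleWell W a b q) (hα : α ∈ Icc a b) {M : ℝ}
    (hM : travelTime W α b ≤ M) :
    ∫ s in Ioi (0 : ℝ), 2 * √(W (profile W b α s)) * deriv (profile W b α) s * s =
      ∫ s in (0 : ℝ)..M, wellDist W b (profile W b α s) := by
  set z := profile W b α with hz
  set τ := travelTime W α b with hτ
  have hτ0 : 0 ≤ τ := travelTime_nonneg hα.2
  have hWb : W b = 0 := (hW.eq_zero_iff b).2 (Or.inr rfl)
  have hprim := hW.profile_isPrimitive hα
  have hzm : ∀ t ∈ Icc 0 τ, z t ∈ Icc a b := fun t _ =>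
    Icc_subset_Icc_left hα.1 (hW.profile_mem hα t)
  -- Integration by parts against the function `s`. It vanishes at `0` and the distance to the well
  -- vanishes at `τ`, so no boundary terms remain.
  have hparts := (hW.wellDist_isPrimitive hprim hzm).integral_deriv_mul_eq
    (IsPrimitive.affine hτ0 0 1)
  have hend : z τ = b := hW.profile_end hα
  simp only [← hz, ← hτ, hend, wellDist_self] at hparts
  have e1 : ∫ s in Ioi (0 : ℝ), 2 * √(W (z s)) * deriv z s * s =
      ∫ s in Ioc 0 τ, 2 * √(W (z s)) * deriv z s * s := by
    refine setIntegral_eq_of_subset_of_forall_sdiff_eq_zero measurableSet_Ioi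
      (fun s hs => hs.1) fun s hs => ?_
    have : τ < s := not_le.1 fun h => hs.2 ⟨hs.1, h⟩
    rw [hz, profile_of_lt this, hWb]
    simp
  have hne : ∀ᵐ x, x ≠ τ := by simp [ae_iff, measure_singleton]
  have e2 : ∫ s in (0 : ℝ)..τ, 2 * √(W (z s)) * deriv z s * s =
      -∫ s in (0 : ℝ)..τ, -(2 * √(W (z s))) * √(W (z s)) * (0 + 1 * (s - 0)) := by
    rw [← intervalIntegral.integral_neg]
    refine intervalIntegral.integral_congr_ae ?_
    filter_upwards [hne] with s hs hsm
    rw [uIoc_of_le hτ0] at hsm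
    rw [hz, (hW.profile_hasDerivAt hα ⟨hsm.1, lt_of_le_of_ne hsm.2 hs⟩).deriv]
    ring
  have e3 : ∫ s in τ..M, wellDist W b (z s) = 0 := by
    rw [intervalIntegral.integral_congr_ae (g := fun _ => 0)]
    · simp
    · refine .of_forall fun s hs => ?_
      rw [uIoc_of_le hM] at hs
      rw [hz, profile_of_lt hs.1, wellDist_self]
  obtain ⟨hi1, hi2⟩ := hW.intervalIntegrable_wellDist_profile hα hM
  rw [← hz, ← hτ] at hi1 hi2
  rw [e1, ← intervalIntegral.integral_of_le hτ0, e2, hparts,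
    ← intervalIntegral.integral_add_adjacent_intervals hi1 hi2, e3]
  simp

end IsSubquadraticDoubleWell

/-! ### Truncated travel time and almost solutions of `w' = √W(w)` -/

/-- The travel time for the potential truncated from below at `κ`. -/
noncomputable def truncTime (W : ℝ → ℝ) (κ α x : ℝ) : ℝ := ∫ s in α..x, 1 / √(max (W s) κ)

section truncTime

variable {W : ℝ → ℝ} {κ α : ℝ}

theorem continuous_truncated (hW : Continuous W) (hκ : 0 < κ) :
    Continuous fun s => 1 / √(max (W s) κ) := by
  refine continuous_const.div (Real.continuous_sqrt.comp (hW.max continuous_const)) fun s => ?_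
  have : 0 < max (W s) κ := lt_max_of_lt_right hκ
  positivity

theorem truncTime_hasDerivAt (hW : Continuous W) (hκ : 0 < κ) (α x : ℝ) :
    HasDerivAt (truncTime W κ α) (1 / √(max (W x) κ)) x :=
  ((continuous_truncated hW hκ).integral_hasStrictDerivAt α x).hasDerivAt

theorem truncTime_strictMono (hW : Continuous W) (hκ : 0 < κ) (α : ℝ) :
    StrictMono (truncTime W κ α) := by
  refine strictMono_of_hasDerivAt_pos (fun x => truncTime_hasDerivAt hW hκ α x) fun x => ?_
  have : 0 < max (W x) κ := lt_max_of_lt_right hκ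
  positivity

theorem truncTime_continuous (hW : Continuous W) (hκ : 0 < κ) (α : ℝ) :
    Continuous (truncTime W κ α) :=
  continuous_iff_continuousAt.2 fun x => (truncTime_hasDerivAt hW hκ α x).continuousAt

@[simp] theorem truncTime_self : truncTime W κ α α = 0 := by simp [truncTime]

end truncTime

namespace IsSubquadraticDoubleWell

variable {W : ℝ → ℝ} {a b q α : ℝ}

theorem truncTime_le (hW : IsSubquadraticDoubleWell W a b q) (hα : α ∈ Icc a b) {κ x : ℝ}
    (hκ : 0 < κ) (hx : x ∈ Icc α b) : truncTime W κ α x ≤ travelTime W α x := by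
  refine intervalIntegral.integral_mono_on_of_le_Ioo hx.1
    ((continuous_truncated hW.continuous hκ).intervalIntegrable _ _)
    (hW.intervalIntegrable_inv_sqrt' hα ⟨hα.1.trans hx.1, hx.2⟩) fun s hs => ?_
  have := hW.pos (x := s) ⟨hα.1.trans_lt hs.1, hs.2.trans_le hx.2⟩
  exact one_div_le_one_div_of_le (by positivity) (Real.sqrt_le_sqrt (le_max_left _ _))

/-- Dominated convergence as `κ → 0`, with majorant `1/√W`. -/
theorem exists_lt_truncTime (hW : IsSubquadraticDoubleWell W a b q) (hα : α ∈ Icc a b) {x t : ℝ}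
    (hx : x ∈ Icc α b) (ht : t < travelTime W α x) : ∃ κ > 0, t < truncTime W κ α x := by
  have hlim : Tendsto (fun κ => truncTime W κ α x) (𝓝[>] 0) (𝓝 (travelTime W α x)) := by
    refine intervalIntegral.tendsto_integral_filter_of_dominated_convergence
      (fun s => 1 / √(W s)) ?_ ?_
      (hW.intervalIntegrable_inv_sqrt' hα ⟨hα.1.trans hx.1, hx.2⟩) ?_
    · filter_upwards [self_mem_nhdsWithin] with κ hκ
      exact (continuous_truncated hW.continuous hκ).aestronglyMeasurable
    · have hne : ∀ᵐ s, s ≠ b := by simp [ae_iff, measure_singleton]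
      filter_upwards [self_mem_nhdsWithin] with κ hκ
      filter_upwards [hne] with s hs hsm
      rw [uIoc_of_le hx.1] at hsm
      have := hW.pos (x := s) ⟨hα.1.trans_lt hsm.1, lt_of_le_of_ne (hsm.2.trans hx.2) hs⟩
      rw [Real.norm_of_nonneg (by positivity)]
      exact one_div_le_one_div_of_le (by positivity) (Real.sqrt_le_sqrt (le_max_left _ _))
    · have hne : ∀ᵐ s, s ≠ b := by simp [ae_iff, measure_singleton]
      filter_upwards [hne] with s hs hsm
      rw [uIoc_of_le hx.1] at hsm
      have := hW.pos (x := s) ⟨hα.1.trans_lt hsm.1, lt_of_le_of_ne (hsm.2.trans hx.2) hs⟩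
      refine (tendsto_const_nhds (x := 1 / √(W s))).congr' ?_
      filter_upwards [Ioo_mem_nhdsGT this] with κ hκ
      rw [max_eq_left hκ.2.le]
  obtain ⟨κ, h1, h2⟩ := ((hlim.eventually_const_lt ht).and self_mem_nhdsWithin).exists
  exact ⟨κ, h2, h1⟩

end IsSubquadraticDoubleWell

/-- Deviation of a path from the gradient flow of the geodesic distance. -/
noncomputable def flowError (W w k : ℝ → ℝ) (s : ℝ) : ℝ := k s - √(W (w s))

section flowError

variable {W w k : ℝ → ℝ} {M : ℝ}

theorem IsPrimitive.intervalIntegrable_flowError (hW : Continuous W) {c d : ℝ}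
    (h : IsPrimitive c d w k) : IntervalIntegrable (flowError W w k) volume c d := by
  refine h.integrable.sub (ContinuousOn.intervalIntegrable ?_)
  rw [uIcc_of_le h.le]
  exact (Real.continuous_sqrt.comp hW).comp_continuousOn h.continuousOn

theorem IsH1Path.intervalIntegrable_flowError_sq (hW : Continuous W) {c d : ℝ}
    (h : IsH1Path c d w k) :
    IntervalIntegrable (fun s => flowError W w k s ^ 2) volume c d := by
  have hc : ContinuousOn (fun s => √(W (w s))) (uIcc c d) := by
    rw [uIcc_of_le h.le]
    exact (Real.continuous_sqrt.comp hW).comp_continuousOn h.continuousOn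
  have h1 := (h.sq_integrable.sub ((h.integrable.mul_continuousOn hc).const_mul 2)).add
    (hc.pow 2).intervalIntegrable
  refine h1.congr_ae (.of_forall fun s => ?_)
  simp only [flowError, Pi.pow_apply]; ring

/-- Cauchy-Schwarz, by integrating `(|f| - m)²` with `m` the mean of `|f|`. -/
theorem integral_abs_sq_le {M : ℝ} {f : ℝ → ℝ} (hM : 0 < M) (hf : IntervalIntegrable f volume 0 M)
    (hf2 : IntervalIntegrable (fun s => f s ^ 2) volume 0 M) :
    (∫ s in (0 : ℝ)..M, |f s|) ^ 2 ≤ M * ∫ s in (0 : ℝ)..M, f s ^ 2 := by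
  set m := (∫ s in (0 : ℝ)..M, |f s|) / M with hm
  have h0 : 0 ≤ ∫ s in (0 : ℝ)..M, (f s ^ 2 - 2 * m * |f s| + m ^ 2) :=
    intervalIntegral.integral_nonneg hM.le fun s _ => by
      have : f s ^ 2 - 2 * m * |f s| + m ^ 2 = (|f s| - m) ^ 2 := by
        rw [sub_sq, sq_abs]; ring
      rw [this]; positivity
  rw [intervalIntegral.integral_add (hf2.sub (hf.abs.const_mul _)) (by simp),
    intervalIntegral.integral_sub hf2 (hf.abs.const_mul _), intervalIntegral.integral_const_mul,
    intervalIntegral.integral_const, smul_eq_mul, sub_zero] at h0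
  have e : ∫ s in (0 : ℝ)..M, |f s| = m * M := by rw [hm]; field_simp
  rw [e] at h0 ⊢
  nlinarith

theorem IsPrimitive.integral_abs_flowError_le (hW : Continuous W) (h : IsPrimitive 0 M w k) {s : ℝ}
    (hs : s ∈ Icc 0 M) :
    ∫ t in (0 : ℝ)..s, |flowError W w k t| ≤ ∫ t in (0 : ℝ)..M, |flowError W w k t| :=
  intervalIntegral.integral_mono_interval le_rfl hs.1 hs.2 (.of_forall fun _ => abs_nonneg _)
    (h.intervalIntegrable_flowError hW).abs

theorem IsPrimitive.truncTime_comp (hW : Continuous W) {κ : ℝ} (hκ : 0 < κ) (α : ℝ)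
    (h : IsPrimitive 0 M w k) :
    IsPrimitive 0 M (fun t => truncTime W κ α (w t)) (fun t => 1 / √(max (W (w t)) κ) * k t) := by
  obtain ⟨m, hm⟩ := isCompact_Icc.exists_bound_of_continuousOn h.continuousOn
  exact h.comp_of_mapsTo (m₁ := -m) (m₂ := m) (F' := fun x => 1 / √(max (W x) κ))
    (fun t ht => abs_le.1 (hm t ht))
    (fun x _ => truncTime_hasDerivAt hW hκ α x) (continuous_truncated hW hκ).continuousOn

/-- With `k = √W(w) + e`, the derivative `k / √(max W κ)` is at most `1 + |e|/√κ`. The truncation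
keeps the factor of the error bounded even at the wells. -/
theorem IsPrimitive.truncTime_le (hW : Continuous W) {κ : ℝ} (hκ : 0 < κ)
    (α : ℝ) (h : IsPrimitive 0 M w k) {s : ℝ} (hs : s ∈ Icc 0 M) :
    truncTime W κ α (w s) ≤ truncTime W κ α (w 0) + s +
      1 / √κ * ∫ t in (0 : ℝ)..M, |flowError W w k t| := by
  have h' := h.mono le_rfl hs.1 hs.2
  have hp := h'.truncTime_comp hW hκ α
  have he := (h'.intervalIntegrable_flowError hW).abs.const_mul (1 / √κ)
  have h1 : ∫ t in (0 : ℝ)..s, 1 / √(max (W (w t)) κ) * k t ≤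
      ∫ t in (0 : ℝ)..s, (1 + 1 / √κ * |flowError W w k t|) := by
    refine intervalIntegral.integral_mono_on hs.1 hp.integrable
      (intervalIntegrable_const.add he) fun t _ => ?_
    have hm : 0 < max (W (w t)) κ := lt_max_of_lt_right hκ
    have hm' : 0 < √(max (W (w t)) κ) := Real.sqrt_pos.2 hm
    have hk : k t = √(W (w t)) + flowError W w k t := by rw [flowError]; ring
    rw [hk, mul_add]
    refine add_le_add ?_ ?_
    · rw [one_div, inv_mul_le_iff₀ hm', mul_one]; exact Real.sqrt_le_sqrt (le_max_left _ _)
    · refine (mul_le_mul_of_nonneg_left (le_abs_self _) (by positivity)).trans ?_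
      refine mul_le_mul_of_nonneg_right ?_ (abs_nonneg _)
      exact one_div_le_one_div_of_le (Real.sqrt_pos.2 hκ) (Real.sqrt_le_sqrt (le_max_right _ _))
  rw [hp.integral_eq_sub, intervalIntegral.integral_add intervalIntegrable_const he,
    intervalIntegral.integral_const, intervalIntegral.integral_const_mul, smul_eq_mul] at h1
  have h2 := mul_le_mul_of_nonneg_left (h.integral_abs_flowError_le hW hs)
    (show 0 ≤ 1 / √κ by positivity)
  linarith

/-- Where `W(w) ≥ κ` the truncation is inactive and the derivative is at least `1 - |e|/√κ`. -/
theorem IsPrimitive.le_truncTime (hW : Continuous W) {κ : ℝ} (hκ : 0 < κ)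
    (α : ℝ) (h : IsPrimitive 0 M w k) {s : ℝ} (hs : s ∈ Icc 0 M)
    (hκW : ∀ t ∈ Icc 0 s, κ ≤ W (w t)) :
    truncTime W κ α (w 0) + s - 1 / √κ * ∫ t in (0 : ℝ)..M, |flowError W w k t| ≤
      truncTime W κ α (w s) := by
  have h' := h.mono le_rfl hs.1 hs.2
  have hp := h'.truncTime_comp hW hκ α
  have he := (h'.intervalIntegrable_flowError hW).abs.const_mul (1 / √κ)
  have h1 : ∫ t in (0 : ℝ)..s, (1 - 1 / √κ * |flowError W w k t|) ≤
      ∫ t in (0 : ℝ)..s, 1 / √(max (W (w t)) κ) * k t := by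
    refine intervalIntegral.integral_mono_on hs.1
      (intervalIntegrable_const.sub he) hp.integrable fun t ht => ?_
    have hWt := hκW t ht
    have hm' : 0 < √(W (w t)) := Real.sqrt_pos.2 (hκ.trans_le hWt)
    have hk : k t = √(W (w t)) + flowError W w k t := by rw [flowError]; ring
    rw [max_eq_left hWt, hk, mul_add, one_div_mul_cancel hm'.ne', sub_eq_add_neg]
    refine add_le_add le_rfl ?_
    have h3 : 1 / √(W (w t)) * |flowError W w k t| ≤ 1 / √κ * |flowError W w k t| :=
      mul_le_mul_of_nonneg_right
        (one_div_le_one_div_of_le (Real.sqrt_pos.2 hκ) (Real.sqrt_le_sqrt hWt)) (abs_nonneg _)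
    have h4 : -(1 / √(W (w t)) * |flowError W w k t|) ≤ 1 / √(W (w t)) * flowError W w k t := by
      rw [← mul_neg]
      exact mul_le_mul_of_nonneg_left (neg_abs_le _) (by positivity)
    linarith
  rw [hp.integral_eq_sub, intervalIntegral.integral_sub intervalIntegrable_const he,
    intervalIntegral.integral_const, intervalIntegral.integral_const_mul, smul_eq_mul] at h1
  have h2 := mul_le_mul_of_nonneg_left (h.integral_abs_flowError_le hW hs)
    (show 0 ≤ 1 / √κ by positivity)
  linarith

/-- The derivative of the distance along the path is `-2W(w) - 2√W(w) e ≤ 2K|e|`: up to the flow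
error, the distance to `b` decreases. -/
theorem IsSubquadraticDoubleWell.wellDist_le_add {a b q K : ℝ}
    (hW : IsSubquadraticDoubleWell W a b q) (hK : ∀ x ∈ Icc a b, √(W x) ≤ K)
    (h : IsPrimitive 0 M w k) (hw : ∀ t ∈ Icc 0 M, w t ∈ Icc a b) {s t : ℝ} (hs : 0 ≤ s)
    (hst : s ≤ t) (ht : t ≤ M) :
    wellDist W b (w t) ≤ wellDist W b (w s) +
      2 * K * ∫ t in (0 : ℝ)..M, |flowError W w k t| := by
  have hp := hW.wellDist_isPrimitive h hw
  have hei := (h.intervalIntegrable_flowError hW.continuous).abs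
  have h' := (h.mono hs hst ht)
  have he := (h'.intervalIntegrable_flowError hW.continuous).abs.const_mul (2 * K)
  have hK0 : 0 ≤ K := (Real.sqrt_nonneg _).trans (hK a ⟨le_rfl, hW.lt.le⟩)
  have h1 : ∫ τ in s..t, -(2 * √(W (w τ))) * k τ ≤
      ∫ τ in s..t, 2 * K * |flowError W w k τ| := by
    refine intervalIntegral.integral_mono_on hst (hp.mono hs hst ht).integrable he fun τ hτ => ?_
    have hk : k τ = √(W (w τ)) + flowError W w k τ := by rw [flowError]; ring
    have h2 := hK _ (hw τ ⟨hs.trans hτ.1, hτ.2.trans ht⟩)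
    have h3 : 0 ≤ √(W (w τ)) := Real.sqrt_nonneg _
    have h4 := neg_abs_le (flowError W w k τ)
    have h5 := abs_nonneg (flowError W w k τ)
    rw [hk]
    nlinarith
  rw [← hp.sub_eq_integral hs hst ht, intervalIntegral.integral_const_mul] at h1
  have h2 := intervalIntegral.integral_mono_interval hs hst ht
    (.of_forall fun τ => abs_nonneg (flowError W w k τ)) hei
  have h3 := mul_le_mul_of_nonneg_left h2 (show 0 ≤ 2 * K by positivity)
  linarith

end flowError

namespace IsSubquadraticDoubleWell

variable {W : ℝ → ℝ} {a b q α : ℝ} {w k : ℕ → ℝ → ℝ} {M : ℝ}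

/-- Almost solutions of `w' = √W(w)` stay asymptotically below the optimal profile. -/
theorem eventually_lt_of_profile_lt (hW : IsSubquadraticDoubleWell W a b q) (hα : α ∈ Icc a b)
    (hp : ∀ᶠ n in atTop, IsPrimitive 0 M (w n) (k n))
    (hw : ∀ᶠ n in atTop, ∀ s ∈ Icc 0 M, w n s ∈ Icc a b)
    (h0 : Tendsto (fun n => w n 0) atTop (𝓝 α))
    (he : Tendsto (fun n => ∫ t in (0 : ℝ)..M, |flowError W (w n) (k n) t|) atTop (𝓝 0))
    {s x : ℝ} (hs : s ∈ Icc 0 M) (hx : profile W b α s < x) : ∀ᶠ n in atTop, w n s < x := by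
  rcases lt_or_ge b x with hbx | hxb
  · filter_upwards [hw] with n hn using (hn s hs).2.trans_lt hbx
  have hsτ : s ≤ travelTime W α b := by
    by_contra h
    rw [profile_of_lt (not_le.1 h)] at hx
    exact absurd hx (not_lt.2 hxb)
  obtain ⟨h1, h2⟩ := hW.profile_spec hα ⟨hs.1, hsτ⟩
  have hxm : x ∈ Icc α b := ⟨h1.1.trans hx.le, hxb⟩
  have hsub : Icc α b ⊆ Icc a b := Icc_subset_Icc_left hα.1
  have h3 : s < travelTime W α x := by
    conv_lhs => rw [← h2]
    exact hW.travelTime_strictMonoOn hα (hsub h1) (hsub hxm) hx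
  obtain ⟨κ, hκ, h4⟩ := hW.exists_lt_truncTime hα hxm h3
  have hlim : Tendsto (fun n => truncTime W κ α (w n 0) + s +
      1 / √κ * ∫ t in (0 : ℝ)..M, |flowError W (w n) (k n) t|) atTop (𝓝 s) := by
    have h5 := ((truncTime_continuous hW.continuous hκ α).tendsto α).comp h0
    have h6 := (h5.add_const s).add (he.const_mul (1 / √κ))
    simpa using h6
  filter_upwards [hp, hlim.eventually_lt_const h4] with n hn h5
  exact (truncTime_strictMono hW.continuous hκ α).lt_iff_lt.1
    ((hn.truncTime_le hW.continuous hκ α hs).trans_lt h5)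

/-- Almost solutions of `w' = √W(w)` that stay away from the well `a` stay asymptotically above the
optimal profile. -/
theorem eventually_gt_of_lt_profile (hW : IsSubquadraticDoubleWell W a b q) (hα : α ∈ Icc a b)
    (hp : ∀ᶠ n in atTop, IsPrimitive 0 M (w n) (k n)) {a' : ℝ} (ha' : a < a')
    (hw : ∀ᶠ n in atTop, ∀ s ∈ Icc 0 M, w n s ∈ Icc a' b)
    (h0 : Tendsto (fun n => w n 0) atTop (𝓝 α))
    (he : Tendsto (fun n => ∫ t in (0 : ℝ)..M, |flowError W (w n) (k n) t|) atTop (𝓝 0))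
    {s x : ℝ} (hs : s ∈ Ioc 0 M) (hx : x < profile W b α s) : ∀ᶠ n in atTop, x < w n s := by
  obtain ⟨K, hK0, hK⟩ := hW.exists_sqrt_bound
  have hzb := (hW.profile_mem hα s).2
  set y := max x a with hy
  have hxb : x < b := hx.trans_le hzb
  have hd : 0 < wellDist W b x := by
    have h1 := hW.wellDist_lt (x := y) (y := b) (le_max_right _ _) (max_lt hxb hW.lt) le_rfl
    rw [wellDist_self] at h1
    exact h1.trans_le (wellDist_antitone hW.continuous b (le_max_left _ _))
  set d := wellDist W b x with hddef
  -- This set avoids `a` because of `a'` and avoids `b` because of `d / 2`, so `W` has a positive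
  -- lower bound on it.
  have hcomp : IsCompact (Icc a' b ∩ {y | d / 2 ≤ wellDist W b y}) :=
    isCompact_Icc.inter_right (isClosed_le continuous_const (continuous_wellDist hW.continuous b))
  obtain ⟨κ, hκ, hκW⟩ : ∃ κ > 0, ∀ y ∈ Icc a' b ∩ {y | d / 2 ≤ wellDist W b y}, κ ≤ W y := by
    rcases (Icc a' b ∩ {y | d / 2 ≤ wellDist W b y}).eq_empty_or_nonempty with h | h
    · exact ⟨1, one_pos, fun y hy => by rw [h] at hy; exact hy.elim⟩
    · obtain ⟨y₀, hy₀, hmin⟩ := hcomp.exists_isMinOn h hW.continuous.continuousOn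
      refine ⟨W y₀, hW.pos ⟨ha'.trans_le hy₀.1.1, lt_of_le_of_ne hy₀.1.2 fun h => ?_⟩,
        fun y hy => hmin hy⟩
      have := hy₀.2
      simp only [mem_ofPred_eq, h, wellDist_self] at this
      linarith
  have h4 : truncTime W κ α x < s := by
    rcases lt_or_ge x α with hxα | hxα
    · have := truncTime_strictMono hW.continuous hκ α hxα
      rw [truncTime_self] at this
      exact this.trans hs.1
    · have hxm : x ∈ Icc α b := ⟨hxα, hxb.le⟩
      refine (hW.truncTime_le hα hκ hxm).trans_lt ?_
      have hsub : Icc α b ⊆ Icc a b := Icc_subset_Icc_left hα.1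
      rcases le_or_gt s (travelTime W α b) with hsτ | hsτ
      · obtain ⟨h1, h2⟩ := hW.profile_spec hα ⟨hs.1.le, hsτ⟩
        rw [← h2]
        refine hW.travelTime_strictMonoOn hα (hsub hxm) (hsub h1) ?_
        exact hx
      · refine lt_of_le_of_lt ?_ hsτ
        exact (hW.travelTime_strictMonoOn hα).monotoneOn (hsub hxm) ⟨hW.lt.le, le_rfl⟩ hxb.le
  have hlim : Tendsto (fun n => truncTime W κ α (w n 0) + s -
      1 / √κ * ∫ t in (0 : ℝ)..M, |flowError W (w n) (k n) t|) atTop (𝓝 s) := by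
    have h5 := ((truncTime_continuous hW.continuous hκ α).tendsto α).comp h0
    have h6 := (h5.add_const s).sub (he.const_mul (1 / √κ))
    simpa using h6
  have hlim2 : Tendsto (fun n => 2 * K * ∫ t in (0 : ℝ)..M, |flowError W (w n) (k n) t|) atTop
      (𝓝 0) := by simpa using he.const_mul (2 * K)
  filter_upwards [hp, hw, hlim.eventually_const_lt h4,
    hlim2.eventually_lt_const (show 0 < d / 2 by positivity)] with n hn hwn h5 h6
  -- If the path had not passed `x` by time `s`, the almost monotone distance would have been at
  -- least `d / 2` at all earlier times. The path would then have stayed where `W ≥ κ`, and its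
  -- truncated travel time would be almost `s`, beyond that of `x`.
  by_contra hcon
  have hle : w n s ≤ x := not_lt.1 hcon
  have h7 := hn.le_truncTime hW.continuous hκ α ⟨hs.1.le, hs.2⟩ (by
    intro t ht
    refine hκW _ ⟨hwn t ⟨ht.1, ht.2.trans hs.2⟩, ?_⟩
    have h8 := hW.wellDist_le_add hK hn
      (fun t ht => Icc_subset_Icc_left ha'.le (hwn t ht)) ht.1 ht.2 hs.2
    have h9 : d ≤ wellDist W b (w n s) := wellDist_antitone hW.continuous b hle
    show d / 2 ≤ wellDist W b (w n t)
    linarith)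
  have h8 := (truncTime_strictMono hW.continuous hκ α).monotone hle
  linarith

theorem eventually_lt_wellDist (hW : IsSubquadraticDoubleWell W a b q) (hα : α ∈ Icc a b)
    (hp : ∀ᶠ n in atTop, IsPrimitive 0 M (w n) (k n))
    (hw : ∀ᶠ n in atTop, ∀ s ∈ Icc 0 M, w n s ∈ Icc a b)
    (h0 : Tendsto (fun n => w n 0) atTop (𝓝 α))
    (he : Tendsto (fun n => ∫ t in (0 : ℝ)..M, |flowError W (w n) (k n) t|) atTop (𝓝 0))
    {s l : ℝ} (hs : s ∈ Icc 0 M) (hl : l < wellDist W b (profile W b α s)) :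
    ∀ᶠ n in atTop, l < wellDist W b (w n s) := by
  have h1 : ∀ᶠ x in 𝓝[>] profile W b α s, l < wellDist W b x :=
    (((continuous_wellDist hW.continuous b).tendsto _).eventually_const_lt hl).filter_mono
      nhdsWithin_le_nhds
  obtain ⟨x, hx1, hx2⟩ := (h1.and self_mem_nhdsWithin).exists
  filter_upwards [hW.eventually_lt_of_profile_lt hα hp hw h0 he hs hx2] with n hn
  exact hx1.trans_le (wellDist_antitone hW.continuous b hn.le)

theorem eventually_wellDist_lt (hW : IsSubquadraticDoubleWell W a b q) (hα : α ∈ Icc a b)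
    (hp : ∀ᶠ n in atTop, IsPrimitive 0 M (w n) (k n)) {a' : ℝ} (ha' : a < a')
    (hw : ∀ᶠ n in atTop, ∀ s ∈ Icc 0 M, w n s ∈ Icc a' b)
    (h0 : Tendsto (fun n => w n 0) atTop (𝓝 α))
    (he : Tendsto (fun n => ∫ t in (0 : ℝ)..M, |flowError W (w n) (k n) t|) atTop (𝓝 0))
    {s l : ℝ} (hs : s ∈ Ioc 0 M) (hl : wellDist W b (profile W b α s) < l) :
    ∀ᶠ n in atTop, wellDist W b (w n s) < l := by
  have h1 : ∀ᶠ x in 𝓝[<] profile W b α s, wellDist W b x < l :=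
    (((continuous_wellDist hW.continuous b).tendsto _).eventually_lt_const hl).filter_mono
      nhdsWithin_le_nhds
  obtain ⟨x, hx1, hx2⟩ := (h1.and self_mem_nhdsWithin).exists
  filter_upwards [hW.eventually_gt_of_lt_profile hα hp ha' hw h0 he hs hx2] with n hn
  exact (wellDist_antitone hW.continuous b hn.le).trans_lt hx1

end IsSubquadraticDoubleWell

/-! ### Extinction, arrival at `b` and avoidance of `a` -/

/-- A positive function with `f' ≤ -c f^θ`, `θ < 1`, becomes extinct in finite time. -/
theorem IsPrimitive.extinction_time_le {f g : ℝ → ℝ} {M c θ E₀ : ℝ} (h : IsPrimitive 0 M f g)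
    (hpos : ∀ t ∈ Icc 0 M, 0 < f t) (hθ : θ < 1)
    (hg : ∀ t ∈ Icc 0 M, g t ≤ -(c * f t ^ θ)) (hE : f 0 ≤ E₀) :
    M * ((1 - θ) * c) ≤ E₀ ^ (1 - θ) := by
  have hM := h.le
  have hne : (Icc 0 M).Nonempty := nonempty_Icc.2 hM
  obtain ⟨t₁, ht₁, hmin⟩ := isCompact_Icc.exists_isMinOn hne h.continuousOn
  obtain ⟨t₂, ht₂, hmax⟩ := isCompact_Icc.exists_isMaxOn hne h.continuousOn
  have hθ' : 0 < 1 - θ := by linarith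
  -- `f^(1-θ)` decreases at rate at least `(1-θ)c`. The positive minimum `f t₁` confines the range
  -- of `f` to where the power is smooth.
  have hp := h.comp_of_mapsTo (F := fun x => x ^ (1 - θ)) (F' := fun x => (1 - θ) * x ^ (-θ))
    (m₁ := f t₁) (m₂ := f t₂) (fun t ht => ⟨hmin ht, hmax ht⟩)
    (fun x hx => by
      have := Real.hasDerivAt_rpow_const (x := x) (p := 1 - θ)
        (Or.inl ((hpos t₁ ht₁).trans_le hx.1).ne')
      rwa [show 1 - θ - 1 = -θ by ring] at this)
    (continuousOn_const.mul (continuousOn_id.rpow_const fun x hx =>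
      Or.inl ((hpos t₁ ht₁).trans_le hx.1).ne'))
  have h1 : ∫ t in (0 : ℝ)..M, (1 - θ) * f t ^ (-θ) * g t ≤ ∫ t in (0 : ℝ)..M, -((1 - θ) * c) := by
    refine intervalIntegral.integral_mono_on hM hp.integrable intervalIntegrable_const
      fun t ht => ?_
    have h2 := hpos t ht
    have h3 : f t ^ (-θ) * f t ^ θ = 1 := by
      rw [← Real.rpow_add h2, neg_add_cancel, Real.rpow_zero]
    calc (1 - θ) * f t ^ (-θ) * g t ≤ (1 - θ) * f t ^ (-θ) * -(c * f t ^ θ) :=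
          mul_le_mul_of_nonneg_left (hg t ht) (by positivity)
      _ = -((1 - θ) * c) * (f t ^ (-θ) * f t ^ θ) := by ring
      _ = -((1 - θ) * c) := by rw [h3, mul_one]
  rw [hp.integral_eq_sub, intervalIntegral.integral_const, smul_eq_mul] at h1
  have h4 : 0 ≤ f M ^ (1 - θ) := Real.rpow_nonneg (hpos M ⟨hM, le_rfl⟩).le _
  have h5 : f 0 ^ (1 - θ) ≤ E₀ ^ (1 - θ) :=
    Real.rpow_le_rpow (hpos 0 ⟨le_rfl, hM⟩).le hE hθ'.le
  linarith

theorem IsH1Path.pathEnergy_le {W η : ℝ → ℝ} (hW : Continuous W) {c d B : ℝ} {u g : ℝ → ℝ}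
    (h : IsH1Path c d u g) (hη : ContinuousOn η (Icc c d))
    (hB : ∀ s ∈ Icc c d, (W (u s) + g s ^ 2) * η s ≤ B) :
    pathEnergy W η c d u g ≤ (d - c) * B := by
  have h1 := intervalIntegral.integral_mono_on h.le (h.intervalIntegrable_energy hW hη)
    (intervalIntegrable_const (c := B)) hB
  rwa [intervalIntegral.integral_const, smul_eq_mul] at h1

theorem pathEnergy_nonneg {W η : ℝ → ℝ} (hW0 : ∀ x, 0 ≤ W x) {c d : ℝ} (hcd : c ≤ d)
    (hη : ∀ s ∈ Icc c d, 0 ≤ η s) (u g : ℝ → ℝ) : 0 ≤ pathEnergy W η c d u g :=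
  intervalIntegral.integral_nonneg hcd fun s hs =>
    mul_nonneg (add_nonneg (hW0 _) (sq_nonneg _)) (hη s hs)

/-- Tails of minimizing paths are minimizing. -/
theorem IsH1Path.tail_minimal {W η : ℝ → ℝ} (hW : Continuous W) {S : ℝ} {w k : ℝ → ℝ}
    (h : IsH1Path 0 S w k) (hη : ContinuousOn η (Icc 0 S))
    (hmin : ∀ w' k' : ℝ → ℝ, IsH1Path 0 S w' k' → w' 0 = w 0 → w' S = w S →
      pathEnergy W η 0 S w k ≤ pathEnergy W η 0 S w' k')
    {s : ℝ} (hs : s ∈ Icc 0 S) {u g : ℝ → ℝ} (hu : IsH1Path s S u g) (hus : u s = w s)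
    (huS : u S = w S) : pathEnergy W η s S w k ≤ pathEnergy W η s S u g := by
  have h1 := h.mono le_rfl hs.1 hs.2
  have h2 := hmin _ _ (h1.glue hu hus.symm) (by simp [hs.1]) (by simp [huS])
  rw [pathEnergy_glue hW h1 hu hus.symm hη, ← h.pathEnergy_add hW hη hs] at h2
  linarith

namespace IsSubquadraticDoubleWell

variable {W : ℝ → ℝ} {a b q : ℝ}

theorem well_right (hW : IsSubquadraticDoubleWell W a b q) : W b = 0 :=
  (hW.eq_zero_iff b).2 (Or.inr rfl)

theorem well_left (hW : IsSubquadraticDoubleWell W a b q) : W a = 0 :=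
  (hW.eq_zero_iff a).2 (Or.inl rfl)

/-- The energy controls the variation of the geodesic distance to the well. -/
theorem mul_abs_wellDist_sub_le (hW : IsSubquadraticDoubleWell W a b q) {η w k : ℝ → ℝ}
    {c d m : ℝ} (h : IsH1Path c d w k) (hw : ∀ t ∈ Icc c d, w t ∈ Icc a b)
    (hη : ContinuousOn η (Icc c d)) (hm0 : 0 ≤ m) (hm : ∀ t ∈ Icc c d, m ≤ η t) :
    m * |wellDist W b (w d) - wellDist W b (w c)| ≤ pathEnergy W η c d w k := by
  have hp := hW.wellDist_isPrimitive h.toIsPrimitive hw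
  rw [← hp.integral_eq_sub]
  have h1 := intervalIntegral.abs_integral_le_integral_abs (μ := volume)
    (f := fun t => -(2 * √(W (w t))) * k t) h.le
  refine (mul_le_mul_of_nonneg_left h1 hm0).trans ?_
  rw [← intervalIntegral.integral_const_mul]
  refine intervalIntegral.integral_mono_on h.le (hp.integrable.abs.const_mul m)
    (h.intervalIntegrable_energy hW.continuous hη) fun t ht => ?_
  have h2 : |-(2 * √(W (w t))) * k t| ≤ W (w t) + k t ^ 2 := by
    have h3 := Real.sq_sqrt (hW.nonneg (w t))
    rw [abs_le]
    constructor <;> nlinarith [sq_nonneg (√(W (w t)) - k t), sq_nonneg (√(W (w t)) + k t)]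
  have h4 := hm t ht
  have h5 : 0 ≤ W (w t) + k t ^ 2 := add_nonneg (hW.nonneg _) (sq_nonneg _)
  calc m * |-(2 * √(W (w t))) * k t| ≤ m * (W (w t) + k t ^ 2) := by gcongr
    _ ≤ (W (w t) + k t ^ 2) * η t := by rw [mul_comm]; gcongr

/-- Decomposition of the energy by completing the square and integrating by parts. -/
theorem pathEnergy_eq (hW : IsSubquadraticDoubleWell W a b q) {η η' w k : ℝ → ℝ}
    {c d : ℝ} (h : IsH1Path c d w k) (hw : ∀ t ∈ Icc c d, w t ∈ Icc a b)
    (hη : IsPrimitive c d η η') :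
    pathEnergy W η c d w k = wellDist W b (w c) * η c - wellDist W b (w d) * η d +
      (∫ s in c..d, wellDist W b (w s) * η' s) + ∫ s in c..d, flowError W w k s ^ 2 * η s := by
  have hp := hW.wellDist_isPrimitive h.toIsPrimitive hw
  have h1 := hp.integral_deriv_mul_eq hη
  have hηc : ContinuousOn η (uIcc c d) := by rw [uIcc_of_le h.le]; exact hη.continuousOn
  have hi1 := hp.integrable.mul_continuousOn hηc
  have hi2 := (h.intervalIntegrable_flowError_sq hW.continuous).mul_continuousOn hηc
  have h2 : pathEnergy W η c d w k = -(∫ s in c..d, -(2 * √(W (w s))) * k s * η s) +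
      ∫ s in c..d, flowError W w k s ^ 2 * η s := by
    have hi3 : IntervalIntegrable (fun x => -(-(2 * √(W (w x))) * k x * η x)) volume c d := hi1.neg
    rw [← intervalIntegral.integral_neg, ← intervalIntegral.integral_add hi3 hi2]
    refine intervalIntegral.integral_congr fun s _ => ?_
    have h3 := Real.sq_sqrt (hW.nonneg (w s))
    simp only [flowError]
    linear_combination (-η s) * h3
  rw [h2, h1]; ring

/-- Lower bound on the distance to the well near `b`. -/
theorem exists_rpow_le_wellDist (hW : IsSubquadraticDoubleWell W a b q) {a' r c₁ : ℝ}
    (hr : 0 ≤ r) (hc₁ : 0 < c₁)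
    (hlow : ∀ x ∈ Icc a' b, c₁ * (b - x) ^ (1 + r) ≤ W x) :
    ∃ c > 0, ∀ x ∈ Icc a' b, c * (b - x) ^ ((3 + r) / 2) ≤ wellDist W b x := by
  refine ⟨2 * √c₁ * (1 / 2) ^ ((3 + r) / 2), by positivity, fun x hx => ?_⟩
  have hy : 0 ≤ b - x := by linarith [hx.2]
  -- On `[x, m]` the distance to `b` is at least half of `b - x`, so the integrand is bounded below
  -- by a constant.
  set m := (x + b) / 2 with hm
  have hxm : x ≤ m := by linarith
  have hmb : m ≤ b := by linarith [hx.2]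
  have h1 := wellDist_sub hW.continuous b x m
  have h2 : ∫ s in x..m, 2 * (√c₁ * ((b - x) / 2) ^ ((1 + r) / 2)) ≤ ∫ s in x..m, 2 * √(W s) := by
    refine intervalIntegral.integral_mono_on hxm intervalIntegrable_const
      ((continuous_two_mul_sqrt hW.continuous).intervalIntegrable _ _) fun s hs => ?_
    have h3 := hlow s ⟨hx.1.trans hs.1, hs.2.trans hmb⟩
    have h4 : (b - x) / 2 ≤ b - s := by linarith [hs.2]
    have h5 : ((b - x) / 2) ^ (1 + r) ≤ (b - s) ^ (1 + r) :=
      Real.rpow_le_rpow (by positivity) h4 (by linarith)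
    have h6 : √(c₁ * ((b - x) / 2) ^ (1 + r)) ≤ √(W s) :=
      Real.sqrt_le_sqrt ((mul_le_mul_of_nonneg_left h5 hc₁.le).trans h3)
    rw [Real.sqrt_mul hc₁.le, Real.sqrt_eq_rpow (_ ^ _), ← Real.rpow_mul (by positivity)] at h6
    rw [show (1 + r) / 2 = (1 + r) * (1 / 2) by ring]
    linarith
  rw [intervalIntegral.integral_const, smul_eq_mul, ← h1] at h2
  have h7 := wellDist_nonneg (W := W) hmb
  have h8 : (b - x) ^ ((3 + r) / 2) * (1 / 2) ^ ((3 + r) / 2) =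
      (b - x) / 2 * ((b - x) / 2) ^ ((1 + r) / 2) := by
    rw [← Real.mul_rpow hy (by norm_num), show (3 + r) / 2 = 1 + (1 + r) / 2 by ring,
      Real.rpow_add_of_nonneg (by positivity) (by norm_num) (by linarith), Real.rpow_one]
    ring_nf
  have h9 : m - x = (b - x) / 2 := by rw [hm]; ring
  rw [h9] at h2
  calc 2 * √c₁ * (1 / 2) ^ ((3 + r) / 2) * (b - x) ^ ((3 + r) / 2)
      = 2 * √c₁ * ((b - x) ^ ((3 + r) / 2) * (1 / 2) ^ ((3 + r) / 2)) := by ring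
    _ = (b - x) / 2 * (2 * (√c₁ * ((b - x) / 2) ^ ((1 + r) / 2))) := by rw [h8]; ring
    _ ≤ wellDist W b x := by linarith

/-- On long intervals, two points near the well `b` can be joined at small cost by passing through
the well. -/
theorem exists_competitor (hW : IsSubquadraticDoubleWell W a b q) {a' r c₂ : ℝ}
    (hr : r ∈ Ico (0 : ℝ) 1) (hc₂ : 0 < c₂)
    (hup : ∀ x ∈ Icc a' b, W x ≤ c₂ * (b - x) ^ (1 + r)) {η : ℝ → ℝ} {c d x₀ x₁ : ℝ}
    (hcd : c + 2 * (b - a') ^ ((1 - r) / 2) ≤ d) (hη : ContinuousOn η (Icc c d))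
    (hη0 : ∀ s ∈ Icc c d, 0 ≤ η s) (hη2 : ∀ s ∈ Icc c d, η s ≤ 2) (hx₀ : x₀ ∈ Icc a' b)
    (hx₁ : x₁ ∈ Icc a' b) :
    ∃ u g : ℝ → ℝ, IsH1Path c d u g ∧ u c = x₀ ∧ u d = x₁ ∧
      pathEnergy W η c d u g ≤
        2 * (c₂ + 1) * ((b - x₀) ^ ((3 + r) / 2) + (b - x₁) ^ ((3 + r) / 2)) := by
  obtain ⟨hr0, hr1⟩ := hr
  have hy₀ : 0 ≤ b - x₀ := by linarith [hx₀.2]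
  have hy₁ : 0 ≤ b - x₁ := by linarith [hx₁.2]
  have hτ : ∀ x ∈ Icc a' b, (b - x) ^ ((1 - r) / 2) ≤ (b - a') ^ ((1 - r) / 2) := fun x hx =>
    Real.rpow_le_rpow (by linarith [hx.2]) (by linarith [hx.1]) (by linarith)
  have hmul : ∀ y : ℝ, 0 ≤ y → y ^ ((1 + r) / 2) * y ^ ((1 - r) / 2) = y := fun y hy => by
    rw [← Real.rpow_add_of_nonneg hy (by linarith) (by linarith),
      show (1 + r) / 2 + (1 - r) / 2 = 1 by ring, Real.rpow_one]
  have hsq : ∀ y : ℝ, 0 ≤ y → (y ^ ((1 + r) / 2)) ^ 2 = y ^ (1 + r) := fun y hy => by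
    rw [← Real.rpow_natCast, ← Real.rpow_mul hy]; congr 1; push_cast; ring
  have hcost : ∀ y : ℝ, 0 ≤ y → y ^ ((1 - r) / 2) * ((c₂ * y ^ (1 + r) + y ^ (1 + r)) * 2) =
      2 * (c₂ + 1) * y ^ ((3 + r) / 2) := fun y hy => by
    have e : y ^ ((3 + r) / 2) = y ^ ((1 - r) / 2) * y ^ (1 + r) := by
      rw [← Real.rpow_add_of_nonneg hy (by linarith) (by linarith)]; congr 1; ring
    rw [e]; ring
  -- With `y = b - x₀`, the affine ascent to `b` uses speed `m₀ = y^((1+r)/2)`, the scale of the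
  -- upper bound for `√W`, and time `τ₀ = y^((1-r)/2)`. Energy density `y^(1+r)` over this time
  -- costs `y^((3+r)/2)`. The path then rests at `b` and descends to `x₁` in the same manner; both
  -- durations are bounded since `r < 1`.
  set τ₀ := (b - x₀) ^ ((1 - r) / 2) with hτ₀
  set τ₁ := (b - x₁) ^ ((1 - r) / 2) with hτ₁
  set m₀ := (b - x₀) ^ ((1 + r) / 2) with hm₀
  set m₁ := (b - x₁) ^ ((1 + r) / 2) with hm₁
  have hτ₀0 : 0 ≤ τ₀ := Real.rpow_nonneg hy₀ _
  have hτ₁0 : 0 ≤ τ₁ := Real.rpow_nonneg hy₁ _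
  have hm₀0 : 0 ≤ m₀ := Real.rpow_nonneg hy₀ _
  have hm₁0 : 0 ≤ m₁ := Real.rpow_nonneg hy₁ _
  have e₀ : m₀ * τ₀ = b - x₀ := hmul _ hy₀
  have e₁ : m₁ * τ₁ = b - x₁ := hmul _ hy₁
  have hτ₀' := hτ x₀ hx₀
  have hτ₁' := hτ x₁ hx₁
  have hmid : c + τ₀ ≤ d - τ₁ := by linarith
  have hbound : ∀ x y s : ℝ, y ∈ Icc a' b → y ≤ x → x ≤ b → s ∈ Icc c d →
      (W x + ((b - y) ^ ((1 + r) / 2)) ^ 2) * η s ≤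
        (c₂ * (b - y) ^ (1 + r) + (b - y) ^ (1 + r)) * 2 := by
    intro x y s hy hyx hxb hs
    rw [hsq _ (by linarith [hy.2])]
    have h1 := hup x ⟨hy.1.trans hyx, hxb⟩
    have h2 : (b - x) ^ (1 + r) ≤ (b - y) ^ (1 + r) :=
      Real.rpow_le_rpow (by linarith) (by linarith) (by linarith)
    have h3 : W x ≤ c₂ * (b - y) ^ (1 + r) := h1.trans (mul_le_mul_of_nonneg_left h2 hc₂.le)
    have h4 : 0 ≤ (b - y) ^ (1 + r) := Real.rpow_nonneg (by linarith [hy.2]) _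
    exact mul_le_mul (by linarith) (hη2 s hs) (hη0 s hs) (by positivity)
  have p1 := IsH1Path.affine (c := c) (d := c + τ₀) (by linarith) x₀ m₀
  have p2 := IsH1Path.affine (c := c + τ₀) (d := d - τ₁) hmid b 0
  have p3 := IsH1Path.affine (c := d - τ₁) (d := d) (by linarith) b (-m₁)
  have g1 : x₀ + m₀ * (c + τ₀ - c) = b + 0 * (c + τ₀ - (c + τ₀)) := by
    rw [add_sub_cancel_left, e₀]; ring
  have q1 := p1.glue p2 g1
  have g2 : (if d - τ₁ ≤ c + τ₀ then x₀ + m₀ * (d - τ₁ - c) else b + 0 * (d - τ₁ - (c + τ₀))) =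
      b + -m₁ * (d - τ₁ - (d - τ₁)) := by
    split_ifs with h
    · rw [le_antisymm h hmid, add_sub_cancel_left, e₀]; ring
    · ring
  have q2 := q1.glue p3 g2
  have hηs : ∀ {c' d' : ℝ}, c ≤ c' → d' ≤ d → ContinuousOn η (Icc c' d') := fun h h' =>
    hη.mono (Icc_subset_Icc h h')
  refine ⟨_, _, q2, ?_, ?_, ?_⟩
  · have h1 : c ≤ d - τ₁ := by linarith
    have h2 : c ≤ c + τ₀ := by linarith
    simp [h1, h2]
  · by_cases h : d ≤ d - τ₁
    · have h0 : τ₁ = 0 := by linarith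
      have hb : b - x₁ = 0 := by rw [← e₁, h0, mul_zero]
      rw [if_pos h]
      rw [h0, sub_zero, sub_self, mul_zero, add_zero] at g2
      rw [g2]; linarith
    · rw [if_neg h]
      linear_combination (-1) * e₁
  · rw [pathEnergy_glue hW.continuous q1 p3 g2 hη,
      pathEnergy_glue hW.continuous p1 p2 g1 (hηs le_rfl (by linarith))]
    have E1 := p1.pathEnergy_le hW.continuous (hηs le_rfl (by linarith))
      (B := (c₂ * (b - x₀) ^ (1 + r) + (b - x₀) ^ (1 + r)) * 2) (fun s hs => by
        refine hbound _ x₀ s hx₀ ?_ ?_ ⟨hs.1, by linarith [hs.2]⟩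
        · have : 0 ≤ m₀ * (s - c) := mul_nonneg hm₀0 (by linarith [hs.1])
          linarith
        · have : m₀ * (s - c) ≤ m₀ * τ₀ := mul_le_mul_of_nonneg_left (by linarith [hs.2]) hm₀0
          linarith)
    have E2 := p2.pathEnergy_le hW.continuous (hηs (by linarith) (by linarith)) (B := 0)
      (fun s _ => by simp [hW.well_right])
    have E3 := p3.pathEnergy_le hW.continuous (hηs (by linarith) le_rfl)
      (B := (c₂ * (b - x₁) ^ (1 + r) + (b - x₁) ^ (1 + r)) * 2) (fun s hs => by
        rw [neg_sq]
        refine hbound _ x₁ s hx₁ ?_ ?_ ⟨by linarith [hs.1], hs.2⟩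
        · have : m₁ * (s - (d - τ₁)) ≤ m₁ * τ₁ :=
            mul_le_mul_of_nonneg_left (by linarith [hs.2]) hm₁0
          linarith
        · have : 0 ≤ m₁ * (s - (d - τ₁)) := mul_nonneg hm₁0 (by linarith [hs.1])
          linarith)
    rw [add_sub_cancel_left, hcost _ hy₀] at E1
    rw [show d - (d - τ₁) = τ₁ by ring, hcost _ hy₁] at E3
    rw [mul_zero] at E2
    linarith

/-- A minimizing path that stays away from the well `a` reaches the vicinity of the well `b` in
uniformly bounded time. -/
theorem exists_arrival_time (hW : IsSubquadraticDoubleWell W a b q) {a' : ℝ} (ha' : a < a')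
    (ha'b : a' < b) (E₀ M₁ : ℝ) :
    ∃ M₀ > 0, ∃ S₀, ∃ C > 0, M₁ ≤ M₀ ∧ M₀ ≤ S₀ ∧ ∀ (S : ℝ) (η w k : ℝ → ℝ), S₀ ≤ S → IsH1Path 0 S w k →
      ContinuousOn η (Icc 0 S) → (∀ s ∈ Icc 0 S, 1 / 2 ≤ η s) → (∀ s ∈ Icc 0 S, η s ≤ 2) →
      (∀ s ∈ Icc 0 S, w s ∈ Icc a' b) →
      (∀ w' k' : ℝ → ℝ, IsH1Path 0 S w' k' → w' 0 = w 0 → w' S = w S →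
        pathEnergy W η 0 S w k ≤ pathEnergy W η 0 S w' k') →
      pathEnergy W η 0 S w k ≤ E₀ →
      wellDist W b (w M₀) ≤ C * wellDist W b (w S) := by
  obtain ⟨r, hr, H⟩ := hW.exists_bounds_right
  obtain ⟨c₁, hc₁, c₂, hc₂, hb⟩ := H a' ha'
  obtain ⟨c₃, hc₃, hD⟩ := hW.exists_rpow_le_wellDist hr.1 hc₁ fun x hx => (hb x hx).1
  set p := (3 + r) / 2 with hp
  have hr0 := hr.1
  have hr1 := hr.2
  have hp0 : 0 < p := by rw [hp]; positivity
  -- The tail energy is controlled by `(b-w)^p` and its dissipation by `(b-w)^(1+r)`, the `θ`-th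
  -- power of the former. Here `θ < 1` amounts to `r < 1`.
  set θ := (1 + r) / p with hθ
  have hθ0 : 0 ≤ θ := by positivity
  have hθ1 : θ < 1 := by rw [hθ, div_lt_one hp0, hp]; linarith
  set C₁ := 2 * (c₂ + 1) with hC₁
  have hC₁0 : 0 < C₁ := by positivity
  set c₄ := 1 / 2 * c₁ * (1 / C₁) ^ θ with hc₄
  have hc₄0 : 0 < c₄ := by positivity
  set E₁ := max E₀ 0 with hE₁
  -- The extinction time for initial energy `E₁`, enlarged so as to be exceeded strictly and to
  -- dominate `M₁`.
  set M₀ := E₁ ^ (1 - θ) / ((1 - θ) * c₄) + (1 + |M₁|) with hM₀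
  have hθ' : 0 < 1 - θ := by linarith
  have hM₁ := abs_nonneg M₁
  have hM₀1 : 0 ≤ E₁ ^ (1 - θ) / ((1 - θ) * c₄) := by
    have : 0 ≤ E₁ ^ (1 - θ) := Real.rpow_nonneg (le_max_right _ _) _
    positivity
  have hM₀0 : 0 < M₀ := by linarith
  set τ := (b - a') ^ ((1 - r) / 2) with hτ
  have hτ0 : 0 ≤ τ := Real.rpow_nonneg (by linarith) _
  -- The additional length `2τ` gives the competitor room in `[s, S]` for every `s ≤ M₀`.
  refine ⟨M₀, hM₀0, M₀ + 2 * τ, 1 + 2 * (C₁ / c₃), by positivity,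
    by linarith [le_abs_self M₁], by linarith, ?_⟩
  intro S η w k hS h hη hη1 hη2 hw hmin hE
  have hMS : M₀ ≤ S := by linarith
  have hS0 : 0 ≤ S := hM₀0.le.trans hMS
  have hwS := hw S ⟨hS0, le_rfl⟩
  set Γ := C₁ * (b - w S) ^ p with hΓ
  have hΓ0 : 0 ≤ Γ := mul_nonneg hC₁0.le (Real.rpow_nonneg (by linarith [hwS.2]) _)
  have hcomp : ∀ s ∈ Icc 0 M₀, pathEnergy W η s S w k ≤ C₁ * (b - w s) ^ p + Γ := by
    intro s hs
    have hsS : s ∈ Icc 0 S := ⟨hs.1, hs.2.trans hMS⟩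
    obtain ⟨u, g, hu, hus, huS, hle⟩ := hW.exists_competitor hr hc₂ (fun x hx => (hb x hx).2)
      (η := η) (c := s) (d := S) (by linarith [hs.2]) (hη.mono (Icc_subset_Icc_left hs.1))
      (fun t ht => le_trans (by norm_num) (hη1 t ⟨hs.1.trans ht.1, ht.2⟩))
      (fun t ht => hη2 t ⟨hs.1.trans ht.1, ht.2⟩) (hw s hsS) hwS
    have := h.tail_minimal hW.continuous hη hmin hsS hu hus huS
    rw [hΓ]; linarith
  have hi := h.intervalIntegrable_energy hW.continuous hη
  have hsplit : ∀ s ∈ Icc 0 S, pathEnergy W η s S w k = pathEnergy W η 0 S w k -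
      ∫ t in (0 : ℝ)..s, (W (w t) + k t ^ 2) * η t := by
    intro s hs
    rw [← h.pathEnergy_add hW.continuous hη hs]
    simp only [pathEnergy]; ring
  -- `Γ` is the part of the competitor's cost due to the terminal value, which does not decay in
  -- `s`. What remains obeys `f' ≤ -c₄ f^θ` as long as it is positive.
  set f : ℝ → ℝ := fun s => pathEnergy W η s S w k - Γ with hf
  have hanti : ∀ s ∈ Icc 0 S, ∀ t ∈ Icc 0 S, s ≤ t →
      pathEnergy W η t S w k ≤ pathEnergy W η s S w k := by
    intro s hs t ht hst
    rw [← (h.mono hs.1 hs.2 le_rfl).pathEnergy_add hW.continuous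
      (hη.mono (Icc_subset_Icc_left hs.1)) (x₀ := t) ⟨hst, ht.2⟩]
    have := pathEnergy_nonneg (W := W) (η := η) hW.nonneg hst (fun x hx =>
      le_trans (by norm_num) (hη1 x ⟨hs.1.trans hx.1, hx.2.trans ht.2⟩)) w k
    linarith
  have hprim : IsPrimitive 0 M₀ f (fun t => -((W (w t) + k t ^ 2) * η t)) := by
    refine ⟨hM₀0.le, (hi.neg.mono_set ?_), fun s hs => ?_⟩
    · rw [uIcc_of_le hM₀0.le, uIcc_of_le hS0]; exact Icc_subset_Icc_right hMS
    · simp only [hf]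
      rw [hsplit s ⟨hs.1, hs.2.trans hMS⟩, intervalIntegral.integral_neg]
      ring
  have hfM : f M₀ ≤ 0 := by
    by_contra hcon
    have hcon' : 0 < f M₀ := not_le.1 hcon
    have hpos : ∀ t ∈ Icc 0 M₀, 0 < f t := fun t ht => by
      refine hcon'.trans_le ?_
      simp only [hf]
      linarith [hanti t ⟨ht.1, ht.2.trans hMS⟩ M₀ ⟨hM₀0.le, hMS⟩ ht.2]
    have hode : ∀ t ∈ Icc 0 M₀, -((W (w t) + k t ^ 2) * η t) ≤ -(c₄ * f t ^ θ) := by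
      intro t ht
      have htS : t ∈ Icc 0 S := ⟨ht.1, ht.2.trans hMS⟩
      have hwt := hw t htS
      have hy : 0 ≤ b - w t := by linarith [hwt.2]
      have h1 : f t ≤ C₁ * (b - w t) ^ p := by simp only [hf]; linarith [hcomp t ht]
      have h2 : f t * (1 / C₁) ≤ (b - w t) ^ p := by
        rw [mul_one_div, div_le_iff₀ hC₁0]; linarith
      have h3 : (f t * (1 / C₁)) ^ θ ≤ (b - w t) ^ (1 + r) := by
        refine (Real.rpow_le_rpow (mul_nonneg (hpos t ht).le (by positivity)) h2 hθ0).trans_eq ?_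
        rw [← Real.rpow_mul hy, hθ, mul_div_cancel₀ _ hp0.ne']
      rw [Real.mul_rpow (hpos t ht).le (by positivity)] at h3
      have h4 := (hb _ hwt).1
      have h5 := hη1 t htS
      have h6 : W (w t) * (1 / 2) ≤ (W (w t) + k t ^ 2) * η t :=
        mul_le_mul (by linarith [sq_nonneg (k t)]) h5 (by norm_num)
          (add_nonneg (hW.nonneg _) (sq_nonneg _))
      have h7 : c₁ * (f t ^ θ * (1 / C₁) ^ θ) ≤ W (w t) :=
        (mul_le_mul_of_nonneg_left h3 hc₁.le).trans h4
      have h8 : c₄ * f t ^ θ = c₁ * (f t ^ θ * (1 / C₁) ^ θ) * (1 / 2) := by rw [hc₄]; ring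
      linarith
    have h9 := hprim.extinction_time_le hpos hθ1 hode (E₀ := E₁) (by
      simp only [hf]
      exact le_trans (by linarith) (le_max_left _ _))
    rw [← le_div_iff₀ (by positivity)] at h9
    linarith
  have h1 := hW.mul_abs_wellDist_sub_le (h.mono hM₀0.le hMS le_rfl)
    (fun t ht => Icc_subset_Icc_left ha'.le (hw t ⟨hM₀0.le.trans ht.1, ht.2⟩))
    (hη.mono (Icc_subset_Icc_left hM₀0.le)) (m := 1 / 2) (by norm_num)
    (fun t ht => hη1 t ⟨hM₀0.le.trans ht.1, ht.2⟩)
  have h2 := neg_abs_le (wellDist W b (w S) - wellDist W b (w M₀))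
  have h3 : Γ ≤ C₁ / c₃ * wellDist W b (w S) := by
    have := hD _ hwS
    rw [hΓ, div_mul_eq_mul_div, le_div_iff₀ hc₃]
    nlinarith
  simp only [hf] at hfM
  linarith

/-- A path of almost minimal energy between points to the right of `αm` does not approach the
well `a`. -/
theorem le_of_pathEnergy_le (hW : IsSubquadraticDoubleWell W a b q) {αm a' δ σ S : ℝ}
    {η w k : ℝ → ℝ} (h : IsH1Path 0 S w k) (hw : ∀ s ∈ Icc 0 S, w s ∈ Icc a b)
    (hη : ContinuousOn η (Icc 0 S)) (hηδ : ∀ s ∈ Icc 0 S, 1 - δ ≤ η s) (hδ0 : 0 ≤ δ)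
    (hδ : δ ≤ 1 / 4) (ha' : a ≤ a') (haα : a' < αm) (hαb : αm ≤ b)
    (hδD : δ * wellDist W b a ≤ (wellDist W b a' - wellDist W b αm) / 2)
    (h0 : αm ≤ w 0)
    (hE : pathEnergy W η 0 S w k ≤ wellDist W b (w 0) + σ)
    (hσ : σ + wellDist W b (w S) ≤ (wellDist W b a' - wellDist W b αm) / 2) :
    ∀ s ∈ Icc 0 S, a' ≤ w s := by
  intro s hs
  by_contra hcon
  have hD := wellDist_antitone hW.continuous b
  have hd := hW.wellDist_lt ha' haα hαb
  have h1 := hW.mul_abs_wellDist_sub_le (h.mono le_rfl hs.1 hs.2)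
    (fun t ht => hw t ⟨ht.1, ht.2.trans hs.2⟩) (hη.mono (Icc_subset_Icc_right hs.2))
    (m := 1 - δ) (by linarith) (fun t ht => hηδ t ⟨ht.1, ht.2.trans hs.2⟩)
  have h2 := hW.mul_abs_wellDist_sub_le (h.mono hs.1 hs.2 le_rfl)
    (fun t ht => hw t ⟨hs.1.trans ht.1, ht.2⟩) (hη.mono (Icc_subset_Icc_left hs.1))
    (m := 1 - δ) (by linarith) (fun t ht => hηδ t ⟨hs.1.trans ht.1, ht.2⟩)
  have h3 := h.pathEnergy_add hW.continuous hη hs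
  have h4 : wellDist W b a' ≤ wellDist W b (w s) := hD (not_le.1 hcon).le
  have h5 : wellDist W b (w 0) ≤ wellDist W b αm := hD h0
  have hS : (0 : ℝ) ≤ S := h.le
  have h6 : wellDist W b (w 0) ≤ wellDist W b a := hD (hw 0 ⟨le_rfl, hS⟩).1
  have h7 : 0 ≤ wellDist W b (w 0) := wellDist_nonneg (hw 0 ⟨le_rfl, hS⟩).2
  have h8 : 0 ≤ wellDist W b (w S) := wellDist_nonneg (hw S ⟨hS, le_rfl⟩).2
  have hδ' : 0 ≤ 1 - δ := by linarith
  have h9 := mul_le_mul_of_nonneg_left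
    (le_abs_self (wellDist W b (w s) - wellDist W b (w 0))) hδ'
  have h10 := mul_le_mul_of_nonneg_left
    (neg_abs_le (wellDist W b (w S) - wellDist W b (w s))) hδ'
  set A := wellDist W b a'
  set B := wellDist W b αm
  set x := wellDist W b (w 0)
  set y := wellDist W b (w S)
  set z := wellDist W b (w s)
  have h11 : (1 - δ) * (2 * z - x - y) ≤ x + σ := by linarith
  have h12 : (1 - δ) * (x + 2 * (A - B) - y) ≤ (1 - δ) * (2 * z - x - y) :=
    mul_le_mul_of_nonneg_left (by linarith) hδ'
  have h13 : δ * x ≤ (A - B) / 2 := (mul_le_mul_of_nonneg_left h6 hδ0).trans hδD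
  -- Together these give `2(1-δ)(A-B) ≤ δx + σ + y ≤ A-B`, impossible for `δ ≤ 1/4` because `A > B`.
  nlinarith

end IsSubquadraticDoubleWell

/-! ### The rescaled weight, lower energy bounds and their limit -/

namespace IsAdmissibleWeight

variable {ω : ℝ → ℝ} {T κ₀ δ : ℝ}

theorem isPrimitive (h : IsAdmissibleWeight ω T κ₀ δ) : IsPrimitive 0 T ω (weightDeriv ω T) := by
  have hT := h.T_mem.1
  refine .of_ac hT.le (ContDiffOn.absolutelyContinuousOnInterval (by
    rw [uIcc_of_le hT.le]; exact h.contDiffOn)) (.of_forall fun t ht => ?_)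
  exact ((h.contDiffOn.differentiableOn one_ne_zero) t
    (Ioo_subset_Icc_self ht)).hasDerivWithinAt.hasDerivAt (Icc_mem_nhds ht.1 ht.2)

theorem continuousOn_weightDeriv (h : IsAdmissibleWeight ω T κ₀ δ) :
    ContinuousOn (weightDeriv ω T) (Icc 0 T) :=
  h.contDiffOn.continuousOn_derivWithin (uniqueDiffOn_Icc h.T_mem.1) le_rfl

theorem isPrimitive_rescaled (h : IsAdmissibleWeight ω T κ₀ δ) {ε : ℝ} (hε : 0 < ε) :
    IsPrimitive 0 (T / ε) (fun s => ω (ε * s)) (fun s => ε * weightDeriv ω T (ε * s)) := by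
  have := h.isPrimitive.comp_mul_left hε
  rwa [zero_div] at this

theorem mul_mem {ε s : ℝ} (hε : 0 < ε) (hs : s ∈ Icc 0 (T / ε)) : ε * s ∈ Icc 0 T := by
  refine ⟨mul_nonneg hε.le hs.1, ?_⟩
  have := hs.2
  rw [le_div_iff₀ hε] at this
  linarith

theorem one_sub_le (h : IsAdmissibleWeight ω T κ₀ δ) {t : ℝ} (ht : t ∈ Icc 0 T) : 1 - δ ≤ ω t := by
  have := h.osc_lt 0 ⟨le_rfl, h.T_mem.1.le⟩ t ht
  rw [h.zero] at this; linarith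

theorem le_one_add (h : IsAdmissibleWeight ω T κ₀ δ) {t : ℝ} (ht : t ∈ Icc 0 T) : ω t ≤ 1 + δ := by
  have := h.osc_lt t ht 0 ⟨le_rfl, h.T_mem.1.le⟩
  rw [h.zero] at this; linarith

theorem abs_weightDeriv_le (h : IsAdmissibleWeight ω T κ₀ δ) {L : ℝ} (hL : c1Norm ω T ≤ L) {t : ℝ}
    (ht : t ∈ Icc 0 T) : |weightDeriv ω T t| ≤ L := by
  have h1 : |weightDeriv ω T t| ≤ sSup ((fun t => |weightDeriv ω T t|) '' Icc 0 T) :=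
    le_csSup (isCompact_Icc.bddAbove_image h.continuousOn_weightDeriv.abs)
      (mem_image_of_mem (fun t => |weightDeriv ω T t|) ht)
  have h2 : 0 ≤ sSup ((fun t => |ω t|) '' Icc 0 T) :=
    Real.sSup_nonneg (by rintro _ ⟨t, -, rfl⟩; exact abs_nonneg _)
  rw [c1Norm] at hL
  linarith

end IsAdmissibleWeight

namespace IsSubquadraticDoubleWell

variable {W : ℝ → ℝ} {a b q : ℝ}

theorem integral_flowError_sq_le {η w k : ℝ → ℝ} {S M : ℝ} (hWc : Continuous W)
    (h : IsH1Path 0 S w k) (hη : ContinuousOn η (Icc 0 S)) (hη1 : ∀ s ∈ Icc 0 S, 1 / 2 ≤ η s)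
    (hM : M ∈ Icc 0 S) :
    1 / 2 * ∫ s in (0 : ℝ)..M, flowError W w k s ^ 2 ≤
      ∫ s in (0 : ℝ)..M, flowError W w k s ^ 2 * η s := by
  have hi := (h.mono le_rfl hM.1 hM.2).intervalIntegrable_flowError_sq hWc
  rw [← intervalIntegral.integral_const_mul]
  refine intervalIntegral.integral_mono_on hM.1 (hi.const_mul _) (hi.mul_continuousOn (by
    rw [uIcc_of_le hM.1]; exact hη.mono (Icc_subset_Icc_right hM.2))) fun s hs => ?_
  rw [mul_comm]
  exact mul_le_mul_of_nonneg_left (hη1 s ⟨hs.1, hs.2.trans hM.2⟩) (sq_nonneg _)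

/-- Lower bound for the energy of a path that is close to the well `b` at time `M`. -/
theorem le_pathEnergy_of_wellDist_le (hW : IsSubquadraticDoubleWell W a b q)
    {η η' w k : ℝ → ℝ} {S M C : ℝ} (h : IsH1Path 0 S w k) (hw : ∀ s ∈ Icc 0 S, w s ∈ Icc a b)
    (hη : IsPrimitive 0 S η η') (hη0 : η 0 = 1) (hη1 : ∀ s ∈ Icc 0 S, 1 / 2 ≤ η s)
    (hη2 : ∀ s ∈ Icc 0 S, η s ≤ 2) (hM : M ∈ Icc 0 S)
    (hC : wellDist W b (w M) ≤ C * wellDist W b (w S)) :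
    wellDist W b (w 0) - 2 * C * wellDist W b (w S) + (∫ s in (0 : ℝ)..M, wellDist W b (w s) * η' s)
      + 1 / 2 * (∫ s in (0 : ℝ)..M, flowError W w k s ^ 2) ≤ pathEnergy W η 0 S w k := by
  have h1 := hW.pathEnergy_eq (h.mono le_rfl hM.1 hM.2)
    (fun t ht => hw t ⟨ht.1, ht.2.trans hM.2⟩) (hη.mono le_rfl hM.1 hM.2)
  have h2 := integral_flowError_sq_le hW.continuous h hη.continuousOn hη1 hM
  have h3 := h.pathEnergy_add hW.continuous hη.continuousOn hM
  have h4 := pathEnergy_nonneg (W := W) (η := η) hW.nonneg hM.2 (fun x hx =>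
    le_trans (by norm_num) (hη1 x ⟨hM.1.trans hx.1, hx.2⟩)) w k
  have h5 : wellDist W b (w M) * η M ≤ wellDist W b (w M) * 2 :=
    mul_le_mul_of_nonneg_left (hη2 M hM) (wellDist_nonneg (hw M hM).2)
  rw [hη0] at h1
  linarith

/-- Lower bound for the energy if the weight is increasing. -/
theorem le_pathEnergy_of_deriv_nonneg (hW : IsSubquadraticDoubleWell W a b q)
    {η η' w k : ℝ → ℝ} {S M : ℝ} (h : IsH1Path 0 S w k) (hw : ∀ s ∈ Icc 0 S, w s ∈ Icc a b)
    (hη : IsPrimitive 0 S η η') (hη0 : η 0 = 1) (hη1 : ∀ s ∈ Icc 0 S, 1 / 2 ≤ η s)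
    (hη2 : ∀ s ∈ Icc 0 S, η s ≤ 2) (hη' : ∀ s ∈ Icc 0 S, 0 ≤ η' s) (hM : M ∈ Icc 0 S) :
    wellDist W b (w 0) - 2 * wellDist W b (w S) + (∫ s in (0 : ℝ)..M, wellDist W b (w s) * η' s)
      + 1 / 2 * (∫ s in (0 : ℝ)..M, flowError W w k s ^ 2) ≤ pathEnergy W η 0 S w k := by
  have hS : (0 : ℝ) ≤ S := h.le
  have hSS : S ∈ Icc 0 S := ⟨hS, le_rfl⟩
  -- Integrating up to `S` leaves only the terminal datum; afterwards the nonnegative contributions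
  -- of `[M, S]` are dropped from both integrals.
  have h1 := hW.le_pathEnergy_of_wellDist_le (C := 1) h hw hη hη0 hη1 hη2 hSS (by rw [one_mul])
  have hnn : ∀ s ∈ Icc 0 S, 0 ≤ wellDist W b (w s) * η' s := fun s hs =>
    mul_nonneg (wellDist_nonneg (hw s hs).2) (hη' s hs)
  have h2 : ∫ s in (0 : ℝ)..M, wellDist W b (w s) * η' s ≤
      ∫ s in (0 : ℝ)..S, wellDist W b (w s) * η' s := by
    refine intervalIntegral.integral_mono_interval le_rfl hM.1 hM.2 ?_ ?_
    · refine (ae_restrict_iff' measurableSet_Ioc).2 (.of_forall fun s hs => ?_)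
      exact hnn s ⟨hs.1.le, hs.2⟩
    · refine hη.integrable.continuousOn_mul ?_
      rw [uIcc_of_le hS]
      exact (continuous_wellDist hW.continuous b).comp_continuousOn h.continuousOn
  have h3 := intervalIntegral.integral_mono_interval (μ := volume) le_rfl hM.1 hM.2
    (.of_forall fun s => sq_nonneg (flowError W w k s))
    (h.intervalIntegrable_flowError_sq hW.continuous)
  linarith

theorem neg_le_integral_wellDist_mul (hW : IsSubquadraticDoubleWell W a b q) {w g : ℝ → ℝ}
    {B M : ℝ} (hM : 0 ≤ M) (hw : ∀ s ∈ Icc 0 M, w s ∈ Icc a b) (hg : ∀ s ∈ Icc 0 M, |g s| ≤ B) :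
    -(wellDist W b a * B * M) ≤ ∫ s in (0 : ℝ)..M, wellDist W b (w s) * g s := by
  have h1 := intervalIntegral.norm_integral_le_of_norm_le_const (a := 0) (b := M)
    (f := fun s => wellDist W b (w s) * g s) (C := wellDist W b a * B) (fun s hs => by
      rw [uIoc_of_le hM] at hs
      have hs' : s ∈ Icc 0 M := ⟨hs.1.le, hs.2⟩
      have h2 := wellDist_nonneg (W := W) (hw s hs').2
      have h3 := wellDist_antitone hW.continuous b (hw s hs').1
      rw [norm_mul, Real.norm_of_nonneg h2]
      exact mul_le_mul h3 (hg s hs') (norm_nonneg _) (h2.trans h3))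
  rw [sub_zero, abs_of_nonneg hM] at h1
  exact (abs_le.1 h1).1

/-- Passage to the limit in the lower bounds for the energy along a sequence of paths. -/
theorem false_of_seq (hW : IsSubquadraticDoubleWell W a b q) {α : ℝ} (hα : α ∈ Icc a b)
    {θ : ℝ → ℝ} {T : ℝ} (hT : 0 < T) (hθ : ContinuousOn θ (Icc 0 T)) {ε : ℕ → ℝ}
    (hε : Tendsto ε atTop (𝓝[>] 0)) {w k : ℕ → ℝ → ℝ} {β E : ℕ → ℝ} {C c M : ℝ}
    (hM : travelTime W α b ≤ M) (hM0 : 0 < M)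
    (hp : ∀ᶠ n in atTop, IsH1Path 0 M (w n) (k n))
    (hw : ∀ᶠ n in atTop, ∀ s ∈ Icc 0 M, w n s ∈ Icc a b)
    (h0 : Tendsto (fun n => w n 0) atTop (𝓝 α))
    (hrate : Tendsto (fun n => |wellDist W b (w n 0) - wellDist W b α| / ε n) atTop (𝓝 0))
    (hβ : Tendsto (fun n => β n / ε n) atTop (𝓝 0))
    (hest : ∀ᶠ n in atTop, wellDist W b (w n 0) - C * β n +
      (∫ s in (0 : ℝ)..M, wellDist W b (w n s) * (ε n * θ (ε n * s))) +
      1 / 2 * (∫ s in (0 : ℝ)..M, flowError W (w n) (k n) s ^ 2) ≤ E n)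
    (hE : ∀ᶠ n in atTop, E n ≤ wellDist W b α + c * ε n)
    (hc : c < θ 0 * ∫ s in (0 : ℝ)..M, wellDist W b (profile W b α s))
    (hcase : (∀ t ∈ Icc 0 T, 0 ≤ θ t) ∨
      ∃ a' > a, ∀ᶠ n in atTop, ∀ s ∈ Icc 0 M, a' ≤ w n s) : False := by
  obtain ⟨L, hL⟩ := isCompact_Icc.exists_bound_of_continuousOn hθ
  have hε0 : ∀ᶠ n in atTop, 0 < ε n := hε.eventually self_mem_nhdsWithin
  have hεz : Tendsto ε atTop (𝓝 0) := hε.mono_right nhdsWithin_le_nhds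
  have hmem : ∀ᶠ n in atTop, 0 < ε n ∧ ∀ s ∈ Icc 0 M, ε n * s ∈ Icc 0 T := by
    filter_upwards [hε0, hεz.eventually_lt_const (show 0 < T / M by positivity)] with n h1 h2
    refine ⟨h1, fun s hs => ⟨mul_nonneg h1.le hs.1, ?_⟩⟩
    rw [lt_div_iff₀ hM0] at h2
    exact (mul_le_mul_of_nonneg_left hs.2 h1.le).trans h2.le
  have hDa : 0 ≤ wellDist W b a := wellDist_nonneg hW.lt.le
  -- The lower bound for the energy against the upper bound `D(α) + cε` leaves only `O(ε)` for the
  -- squared flow error.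
  have hsq : Tendsto (fun n => ∫ s in (0 : ℝ)..M, flowError W (w n) (k n) s ^ 2) atTop (𝓝 0) := by
    have hub : Tendsto (fun n => 2 * (ε n * (c + |wellDist W b (w n 0) - wellDist W b α| / ε n +
        C * (β n / ε n) + wellDist W b a * L * M))) atTop (𝓝 0) := by
      have := (hεz.mul (((tendsto_const_nhds (x := c)).add hrate).add (hβ.const_mul C)
        |>.add_const (wellDist W b a * L * M))).const_mul 2
      simpa using this
    refine squeeze_zero' (.of_forall fun n => intervalIntegral.integral_nonneg hM0.le fun s _ =>
      sq_nonneg _) ?_ hub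
    filter_upwards [hest, hE, hmem, hw] with n h1 h2 h3 h4
    have h5 := hW.neg_le_integral_wellDist_mul (g := fun s => ε n * θ (ε n * s)) (B := ε n * L)
      hM0.le h4 (fun s hs => by
        rw [abs_mul, abs_of_pos h3.1]
        exact mul_le_mul_of_nonneg_left (hL _ (h3.2 s hs)) h3.1.le)
    have h6 := neg_abs_le (wellDist W b (w n 0) - wellDist W b α)
    have e : ε n * (c + |wellDist W b (w n 0) - wellDist W b α| / ε n +
        C * (β n / ε n) + wellDist W b a * L * M) = c * ε n +
        |wellDist W b (w n 0) - wellDist W b α| + C * β n + wellDist W b a * (ε n * L) * M := by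
      have := h3.1.ne'
      field_simp
    rw [e]; linarith
  have habs : Tendsto (fun n => ∫ s in (0 : ℝ)..M, |flowError W (w n) (k n) s|) atTop (𝓝 0) := by
    have hub : Tendsto (fun n => √(M * ∫ s in (0 : ℝ)..M, flowError W (w n) (k n) s ^ 2)) atTop
        (𝓝 0) := by
      have := (Real.continuous_sqrt.tendsto _).comp (hsq.const_mul M)
      simpa [Function.comp_def] using this
    refine squeeze_zero' (.of_forall fun n => intervalIntegral.integral_nonneg hM0.le fun s _ =>
      abs_nonneg _) ?_ hub
    filter_upwards [hp] with n hn
    exact Real.le_sqrt_of_sq_le (integral_abs_sq_le hM0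
      (hn.toIsPrimitive.intervalIntegrable_flowError hW.continuous)
      (hn.intervalIntegrable_flowError_sq hW.continuous))
  have hp' : ∀ᶠ n in atTop, IsPrimitive 0 M (w n) (k n) := hp.mono fun n hn => hn.toIsPrimitive
  have hDm : ∀ᶠ n in atTop, AEStronglyMeasurable (fun s => wellDist W b (w n s))
      (volume.restrict (uIoc 0 M)) := by
    filter_upwards [hp] with n hn
    rw [uIoc_of_le hM0.le]
    exact (((continuous_wellDist hW.continuous b).comp_continuousOn hn.continuousOn).mono
      Ioc_subset_Icc_self).aestronglyMeasurable measurableSet_Ioc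
  obtain ⟨hi1, hi2⟩ := hW.intervalIntegrable_wellDist_profile hα hM
  have hzi : IntervalIntegrable (fun s => wellDist W b (profile W b α s)) volume 0 M :=
    hi1.trans hi2
  have hlow : ∀ s ∈ Icc 0 M, ∀ l < wellDist W b (profile W b α s),
      ∀ᶠ n in atTop, l < wellDist W b (w n s) := fun s hs l hl =>
    hW.eventually_lt_wellDist hα hp' hw h0 habs hs hl
  have hDle : ∀ x ∈ Icc a b, 0 ≤ wellDist W b x ∧ wellDist W b x ≤ wellDist W b a := fun x hx =>
    ⟨wellDist_nonneg hx.2, wellDist_antitone hW.continuous b hx.1⟩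
  -- A substitute for `D(w n)` that converges pointwise. For `θ ≥ 0` only the lower bound on `D(w
  -- n)` is available, and the minimum with `D(z_α)` turns it into convergence; away from `a` the
  -- function `D(w n)` itself converges.
  obtain ⟨g, hg1, hg2, hg3⟩ : ∃ g : ℕ → ℝ → ℝ,
      (∀ᶠ n in atTop, ∀ s ∈ Icc 0 M, |g n s| ≤ wellDist W b a ∧
        g n s * θ (ε n * s) ≤ wellDist W b (w n s) * θ (ε n * s)) ∧
      (∀ᶠ n in atTop, AEStronglyMeasurable (g n) (volume.restrict (uIoc 0 M))) ∧
      ∀ s ∈ Ioc 0 M, Tendsto (fun n => g n s) atTop (𝓝 (wellDist W b (profile W b α s))) := by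
    rcases hcase with hpos | ⟨a', ha', haw⟩
    · refine ⟨fun n s => min (wellDist W b (w n s)) (wellDist W b (profile W b α s)), ?_, ?_, ?_⟩
      · filter_upwards [hw, hmem] with n h1 h2 s hs
        obtain ⟨h3, h4⟩ := hDle _ (h1 s hs)
        have h5 := wellDist_nonneg (W := W) (hW.profile_mem hα s).2
        refine ⟨?_, mul_le_mul_of_nonneg_right (min_le_left _ _) (hpos _ (h2.2 s hs))⟩
        rw [abs_of_nonneg (le_min h3 h5)]
        exact (min_le_left _ _).trans h4
      · filter_upwards [hDm] with n hn
        exact hn.inf hzi.aestronglyMeasurable_restrict_uIoc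
      · intro s hs
        refine tendsto_order.2 ⟨fun l hl => ?_, fun l hl => ?_⟩
        · filter_upwards [hlow s ⟨hs.1.le, hs.2⟩ l hl] with n hn using lt_min hn hl
        · exact .of_forall fun n => (min_le_right _ _).trans_lt hl
    · have hw' : ∀ᶠ n in atTop, ∀ s ∈ Icc 0 M, w n s ∈ Icc a' b := by
        filter_upwards [hw, haw] with n h1 h2 s hs using ⟨h2 s hs, (h1 s hs).2⟩
      refine ⟨fun n s => wellDist W b (w n s), ?_, hDm, ?_⟩
      · filter_upwards [hw] with n h1 s hs
        obtain ⟨h3, h4⟩ := hDle _ (h1 s hs)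
        exact ⟨by rwa [abs_of_nonneg h3], le_rfl⟩
      · intro s hs
        exact tendsto_order.2 ⟨fun l hl => hlow s ⟨hs.1.le, hs.2⟩ l hl, fun l hl =>
          hW.eventually_wellDist_lt hα hp' ha' hw' h0 habs hs hl⟩
  have hθm : ∀ᶠ n in atTop, ContinuousOn (fun s => θ (ε n * s)) (Icc 0 M) := by
    filter_upwards [hmem] with n hn
    exact hθ.comp (continuousOn_const.mul continuousOn_id) fun s hs => hn.2 s hs
  have hlim : Tendsto (fun n => ∫ s in (0 : ℝ)..M, g n s * θ (ε n * s)) atTop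
      (𝓝 (∫ s in (0 : ℝ)..M, wellDist W b (profile W b α s) * θ 0)) := by
    refine intervalIntegral.tendsto_integral_filter_of_dominated_convergence
      (fun _ => wellDist W b a * L) ?_ ?_ intervalIntegrable_const ?_
    · filter_upwards [hg2, hθm] with n h1 h2
      refine h1.mul ?_
      rw [uIoc_of_le hM0.le]
      exact (h2.mono Ioc_subset_Icc_self).aestronglyMeasurable measurableSet_Ioc
    · filter_upwards [hg1, hmem] with n h1 h2
      refine .of_forall fun s hs => ?_
      rw [uIoc_of_le hM0.le] at hs
      have hs' : s ∈ Icc 0 M := ⟨hs.1.le, hs.2⟩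
      rw [norm_mul]
      exact mul_le_mul (h1 s hs').1 (hL _ (h2.2 s hs')) (norm_nonneg _) hDa
    · refine .of_forall fun s hs => ?_
      rw [uIoc_of_le hM0.le] at hs
      refine (hg3 s hs).mul ?_
      have h1 : Tendsto (fun n => ε n * s) atTop (𝓝[Icc 0 T] 0) := by
        refine tendsto_nhdsWithin_iff.2 ⟨by simpa using hεz.mul_const s, ?_⟩
        filter_upwards [hmem] with n hn using hn.2 s ⟨hs.1.le, hs.2⟩
      exact (hθ 0 ⟨le_rfl, hT.le⟩).tendsto.comp h1
  rw [intervalIntegral.integral_mul_const, mul_comm] at hlim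
  have hub : Tendsto (fun n => c + |wellDist W b (w n 0) - wellDist W b α| / ε n +
      C * (β n / ε n)) atTop (𝓝 c) := by
    simpa using ((tendsto_const_nhds (x := c)).add hrate).add (hβ.const_mul C)
  -- Dividing the energy bounds by `ε n` shows that `θ 0 * ∫ D(z_α)` is at most `c`.
  refine absurd (le_of_tendsto_of_tendsto hlim hub ?_) (not_le.2 hc)
  filter_upwards [hest, hE, hmem, hw, hg1, hg2, hθm, hp] with n h1 h2 h3 h4 h5 h6 h7 h8
  have hci : IntervalIntegrable (fun s => wellDist W b (w n s) * θ (ε n * s)) volume 0 M := by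
    refine ContinuousOn.intervalIntegrable ?_
    rw [uIcc_of_le hM0.le]
    exact ((continuous_wellDist hW.continuous b).comp_continuousOn h8.continuousOn).mul h7
  have hgi : IntervalIntegrable (fun s => g n s * θ (ε n * s)) volume 0 M := by
    refine (intervalIntegrable_const (c := wellDist W b a * L)).mono_fun (h6.mul ?_) ?_
    · rw [uIoc_of_le hM0.le]
      exact (h7.mono Ioc_subset_Icc_self).aestronglyMeasurable measurableSet_Ioc
    · refine (ae_restrict_iff' measurableSet_uIoc).2 (.of_forall fun s hs => ?_)
      rw [uIoc_of_le hM0.le] at hs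
      have hs' : s ∈ Icc 0 M := ⟨hs.1.le, hs.2⟩
      have := mul_le_mul (h5 s hs').1 (hL _ (h3.2 s hs')) (norm_nonneg _) hDa
      rw [← Real.norm_eq_abs, ← norm_mul] at this
      exact this.trans (le_abs_self _)
  have h9 : ∫ s in (0 : ℝ)..M, g n s * θ (ε n * s) ≤
      ∫ s in (0 : ℝ)..M, wellDist W b (w n s) * θ (ε n * s) :=
    intervalIntegral.integral_mono_on hM0.le hgi hci fun s hs => (h5 s hs).2
  refine h9.trans ?_
  have h10 : ∫ s in (0 : ℝ)..M, wellDist W b (w n s) * (ε n * θ (ε n * s)) =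
      ε n * ∫ s in (0 : ℝ)..M, wellDist W b (w n s) * θ (ε n * s) := by
    rw [← intervalIntegral.integral_const_mul]
    congr 1; ext s; ring
  rw [h10] at h1
  have h11 : 0 ≤ ∫ s in (0 : ℝ)..M, flowError W (w n) (k n) s ^ 2 :=
    intervalIntegral.integral_nonneg hM0.le fun s _ => sq_nonneg _
  have h12 := neg_abs_le (wellDist W b (w n 0) - wellDist W b α)
  refine le_of_mul_le_mul_left ?_ h3.1
  have e : ε n * (c + |wellDist W b (w n 0) - wellDist W b α| / ε n + C * (β n / ε n)) =
      c * ε n + |wellDist W b (w n 0) - wellDist W b α| + C * β n := by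
    have := h3.1.ne'
    field_simp
  rw [e]; linarith

end IsSubquadraticDoubleWell

/-! ### The two estimates for minimizers -/

/-- The rescaled path of a minimizer, with everything the estimates use. -/
theorem IsMinimizerG0.exists_rescaled_path {W ω : ℝ → ℝ} {a b q T κ₀ δ ε αε βε : ℝ}
    (hW : IsSubquadraticDoubleWell W a b q) (hω : IsAdmissibleWeight ω T κ₀ δ) (hε : 0 < ε)
    (hα : αε ∈ Icc a b) (hβ : βε ∈ Icc a b) {v : ℝ →₁[volI T] ℝ}
    (hv : IsMinimizerG0 W ω T ε αε βε v) (α : ℝ) (hαb : α ≤ b) :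
    ∃ w k : ℝ → ℝ, IsH1Path 0 (T / ε) w k ∧ (∀ s ∈ Icc 0 (T / ε), w s ∈ Icc a b) ∧
      w 0 = αε ∧ w (T / ε) = βε ∧
      G2 W ω b α T ε αε βε v = (((pathEnergy W (fun s => ω (ε * s)) 0 (T / ε) w k
        - wellDist W b α) / ε : ℝ) : EReal) ∧
      ∀ w' k' : ℝ → ℝ, IsH1Path 0 (T / ε) w' k' → w' 0 = w 0 → w' (T / ε) = w (T / ε) →
        pathEnergy W (fun s => ω (ε * s)) 0 (T / ε) w k ≤
          pathEnergy W (fun s => ω (ε * s)) 0 (T / ε) w' k' := by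
  obtain ⟨w, k, h1, h2, h3, h4, h5, h6⟩ := hv.exists_path hW.lt hW.continuous hW.nonneg
    hW.well_left hW.well_right hω.T_mem.1 hω.contDiffOn.continuousOn hω.pos hε hα hβ α
  refine ⟨w, k, h1, h2, h3, h4, ?_, by rwa [h3, h4]⟩
  rw [h5, hω.zero, one_mul, geodDist_left hW.continuous hαb, one_div_mul_eq_div]

/-- Lower bound for the energy of minimizing paths that start to the right of `αm`. -/
theorem IsSubquadraticDoubleWell.exists_lower_bound {W : ℝ → ℝ} {a b q : ℝ}
    (hW : IsSubquadraticDoubleWell W a b q) {αm : ℝ} (hαm : αm ∈ Ioo a b) (M₁ : ℝ) :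
    ∃ M₀ > 0, ∃ S₀, ∃ C > 0, M₁ ≤ M₀ ∧ M₀ ≤ S₀ ∧ ∀ (S δ σ : ℝ) (η η' w k : ℝ → ℝ),
      0 ≤ δ → δ ≤ 1 / 4 →
      δ * wellDist W b a ≤ (wellDist W b ((a + αm) / 2) - wellDist W b αm) / 2 →
      IsH1Path 0 S w k → (∀ s ∈ Icc 0 S, w s ∈ Icc a b) → IsPrimitive 0 S η η' → η 0 = 1 →
      (∀ s ∈ Icc 0 S, 1 - δ ≤ η s) → (∀ s ∈ Icc 0 S, η s ≤ 1 + δ) →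
      (∀ w' k' : ℝ → ℝ, IsH1Path 0 S w' k' → w' 0 = w 0 → w' S = w S →
        pathEnergy W η 0 S w k ≤ pathEnergy W η 0 S w' k') →
      αm ≤ w 0 → pathEnergy W η 0 S w k ≤ wellDist W b (w 0) + σ → σ ≤ 1 →
      σ + wellDist W b (w S) ≤ (wellDist W b ((a + αm) / 2) - wellDist W b αm) / 2 →
      (∀ s ∈ Icc 0 S, (a + αm) / 2 ≤ w s) ∧ ∀ M, (S₀ ≤ S ∧ M = M₀ ∨ M = S) →
        wellDist W b (w 0) - C * wellDist W b (w S) +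
          (∫ s in (0 : ℝ)..M, wellDist W b (w s) * η' s) +
          1 / 2 * (∫ s in (0 : ℝ)..M, flowError W w k s ^ 2) ≤ pathEnergy W η 0 S w k := by
  have ha' : a < (a + αm) / 2 := by linarith [hαm.1]
  have ha'm : (a + αm) / 2 < αm := by linarith [hαm.1]
  obtain ⟨M₀, hM₀, S₀, C, hC, hM₁, hMS, H⟩ := hW.exists_arrival_time ha' (ha'm.trans hαm.2)
    (wellDist W b a + 1) M₁
  -- The factor `2` bounds the weight at `M`. The maximum with `1` covers `M = S`, the choice for
  -- short intervals, where no arrival time is needed because `S` itself is bounded.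
  refine ⟨M₀, hM₀, S₀, 2 * max C 1, by positivity, hM₁, hMS, ?_⟩
  intro S δ σ η η' w k hδ0 hδ4 hδD h hw hη hη0 hηl hηu hmin h0 hE hσ1 hσ
  have hS : (0 : ℝ) ≤ S := h.le
  have hη1 : ∀ s ∈ Icc 0 S, 1 / 2 ≤ η s := fun s hs => by linarith [hηl s hs]
  have hη2 : ∀ s ∈ Icc 0 S, η s ≤ 2 := fun s hs => by linarith [hηu s hs]
  have hdip := hW.le_of_pathEnergy_le h hw hη.continuousOn hηl hδ0 hδ4 ha'.le ha'm hαm.2.le hδD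
    h0 hE hσ
  have hβ0 : 0 ≤ wellDist W b (w S) := wellDist_nonneg (hw S ⟨hS, le_rfl⟩).2
  refine ⟨hdip, fun M hM => ?_⟩
  have hMC : M ∈ Icc 0 S ∧ wellDist W b (w M) ≤ max C 1 * wellDist W b (w S) := by
    rcases hM with ⟨hSS, rfl⟩ | rfl
    · refine ⟨⟨hM₀.le, hMS.trans hSS⟩, ?_⟩
      have hE₀ : pathEnergy W η 0 S w k ≤ wellDist W b a + 1 := by
        have := wellDist_antitone hW.continuous b (hw 0 ⟨le_rfl, hS⟩).1
        linarith
      exact (H S η w k hSS h hη.continuousOn hη1 hη2 (fun s hs => ⟨hdip s hs, (hw s hs).2⟩) hmin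
        hE₀).trans (mul_le_mul_of_nonneg_right (le_max_left _ _) hβ0)
    · refine ⟨⟨hS, le_rfl⟩, ?_⟩
      nlinarith [le_max_right C 1]
  exact hW.le_pathEnergy_of_wellDist_le h hw hη hη0 hη1 hη2 hMC.1 hMC.2

/-- By contradiction: some real `c` below the claimed bound exceeds `G2` along a sequence `ε → 0`.
The slope of the weight at `0` decides which lower energy bound is handed to `false_of_seq`. -/
theorem IsSubquadraticDoubleWell.le_liminf_G2 {W : ℝ → ℝ} {a b q : ℝ}
    (hW : IsSubquadraticDoubleWell W a b q) {αm : ℝ} (hαm : αm ∈ Ioo a b) {δ κ₀ T : ℝ} {ω : ℝ → ℝ}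
    (hδ0 : 0 ≤ δ) (hδ4 : δ ≤ 1 / 4)
    (hδD : δ * wellDist W b a ≤ (wellDist W b ((a + αm) / 2) - wellDist W b αm) / 2)
    (hκ₀ : κ₀ < 0) (hω : IsAdmissibleWeight ω T κ₀ δ) {α : ℝ} {αε βε : ℝ → ℝ}
    (hbd : IsAdmissibleBoundaryData W ω a b T αm κ₀ α αε βε) {v : ℝ → (ℝ →₁[volI T] ℝ)}
    (hv : ∀ ε > 0, IsMinimizerG0 W ω T ε (αε ε) (βε ε) (v ε)) :
    ((weightDeriv ω T 0 * ∫ s in Ioi (0 : ℝ),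
        2 * √(W (profile W b α s)) * deriv (profile W b α) s * s : ℝ) : EReal)
      ≤ liminf (fun ε => G2 W ω b α T ε (αε ε) (βε ε) (v ε)) (𝓝[>] 0) := by
  have hα := hbd.limit_mem
  have hT := hω.T_mem.1
  refine (EReal.ge_of_forall_gt_iff_ge).1 fun c hc => ?_
  rw [EReal.coe_lt_coe_iff] at hc
  refine le_liminf_of_le (by isBoundedDefault) ?_
  by_contra hcon
  rw [not_eventually] at hcon
  obtain ⟨ε, hε, hεc⟩ := exists_seq_forall_of_frequently
    (hcon.and_eventually self_mem_nhdsWithin)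
  have hε0 : ∀ n, 0 < ε n := fun n => (hεc n).2
  have hεz : Tendsto ε atTop (𝓝 0) := hε.mono_right nhdsWithin_le_nhds
  have hβab : ∀ e > 0, βε e ∈ Icc a b := fun e he => Icc_subset_Icc_left hαm.1.le (hbd.right_mem e he)
  choose w k hp hw hw0 hwS hG2 hmin using fun n => (hv (ε n) (hε0 n)).exists_rescaled_path hW hω
    (hε0 n) (hbd.left_mem _ (hε0 n)) (hβab _ (hε0 n)) α hα.2
  set E : ℕ → ℝ := fun n => pathEnergy W (fun s => ω (ε n * s)) 0 (T / ε n) (w n) (k n) with hE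
  have hEc : ∀ n, E n ≤ wellDist W b α + c * ε n := by
    intro n
    have h1 := (hεc n).1
    rw [hG2 n, EReal.coe_le_coe_iff, not_le, div_lt_iff₀ (hε0 n)] at h1
    simp only [hE]
    linarith
  have h0 : Tendsto (fun n => w n 0) atTop (𝓝 α) := by
    simp only [hw0]; exact hbd.left_tendsto.comp hε
  have hrate : Tendsto (fun n => |wellDist W b (w n 0) - wellDist W b α| / ε n) atTop (𝓝 0) := by
    have := (hbd.left_rate.tendsto_div_nhds_zero).comp hε
    refine this.congr fun n => ?_
    simp only [Function.comp, geodDist_eq hW.continuous b, hw0]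
  have hβ : Tendsto (fun n => wellDist W b (w n (T / ε n)) / ε n) atTop (𝓝 0) := by
    have := (hbd.right_rate.tendsto_div_nhds_zero).comp hε
    refine this.congr fun n => ?_
    simp only [Function.comp, hwS]
    rw [geodDist_right hW.continuous (hbd.right_mem _ (hε0 n)).2]
  have hprim : ∀ n, IsPrimitive 0 (T / ε n) (fun s => ω (ε n * s))
      (fun s => ε n * weightDeriv ω T (ε n * s)) := fun n => hω.isPrimitive_rescaled (hε0 n)
  have hηl : ∀ n, ∀ s ∈ Icc 0 (T / ε n), 1 - δ ≤ ω (ε n * s) := fun n s hs =>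
    hω.one_sub_le (IsAdmissibleWeight.mul_mem (hε0 n) hs)
  have hηu : ∀ n, ∀ s ∈ Icc 0 (T / ε n), ω (ε n * s) ≤ 1 + δ := fun n s hs =>
    hω.le_one_add (IsAdmissibleWeight.mul_mem (hε0 n) hs)
  have hη0 : ∀ n, ω (ε n * 0) = 1 := fun n => by rw [mul_zero, hω.zero]
  have hlarge : ∀ M : ℝ, ∀ᶠ n in atTop, M ≤ T / ε n := fun M =>
    (hε.inv_tendsto_nhdsGT_zero.const_mul_atTop hT).eventually_ge_atTop M
  have hfin : ∀ {M C : ℝ}, travelTime W α b ≤ M → 0 < M →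
      (∀ᶠ n in atTop, wellDist W b (w n 0) - C * wellDist W b (w n (T / ε n)) +
        (∫ s in (0 : ℝ)..M, wellDist W b (w n s) * (ε n * weightDeriv ω T (ε n * s))) +
        1 / 2 * (∫ s in (0 : ℝ)..M, flowError W (w n) (k n) s ^ 2) ≤ E n) →
      ((∀ t ∈ Icc 0 T, 0 ≤ weightDeriv ω T t) ∨
        ∃ a' > a, ∀ᶠ n in atTop, ∀ s ∈ Icc 0 M, a' ≤ w n s) → False := by
    intro M C hM hM0 hest hcase
    refine hW.false_of_seq hα hT hω.continuousOn_weightDeriv hε (w := w) (k := k) hM hM0 ?_ ?_ h0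
      hrate hβ hest (.of_forall hEc) (by rwa [← hW.integral_profile_eq hα hM]) hcase
    · filter_upwards [hlarge M] with n hn using (hp n).mono le_rfl hM0.le hn
    · filter_upwards [hlarge M] with n hn s hs using hw n s ⟨hs.1, hs.2.trans hn⟩
  have hτ := travelTime_nonneg (W := W) hα.2
  by_cases hsl : -κ₀ ≤ weightDeriv ω T 0
  · have hpos : ∀ t ∈ Icc 0 T, 0 ≤ weightDeriv ω T t := fun t ht => by
      linarith [hω.slope_ge hsl t ht]
    -- The summand `1` keeps `M` positive when `α = b`.
    refine hfin (M := travelTime W α b + 1) (C := 2) (by linarith) (by linarith) ?_ (Or.inl hpos)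
    filter_upwards [hlarge (travelTime W α b + 1)] with n hn
    exact hW.le_pathEnergy_of_deriv_nonneg (hp n) (hw n) (hprim n) (hη0 n)
      (fun s hs => by linarith [hηl n s hs]) (fun s hs => by linarith [hηu n s hs])
      (fun s hs => mul_nonneg (hε0 n).le (hpos _ (IsAdmissibleWeight.mul_mem (hε0 n) hs)))
      ⟨by linarith, hn⟩
  · obtain ⟨M₀, hM₀, S₀, C, hC, hM₁, hMS, H⟩ := hW.exists_lower_bound hαm (travelTime W α b)
    have hd : 0 < wellDist W b ((a + αm) / 2) - wellDist W b αm :=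
      sub_pos.2 (hW.wellDist_lt (by linarith [hαm.1]) (by linarith [hαm.1]) hαm.2.le)
    have hσ : Tendsto (fun n => |wellDist W b (w n 0) - wellDist W b α| + c * ε n) atTop (𝓝 0) := by
      have h1 := ((((continuous_wellDist hW.continuous b).tendsto α).comp h0).sub_const
        (wellDist W b α)).abs
      simpa [Function.comp_def] using h1.add (hεz.const_mul c)
    have hβz : Tendsto (fun n => wellDist W b (w n (T / ε n))) atTop (𝓝 0) := by
      have := hβ.mul hεz
      rw [mul_zero] at this
      refine this.congr fun n => ?_
      exact div_mul_cancel₀ _ (hε0 n).ne'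
    have hsum := hσ.add hβz
    rw [add_zero] at hsum
    have hev : ∀ᶠ n in atTop, S₀ ≤ T / ε n ∧
        ((∀ s ∈ Icc 0 (T / ε n), (a + αm) / 2 ≤ w n s) ∧
        wellDist W b (w n 0) - C * wellDist W b (w n (T / ε n)) +
          (∫ s in (0 : ℝ)..M₀, wellDist W b (w n s) * (ε n * weightDeriv ω T (ε n * s))) +
          1 / 2 * (∫ s in (0 : ℝ)..M₀, flowError W (w n) (k n) s ^ 2) ≤ E n) := by
      filter_upwards [hlarge S₀, hσ.eventually_le_const one_pos,
        hsum.eventually_le_const (half_pos hd)] with n h1 h2 h3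
      have h4 := neg_abs_le (wellDist W b (w n 0) - wellDist W b α)
      obtain ⟨h5, h6⟩ := H (T / ε n) δ _ (fun s => ω (ε n * s)) _ (w n) (k n) hδ0 hδ4 hδD (hp n)
        (hw n) (hprim n) (hη0 n) (hηl n) (hηu n) (hmin n)
        (by rw [hw0]; exact ((hbd.dichotomy _ (hε0 n)).resolve_right hsl).1)
        (by linarith [hEc n]) h2 h3
      exact ⟨h1, h5, h6 M₀ (Or.inl ⟨h1, rfl⟩)⟩
    refine hfin hM₁ hM₀ (hev.mono fun n hn => hn.2.2)
      (Or.inr ⟨(a + αm) / 2, by linarith [hαm.1], ?_⟩)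
    filter_upwards [hev] with n hn s hs
    exact hn.2.1 s ⟨hs.1, hs.2.trans (hMS.trans hn.1)⟩

theorem IsSubquadraticDoubleWell.exists_le_G2 {W : ℝ → ℝ} {a b q : ℝ}
    (hW : IsSubquadraticDoubleWell W a b q) {αm : ℝ} (hαm : αm ∈ Ioo a b) {δ κ₀ : ℝ}
    (hδ0 : 0 ≤ δ) (hδ4 : δ ≤ 1 / 4)
    (hδD : δ * wellDist W b a ≤ (wellDist W b ((a + αm) / 2) - wellDist W b αm) / 2)
    (hκ₀ : κ₀ < 0) (L : ℝ) :
    ∃ M : ℝ, 0 < M ∧ ∀ (T : ℝ) (ω : ℝ → ℝ), IsAdmissibleWeight ω T κ₀ δ → c1Norm ω T ≤ L →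
      ∀ (α : ℝ) (αε βε : ℝ → ℝ), IsAdmissibleBoundaryData W ω a b T αm κ₀ α αε βε →
      ∀ ε > 0, ∀ v : ℝ →₁[volI T] ℝ, IsMinimizerG0 W ω T ε (αε ε) (βε ε) v →
        ((-M * (1 + (geodDist W (αε ε) α + geodDist W (βε ε) b) / ε) : ℝ) : EReal)
          ≤ G2 W ω b α T ε (αε ε) (βε ε) v := by
  obtain ⟨M₀, hM₀, S₀, C, hC, -, hMS, H⟩ := hW.exists_lower_bound hαm 0
  set Da := wellDist W b a with hDa
  have hDa0 : 0 ≤ Da := wellDist_nonneg hW.lt.le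
  set d := wellDist W b ((a + αm) / 2) - wellDist W b αm with hd
  have hd0 : 0 < d :=
    sub_pos.2 (hW.wellDist_lt (by linarith [hαm.1]) (by linarith [hαm.1]) hαm.2.le)
  set σ₀ := min 1 (d / 2) with hσ₀
  have hσ₀0 : 0 < σ₀ := lt_min one_pos (half_pos hd0)
  have hS₀ : 0 < S₀ := hM₀.trans_le hMS
  have hK1 : 0 ≤ Da * |L| * S₀ := by positivity
  have hK2 : 0 ≤ Da / σ₀ := by positivity
  -- The summands come from the different cases: `2` from increasing weights and from replacing
  -- `α_ε` by `α`, `Da / σ₀` from large boundary errors, `C` from the terminal datum, and the last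
  -- from the integral of `D(w) η'`.
  refine ⟨2 + Da / σ₀ + C + Da * |L| * S₀, by positivity, ?_⟩
  intro T ω hω hL α αε βε hbd ε hε v hv
  have hα := hbd.limit_mem
  have hT := hω.T_mem.1
  have hβm := hbd.right_mem ε hε
  obtain ⟨w, k, hp, hw, hw0, hwS, hG2, hmin⟩ := hv.exists_rescaled_path hW hω hε
    (hbd.left_mem _ hε) (Icc_subset_Icc_left hαm.1.le hβm) α hα.2
  rw [hG2, EReal.coe_le_coe_iff, le_div_iff₀ hε, geodDist_eq hW.continuous b,
    geodDist_right hW.continuous hβm.2, ← hw0, ← hwS]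
  set S := T / ε with hS
  have hS0 : 0 ≤ S := hp.le
  set E := pathEnergy W (fun s => ω (ε * s)) 0 S w k with hE
  set dα := |wellDist W b (w 0) - wellDist W b α| with hdα
  set β := wellDist W b (w S) with hβ
  have hdα0 : 0 ≤ dα := abs_nonneg _
  have hβ0 : 0 ≤ β := wellDist_nonneg (hw S ⟨hS0, le_rfl⟩).2
  have e : -(2 + Da / σ₀ + C + Da * |L| * S₀) * (1 + (dα + β) / ε) * ε =
      -(2 + Da / σ₀ + C + Da * |L| * S₀) * (ε + (dα + β)) := by field_simp
  rw [e]
  have hx : 0 ≤ dα + β := add_nonneg hdα0 hβ0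
  have p1 : 0 ≤ Da / σ₀ * ε := by positivity
  have p2 : 0 ≤ Da / σ₀ * (dα + β) := by positivity
  have p3 : 0 ≤ C * ε := by positivity
  have p4 : 0 ≤ C * dα := by positivity
  have p5 : 0 ≤ C * β := by positivity
  have p6 : 0 ≤ Da * |L| * S₀ * ε := by positivity
  have p7 : 0 ≤ Da * |L| * S₀ * (dα + β) := by positivity
  have hprim := hω.isPrimitive_rescaled hε
  have hηl : ∀ s ∈ Icc 0 S, 1 - δ ≤ ω (ε * s) := fun s hs =>
    hω.one_sub_le (IsAdmissibleWeight.mul_mem hε hs)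
  have hηu : ∀ s ∈ Icc 0 S, ω (ε * s) ≤ 1 + δ := fun s hs =>
    hω.le_one_add (IsAdmissibleWeight.mul_mem hε hs)
  have hη0 : ω (ε * 0) = 1 := by rw [mul_zero, hω.zero]
  have hα1 := neg_abs_le (wellDist W b (w 0) - wellDist W b α)
  rw [← hdα] at hα1
  by_cases hsl : -κ₀ ≤ weightDeriv ω T 0
  · have hpos : ∀ t ∈ Icc 0 T, 0 ≤ weightDeriv ω T t := fun t ht => by
      linarith [hω.slope_ge hsl t ht]
    -- With `M = 0` both integrals disappear, leaving `D(w 0) - 2 D(w S)`.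
    have h1 := hW.le_pathEnergy_of_deriv_nonneg (M := 0) hp hw hprim hη0
      (fun s hs => by linarith [hηl s hs]) (fun s hs => by linarith [hηu s hs])
      (fun s hs => mul_nonneg hε.le (hpos _ (IsAdmissibleWeight.mul_mem hε hs))) ⟨le_rfl, hS0⟩
    simp only [intervalIntegral.integral_same, mul_zero, add_zero] at h1
    linarith
  rcases le_or_gt (wellDist W b α) E with hEα | hEα
  · linarith
  have hE0 : 0 ≤ E := pathEnergy_nonneg hW.nonneg hS0 (fun s hs => by linarith [hηl s hs]) w k
  -- For small errors, the assumption `E < D(α)` bounds the excess of the energy over `D(w 0)` by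
  -- `dα`, so the path is almost minimal. For large errors the trivial bound `E - D(α) ≥ -Da`
  -- suffices.
  rcases le_or_gt (dα + β) σ₀ with hsm | hbig
  · obtain ⟨-, h1⟩ := H S δ dα (fun s => ω (ε * s)) _ w k hδ0 hδ4 hδD hp hw hprim hη0 hηl hηu hmin
      (by rw [hw0]; exact ((hbd.dichotomy _ hε).resolve_right hsl).1) (by linarith)
      (by linarith [min_le_left 1 (d / 2)]) (hsm.trans (min_le_right _ _))
    -- A time at most `S₀` is needed, so that the integral of `D(w) η'` is `O(ε)` uniformly.
    have hcase : ∃ M, (S₀ ≤ S ∧ M = M₀ ∨ M = S) ∧ 0 ≤ M ∧ M ≤ S ∧ M ≤ S₀ := by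
      rcases le_or_gt S₀ S with h | h
      · exact ⟨M₀, Or.inl ⟨h, rfl⟩, hM₀.le, hMS.trans h, hMS⟩
      · exact ⟨S, Or.inr rfl, hS0, le_rfl, h.le⟩
    obtain ⟨M, hM, hM0, hMS', hMS₀⟩ := hcase
    have h2 := h1 M hM
    have h3 : 0 ≤ ∫ s in (0 : ℝ)..M, flowError W w k s ^ 2 :=
      intervalIntegral.integral_nonneg hM0 fun s _ => sq_nonneg _
    have h4 := hW.neg_le_integral_wellDist_mul (w := w)
      (g := fun s => ε * weightDeriv ω T (ε * s)) (B := ε * |L|) hM0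
      (fun s hs => hw s ⟨hs.1, hs.2.trans hMS'⟩) (fun s hs => by
        rw [abs_mul, abs_of_pos hε]
        refine mul_le_mul_of_nonneg_left ?_ hε.le
        exact (hω.abs_weightDeriv_le hL
          (IsAdmissibleWeight.mul_mem hε ⟨hs.1, hs.2.trans hMS'⟩)).trans (le_abs_self L))
    have h5 : Da * (ε * |L|) * M ≤ Da * (ε * |L|) * S₀ :=
      mul_le_mul_of_nonneg_left hMS₀ (by positivity)
    have h6 : Da * (ε * |L|) * S₀ = Da * |L| * S₀ * ε := by ring
    linarith
  · have h1 : wellDist W b α ≤ Da := wellDist_antitone hW.continuous b hα.1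
    have h2 : Da ≤ Da / σ₀ * (dα + β) := by
      rw [div_mul_eq_mul_div, le_div_iff₀ hσ₀0]
      exact mul_le_mul_of_nonneg_left hbig.le hDa0
    linarith

theorem propositionp (W : ℝ → ℝ) (a b q : ℝ) (hW : IsSubquadraticDoubleWell W a b q)
    (αm : ℝ) (hαm : αm ∈ Ioo a b) :
    ∃ δ : ℝ, 0 < δ ∧ ∀ κ₀ : ℝ, κ₀ < 0 →
      -- the liminf inequality
      (∀ (T : ℝ) (ω : ℝ → ℝ), IsAdmissibleWeight ω T κ₀ δ →
        ∀ (α : ℝ) (αε βε : ℝ → ℝ), IsAdmissibleBoundaryData W ω a b T αm κ₀ α αε βε →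
        ∀ v : ℝ → (ℝ →₁[volI T] ℝ),
          (∀ ε > 0, IsMinimizerG0 W ω T ε (αε ε) (βε ε) (v ε)) →
          ((weightDeriv ω T 0 *
            ∫ s in Ioi (0 : ℝ),
              2 * √(W (profile W b α s)) * deriv (profile W b α) s * s : ℝ) : EReal)
            ≤ liminf (fun ε => G2 W ω b α T ε (αε ε) (βε ε) (v ε)) (𝓝[>] 0)) ∧
      -- the quantitative lower bound; `ρ` is the speed of convergence of `βε` to `b`
      (∀ (L : ℝ) (ρ : ℝ → ℝ), Tendsto ρ (𝓝[>] 0) (𝓝 0) →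
        ∃ M : ℝ, 0 < M ∧ ∃ ε₀ : ℝ, 0 < ε₀ ∧
          ∀ (T : ℝ) (ω : ℝ → ℝ), IsAdmissibleWeight ω T κ₀ δ → c1Norm ω T ≤ L →
          ∀ (α : ℝ) (αε βε : ℝ → ℝ), IsAdmissibleBoundaryData W ω a b T αm κ₀ α αε βε →
            (∀ ε > 0, b - βε ε ≤ ρ ε) →
            ∀ ε ∈ Ioo 0 ε₀, ∀ v : ℝ →₁[volI T] ℝ,
              IsMinimizerG0 W ω T ε (αε ε) (βε ε) v →
              ((-M * (1 + (geodDist W (αε ε) α + geodDist W (βε ε) b) / ε) : ℝ) : EReal)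
                ≤ G2 W ω b α T ε (αε ε) (βε ε) v) := by
  have hd : 0 < wellDist W b ((a + αm) / 2) - wellDist W b αm :=
    sub_pos.2 (hW.wellDist_lt (by linarith [hαm.1]) (by linarith [hαm.1]) hαm.2.le)
  have hDa : 0 < wellDist W b a := by
    simpa using hW.wellDist_lt le_rfl hW.lt le_rfl
  set d := wellDist W b ((a + αm) / 2) - wellDist W b αm with hd'
  -- This `δ` makes the loss `δ D(a)` from the weight at most half of what a dip from `αm` to `(a +
  -- αm) / 2` costs.
  have hδ0 : 0 < min (1 / 4) (d / 2 / wellDist W b a) := by positivity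
  have hδD : min (1 / 4) (d / 2 / wellDist W b a) * wellDist W b a ≤ d / 2 := by
    rw [← le_div_iff₀ hDa]; exact min_le_right _ _
  refine ⟨min (1 / 4) (d / 2 / wellDist W b a), hδ0, fun κ₀ hκ₀ => ⟨?_, ?_⟩⟩
  · intro T ω hω α αε βε hbd v hv
    exact hW.le_liminf_G2 hαm hδ0.le (min_le_left _ _) hδD hκ₀ hω hbd hv
  · intro L ρ _
    obtain ⟨M, hM, H⟩ := hW.exists_le_G2 hαm hδ0.le (min_le_left _ _) hδD hκ₀ L
    -- The estimate holds for every `ε > 0`, so any positive threshold serves.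
    exact ⟨M, hM, 1, one_pos, fun T ω hω hL α αε βε hbd _ ε hε v hv =>
      H T ω hω hL α αε βε hbd ε hε.1 v hv⟩
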